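/- **Setting.** A $P$-variable is a measurable function $W:\Omega_1\times\Omega_1\times\Omega_2\to\mathbb R$, where $(\Omega_1,\mu_1)$, $(\Omega_2,\mu_2)$ are probability spaces. For $k\ge 1$ its $k$-profile $\mathcal S_k(W)$ is the set of all laws on $\mathbb R^{2k+1}$ (under $\mu_1\otimes\mu_1\otimes\mu_2$) of the random vectors $$(x_1,x_2,x_{12})\mapsto\bigl(f_1(x_1),f_1(x_2),\dots,f_k(x_1),f_k(x_2),W(x_1,x_2,x_{12})\bigr),$$ where $f_1,\dots,f_k:\Omega_1\to\mathbb R$ are measurable with values in $[-1,1]$ almost everywhere. For two $P$-variables, possibly on different probability spaces, put $$d_M(W,U)=\sum_{k=1}^\infty 2^{-k}d_H(\mathcal S_k(W),\mathcal S_k(U)),$$ where $d_H$ is the Hausdorff distance with respect to the Lévy–Prokhorov metric $d_{\mathcal{LP}}$ of Euclidean $\mathbb R^{2k+1}$. A probability graphon is a Markov kernel $V$ from $[0,1]^2$ to $\mathbb R$; write $V(S\times T;\cdot)=\int_{S\times T}V(x,y;\cdot)\,dx\,dy$ and $V^\varphi(x,y;\cdot)=V(\varphi(x),\varphi(y);\cdot)$.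 The unlabelled cut distance is $$\delta_\square(U,V)=\inf_{\varphi}\ \sup_{S,T\subseteq[0,1]\text{ measurable}}d_{\mathcal{LP}}\bigl(U(S\times T;\cdot),V^\varphi(S\times T;\cdot)\bigr),$$ the infimum being over all bijective Lebesgue-measure-preserving maps $\varphi:[0,1]\to[0,1]$. The probability graphon $\widetilde W$ associated with a $P$-variable $W$ on $[0,1]\times[0,1]\times\Omega_2$ sends $(x_1,x_2)$ to the law of $W(x_1,x_2,\cdot)$. A finite weighted (possibly directed) graph $H$ on the vertex set $[n]$, $n\ge1$, with real adjacency matrix $A$, is regarded as the $P$-variable $(i,j,\omega)\mapsto A_{ij}$ on $[n]\times[n]\times\Omega$, where $[n]$ carries the uniform measure and $\Omega$ is a fixed probability space. Its step representation $W_H$ on $[0,1]\times[0,1]\times[0,1]$ takes the value $A_{ij}$ when $x_1$ lies in the $i$-th and $x_2$ in the $j$-th of the $n$ consecutive intervals of length $1/n$ of $[0,1]$. **Theorem.** Let $(H_n)_n$ be a sequence of finite weighted graphs with $|V(H_n)|\to\infty$. Then convergence of $(H_n)_n$, as $P$-variables, in $d_M$ is equivalent to convergence of $(\widetilde W_{H_n})_n$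 in $\delta_\square$. Precisely: 1. there is a $P$-variable $W$ (on some probability spaces) with $d_M(H_n,W)\to0$ if and only if there is a probability graphon $V$ with $\delta_\square(\widetilde W_{H_n},V)\to0$; 2. $(H_n)_n$ is Cauchy for $d_M$ if and only if $(\widetilde W_{H_n})_n$ is Cauchy for $\delta_\square$; 3. for every probability space $\Omega_2$ and every $P$-variable $W$ on $[0,1]\times[0,1]\times\Omega_2$, $d_M(H_n,W)\to0$ if and only if $\delta_\square(\widetilde W_{H_n},\widetilde W)\to0$. -/

import Mathlib

open MeasureTheory ProbabilityTheory Filter Topology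
open scoped ENNReal unitInterval

universe u v w

noncomputable section

/-! ### P-variables and the P-variables metric -/

/-- A `P`-variable on `Ω₁ × Ω₁ × Ω₂`: a real-valued measurable function on the product of the
probability spaces `(Ω₁, μ₁)`, `(Ω₁, μ₁)` and `(Ω₂, μ₂)`. -/
structure PVariable {Ω₁ : Type u} {Ω₂ : Type v} [MeasurableSpace Ω₁] [MeasurableSpace Ω₂]
    (μ₁ : Measure Ω₁) (μ₂ : Measure Ω₂) where
  toFun : Ω₁ × Ω₁ × Ω₂ → ℝ
  measurable_toFun : Measurable toFun

namespace PVariable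

variable {Ω₁ : Type u} {Ω₂ : Type v} [MeasurableSpace Ω₁] [MeasurableSpace Ω₂]
  {μ₁ : Measure Ω₁} {μ₂ : Measure Ω₂}

/-- Euclidean space of dimension `2k+1`. The coordinates are indexed by `Fin k ⊕ Fin k ⊕ Unit`:
first the `k` coordinates for the `f_i(x₁)`, then the `k` coordinates for the `f_i(x₂)`, then the
coordinate for `W(x₁, x₂, x₁₂)`. (This only permutes the coordinates of `ℝ^(2k+1)`.) -/
abbrev ProfileSpace (k : ℕ) : Type := EuclideanSpace ℝ (Fin k ⊕ Fin k ⊕ Unit)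

/-- The random vector formed by `f_i ⊗ 1 ⊗ 1`, `1 ⊗ f_i ⊗ 1` (for `i < k`) and `W`. -/
def profileVector (W : PVariable μ₁ μ₂) {k : ℕ} (f : Fin k → Ω₁ → ℝ) (p : Ω₁ × Ω₁ × Ω₂) :
    ProfileSpace k :=
  WithLp.toLp 2 (Sum.elim (fun i => f i p.1)
    (Sum.elim (fun i => f i p.2.1) (fun _ => W.toFun p)))

/-- The measure generated by `W` through the test functions `f_1, …, f_k`. -/
def generatedMeasure (W : PVariable μ₁ μ₂) {k : ℕ} (f : Fin k → Ω₁ → ℝ) :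
    Measure (ProfileSpace k) :=
  (μ₁.prod (μ₁.prod μ₂)).map (W.profileVector f)

/-- The `k`-profile of `W`: all measures generated by `W` through `k` measurable test functions
with values in `[-1, 1]` almost everywhere, as a set of points of the space of measures on
`ℝ^(2k+1)` equipped with the Lévy–Prokhorov metric. -/
def profile (W : PVariable μ₁ μ₂) (k : ℕ) : Set (LevyProkhorov (Measure (ProfileSpace k))) :=
  {ν | ∃ f : Fin k → Ω₁ → ℝ, (∀ i, Measurable (f i)) ∧
    (∀ i, ∀ᵐ x ∂μ₁, f i x ∈ Set.Icc (-1 : ℝ) 1) ∧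
    ν = LevyProkhorov.ofMeasure (W.generatedMeasure f)}

/-- The `P`-variables metric `d_M(W, U) = ∑_{k ≥ 1} 2^{-k} d_H(S_k(W), S_k(U))`, where `d_H` is the
Hausdorff distance with respect to the Lévy–Prokhorov metric. The two `P`-variables may live on
different probability spaces. -/
def dM {Ω₁' : Type*} {Ω₂' : Type*} [MeasurableSpace Ω₁'] [MeasurableSpace Ω₂']
    {ν₁ : Measure Ω₁'} {ν₂ : Measure Ω₂'} (W : PVariable μ₁ μ₂) (U : PVariable ν₁ ν₂) : ℝ≥0∞ :=
  ∑' k : ℕ, (2⁻¹ : ℝ≥0∞) ^ (k + 1) *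
    Metric.hausdorffEDist (W.profile (k + 1)) (U.profile (k + 1))

/-- The probability graphon of a `P`-variable: `(x₁, x₂)` is sent to the law of the random
variable `W(x₁, x₂, ·)`. Probability graphons on `Ω₁` are Markov kernels from `Ω₁ × Ω₁` to `ℝ`. -/
def graphon [SFinite μ₂] (W : PVariable μ₁ μ₂) : Kernel (Ω₁ × Ω₁) ℝ where
  toFun x := μ₂.map (fun z => W.toFun (x.1, x.2, z))
  measurable' := by
    have hW : Measurable fun q : (Ω₁ × Ω₁) × Ω₂ => W.toFun (q.1.1, q.1.2, q.2) :=
      W.measurable_toFun.comp (by fun_prop)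
    refine Measure.measurable_of_measurable_coe _ fun s hs => ?_
    have h : ∀ x : Ω₁ × Ω₁, μ₂.map (fun z => W.toFun (x.1, x.2, z)) s =
        μ₂ (Prod.mk x ⁻¹' ((fun q : (Ω₁ × Ω₁) × Ω₂ => W.toFun (q.1.1, q.1.2, q.2)) ⁻¹' s)) :=
      fun x => Measure.map_apply (hW.comp measurable_prodMk_left) hs
    simp_rw [h]
    exact measurable_measure_prodMk_left (hW hs)

instance [IsProbabilityMeasure μ₂] (W : PVariable μ₁ μ₂) : IsMarkovKernel W.graphon :=
  ⟨fun x => Measure.isProbabilityMeasure_map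
    (W.measurable_toFun.comp (by fun_prop : Measurable fun z : Ω₂ => (x.1, x.2, z))).aemeasurable⟩

end PVariable

/-! ### The unlabelled cut distance for probability graphons on `[0, 1]` -/

namespace ProbGraphon

/-- The measure `W(S × T; ·) = ∫_{S × T} W(x, y; ·) dx dy` on `ℝ`. -/
def integrate (W : Kernel (I × I) ℝ) (S T : Set I) : Measure ℝ :=
  ((volume : Measure (I × I)).restrict (S ×ˢ T)).bind W

/-- The cut semi-distance: the supremum over measurable `S, T ⊆ [0, 1]` of the Lévy–Prokhorov
distance between `U(S × T; ·)` and `W(S × T; ·)`. -/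
def cutDist (U W : Kernel (I × I) ℝ) : ℝ≥0∞ :=
  ⨆ (S : Set I) (T : Set I) (_ : MeasurableSet S) (_ : MeasurableSet T),
    levyProkhorovEDist (integrate U S T) (integrate W S T)

/-- The relabelling `W^φ(x, y; ·) = W(φ x, φ y; ·)`. -/
def relabel (W : Kernel (I × I) ℝ) (φ : I → I) (hφ : Measurable φ) : Kernel (I × I) ℝ :=
  W.comap (Prod.map φ φ) (hφ.prodMap hφ)

/-- The unlabelled cut distance `δ_□(U, W) = inf_φ d_□(U, W^φ)`, over all bijective
measure-preserving maps `φ` from `[0, 1]` to itself. -/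
def unlabelledCutDist (U W : Kernel (I × I) ℝ) : ℝ≥0∞ :=
  ⨅ (φ : I → I) (hφ : MeasurePreserving φ volume volume) (_ : Function.Bijective φ),
    cutDist U (relabel W φ hφ.measurable)

end ProbGraphon

/-! ### Weighted graphs -/

/-- A finite weighted (possibly directed) graph: a non-empty vertex set `[n]`, a set of ordered
pairs as edge set, and a real weight function on ordered pairs of vertices which is non-zero
exactly on the edges. -/
structure WeightedGraph where
  order : ℕ
  order_pos : 0 < order
  edges : Set (Fin order × Fin order)
  weight : Fin order → Fin order → ℝ
  weight_ne_zero_iff : ∀ i j, weight i j ≠ 0 ↔ (i, j) ∈ edges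

namespace WeightedGraph

/-- The adjacency matrix of a weighted graph. -/
def adjMatrix (H : WeightedGraph) : Matrix (Fin H.order) (Fin H.order) ℝ :=
  Matrix.of H.weight

/-- A weighted graph on `[n]` as a `P`-variable on `[n] × [n] × Ω`, with the uniform measure
on `[n]`: the adjacency matrix, constant in the third variable. -/
def toPVariable (H : WeightedGraph) {Ω : Type*} [MeasurableSpace Ω] (P : Measure Ω) :
    PVariable (uniformOn (Set.univ : Set (Fin H.order))) P where
  toFun p := H.adjMatrix p.1 p.2.1
  measurable_toFun :=
    (measurable_of_finite fun q : Fin H.order × Fin H.order => H.adjMatrix q.1 q.2).comp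
      (measurable_fst.prodMk measurable_snd.fst)

/-- The index of the interval of length `1/n` that contains `x`: the `i`-th one (counted from
`0`) if `x ∈ (i/n, (i+1)/n]`, and the first one if `x = 0`. -/
def stepIndex (H : WeightedGraph) (x : I) : Fin H.order :=
  ⟨⌈(x : ℝ) * H.order⌉₊ - 1, by
    have h1 : ⌈(x : ℝ) * H.order⌉₊ ≤ H.order :=
      Nat.ceil_le.2 (mul_le_of_le_one_left (Nat.cast_nonneg _) x.2.2)
    have h2 := H.order_pos
    omega⟩

lemma measurable_stepIndex (H : WeightedGraph) : Measurable H.stepIndex := by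
  refine measurable_to_countable' fun i => ?_
  have hm : Measurable fun x : I => ⌈(x : ℝ) * H.order⌉₊ - 1 :=
    (measurable_of_countable fun m : ℕ => m - 1).comp
      (Nat.measurable_ceil.comp (measurable_subtype_coe.mul_const _))
  have : H.stepIndex ⁻¹' {i} = (fun x : I => ⌈(x : ℝ) * H.order⌉₊ - 1) ⁻¹' {(i : ℕ)} := by
    ext x
    simp [stepIndex, Fin.ext_iff]
  rw [this]
  exact hm (measurableSet_singleton _)

/-- The step representation `W_H` on `[0,1] × [0,1] × [0,1]`, equal to the entry `A_{ij}` of the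
adjacency matrix on the `(i, j)`-th square of side `1/n`, for every `x₁₂ ∈ [0, 1]`. -/
def stepPVariable (H : WeightedGraph) :
    PVariable (volume : Measure I) (volume : Measure I) where
  toFun p := H.adjMatrix (H.stepIndex p.1) (H.stepIndex p.2.1)
  measurable_toFun :=
    (measurable_of_finite fun q : Fin H.order × Fin H.order => H.adjMatrix q.1 q.2).comp
      ((H.measurable_stepIndex.comp measurable_fst).prodMk
        (H.measurable_stepIndex.comp measurable_snd.fst))

/-- The probability graphon associated with the step representation. -/
def stepGraphon (H : WeightedGraph) : Kernel (I × I) ℝ := H.stepPVariable.graphon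

end WeightedGraph

end

/-!
The common language of both metrics is that of colourings. For a kernel `κ` on a probability space,
a measurable partition of the space into `m` classes yields `m²` block laws
`κ(S × T; ·) = ∫_{S × T} κ dμ dμ`. One kernel imitates another one (`Approximates`, and `Imitates`
along a filter) if every `m`-colouring on the first space is matched by an `m`-colouring on the
second space such that all block laws are close in the Lévy–Prokhorov sense. Both kinds of
convergence are equivalent to mutual imitation with error tending to zero, for every `m`.

*The metric `d_M`.* A colouring is coded by the single test function `x ↦ c(x) / m`, and decoded
from any function that generates a nearby measure, so closeness of the `1`-profiles implies imitation
(`PVariable.approximates_of_dM_lt`). Conversely, `k` test functions with values in `[-1, 1]` are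
rounded to a grid, which makes them functions of a colouring, and the generated measures are
determined by its block laws (`PVariable.exists_mem_profile_close`).

*The unlabelled cut distance.* A relabelling transports colourings, so closeness implies imitation.
For the converse, finitely many Lipschitz test functions `g` control the Lévy–Prokhorov distance of
tight measures (`exists_test_functions`), which reduces the matter to the bounded kernels `∫ g dκ`.
The supremum of the energies of colourings with `4 ^ t` colours is bounded and increasing in `t`, so
it almost stabilises for some bounded `t`, simultaneously for both kernels because they imitate each
other. A colouring that nearly attains the supremum is weakly regular, and so is the colouring that
imitates it (`exists_cutRegular_pair`). The two colourings of `[0, 1]` have nearly equal class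
sizes, hence a permutation of short intervals matches them up to a small set
(`exists_measurePreserving_matching`), and that permutation brings the two kernels close in the cut
distance (`ProbGraphon.exists_unlabelledCutDist_le`).

*Graphs.* A graph is imitated by its step representation exactly, by pulling colourings back. In the
other direction, a colouring of `[0, 1]` induces a fractional colouring of the vertices, which is
rounded with error `O(n ^ (-1 / 2))` by a greedy vector-balancing argument (`exists_rounding`). This
is where `|V(H_n)| → ∞` is used.

*Limits.* The unlabelled cut distance is complete: consecutive terms of a fast Cauchy sequence are
aligned by relabellings, the joint laws of position and value are tight, and Prokhorov's theorem and
disintegration yield the limit (`ProbGraphon.exists_unlabelledCutDist_limit`). Every probability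
graphon is the graphon of a `P`-variable, since a Markov kernel is the law of a measurable function
of a point and a uniform variable (`exists_pVariable_approximates`). The tightness that the converse
for the cut distance needs follows from imitation by a fixed kernel, or by a member of the sequence.
-/

noncomputable section

/-! ### The Lévy–Prokhorov relation -/

lemma exists_ofReal_le {r : ℝ≥0∞} (hr : 0 < r) : ∃ ε : ℝ, 0 < ε ∧ ENNReal.ofReal ε ≤ r := by
  rcases eq_or_ne r ∞ with rfl | hr'
  · exact ⟨1, one_pos, le_top⟩
  · exact ⟨r.toReal, ENNReal.toReal_pos hr.ne' hr', (ENNReal.ofReal_toReal hr').le⟩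

/-- The two inequalities in the definition of the Lévy–Prokhorov distance, at a real radius `ε`:
being `LPClose` at `ε` sits between `levyProkhorovEDist μ ν < ε` and
`levyProkhorovEDist μ ν ≤ ε`. -/
def LPClose {X : Type*} [MeasurableSpace X] [PseudoEMetricSpace X] (ε : ℝ) (μ ν : Measure X) :
    Prop :=
  ∀ B, MeasurableSet B → μ B ≤ ν (Metric.thickening ε B) + ENNReal.ofReal ε ∧
    ν B ≤ μ (Metric.thickening ε B) + ENNReal.ofReal ε

namespace LPClose

section General

variable {X : Type*} [MeasurableSpace X] [PseudoEMetricSpace X] {ε δ : ℝ} {μ ν ρ : Measure X}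

lemma symm (h : LPClose ε μ ν) : LPClose ε ν μ := fun B hB => (h B hB).symm

lemma mono (h : LPClose ε μ ν) (hεδ : ε ≤ δ) : LPClose δ μ ν := fun B hB =>
  ⟨(h B hB).1.trans (add_le_add (measure_mono (Metric.thickening_mono hεδ B))
      (ENNReal.ofReal_le_ofReal hεδ)),
    (h B hB).2.trans (add_le_add (measure_mono (Metric.thickening_mono hεδ B))
      (ENNReal.ofReal_le_ofReal hεδ))⟩

lemma refl (hε : 0 < ε) (μ : Measure X) : LPClose ε μ μ := fun B _ => by
  have : μ B ≤ μ (Metric.thickening ε B) + ENNReal.ofReal ε :=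
    (measure_mono (Metric.self_subset_thickening hε B)).trans le_self_add
  exact ⟨this, this⟩

lemma trans [OpensMeasurableSpace X] (hε : 0 ≤ ε) (hδ : 0 ≤ δ) (h : LPClose ε μ ν)
    (h' : LPClose δ ν ρ) : LPClose (ε + δ) μ ρ := by
  have key : ∀ {a b : ℝ} {μ ν ρ : Measure X}, 0 ≤ a → 0 ≤ b →
      (∀ B, MeasurableSet B → μ B ≤ ν (Metric.thickening a B) + ENNReal.ofReal a) →
      (∀ B, MeasurableSet B → ν B ≤ ρ (Metric.thickening b B) + ENNReal.ofReal b) →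
      ∀ B, MeasurableSet B → μ B ≤ ρ (Metric.thickening (a + b) B) + ENNReal.ofReal (a + b) := by
    intro a b μ ν ρ ha hb h1 h2 B hB
    calc μ B ≤ ν (Metric.thickening a B) + ENNReal.ofReal a := h1 B hB
      _ ≤ (ρ (Metric.thickening b (Metric.thickening a B)) + ENNReal.ofReal b)
            + ENNReal.ofReal a := by
          gcongr
          exact h2 _ Metric.isOpen_thickening.measurableSet
      _ ≤ ρ (Metric.thickening (a + b) B) + ENNReal.ofReal (a + b) := by
          rw [ENNReal.ofReal_add ha hb, add_assoc, add_comm (ENNReal.ofReal b)]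
          gcongr
          rw [add_comm a b]
          exact Metric.thickening_thickening_subset _ _ _
  intro B hB
  refine ⟨key hε hδ (fun B hB => (h B hB).1) (fun B hB => (h' B hB).1) B hB, ?_⟩
  rw [add_comm ε δ]
  exact key hδ hε (fun B hB => (h' B hB).2) (fun B hB => (h B hB).2) B hB

lemma edist_le (hε : 0 ≤ ε) (h : LPClose ε μ ν) : levyProkhorovEDist μ ν ≤ ENNReal.ofReal ε :=
  sInf_le fun B hB => by simpa [ENNReal.toReal_ofReal hε] using h B hB

lemma of_edist_lt (hε : 0 ≤ ε) (h : levyProkhorovEDist μ ν < ENNReal.ofReal ε) :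
    LPClose ε μ ν := fun B hB => by
  have h1 := left_measure_le_of_levyProkhorovEDist_lt h hB
  have h2 := right_measure_le_of_levyProkhorovEDist_lt h hB
  rw [ENNReal.toReal_ofReal hε] at h1 h2
  exact ⟨h1, h2⟩

/-- For finite measures of the same mass, each of the two inequalities implies the other one, by
passing to complements. -/
lemma of_left [OpensMeasurableSpace X] [IsFiniteMeasure μ] [IsFiniteMeasure ν]
    (huniv : μ Set.univ = ν Set.univ)
    (h : ∀ B, MeasurableSet B → μ B ≤ ν (Metric.thickening ε B) + ENNReal.ofReal ε) :
    LPClose ε μ ν := by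
  intro B hB
  refine ⟨h B hB, ?_⟩
  have hT : MeasurableSet (Metric.thickening ε B) := Metric.isOpen_thickening.measurableSet
  have h1 := h _ hT.compl
  have hsub : Metric.thickening ε (Metric.thickening ε B)ᶜ ⊆ Bᶜ := by
    intro x hx hxB
    obtain ⟨z, hz, hxz⟩ := Metric.mem_thickening_iff_exists_edist_lt _ _ |>.1 hx
    exact hz ((Metric.mem_thickening_iff_exists_edist_lt _ _).2 ⟨x, hxB, by rwa [edist_comm]⟩)
  have h2 : μ (Metric.thickening ε B)ᶜ ≤ ν Bᶜ + ENNReal.ofReal ε :=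
    h1.trans (add_le_add (measure_mono hsub) le_rfl)
  have h3 := measure_add_measure_compl (μ := μ) hT
  have h4 := measure_add_measure_compl (μ := ν) hB
  have h5 : ν B + ν Bᶜ ≤ μ (Metric.thickening ε B) + ENNReal.ofReal ε + ν Bᶜ := by
    rw [h4, ← huniv, ← h3, add_assoc, add_comm (ENNReal.ofReal ε)]
    gcongr
  exact (ENNReal.add_le_add_iff_right (measure_ne_top ν _)).1 h5

/-- Random variables that are almost surely within `ε` of each other have close laws. -/
lemma map_of_ae {Z : Type*} [MeasurableSpace Z] [OpensMeasurableSpace X] {ρ : Measure Z}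
    {f g : Z → X} (hf : Measurable f) (hg : Measurable g)
    (h : ∀ᵐ z ∂ρ, edist (f z) (g z) < ENNReal.ofReal ε) : LPClose ε (ρ.map f) (ρ.map g) := by
  have key : ∀ {f g : Z → X}, Measurable f → Measurable g →
      (∀ᵐ z ∂ρ, edist (f z) (g z) < ENNReal.ofReal ε) → ∀ B, MeasurableSet B →
      ρ.map f B ≤ ρ.map g (Metric.thickening ε B) + ENNReal.ofReal ε := by
    intro f g hf hg h B hB
    rw [Measure.map_apply hf hB, Measure.map_apply hg Metric.isOpen_thickening.measurableSet]
    refine le_trans (measure_mono_ae ?_) le_self_add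
    filter_upwards [h] with z hz hzB
    exact (Metric.mem_thickening_iff_exists_edist_lt _ _).2 ⟨f z, hzB, by rwa [edist_comm]⟩
  exact fun B hB => ⟨key hf hg h B hB, key hg hf (by simpa only [edist_comm] using h) B hB⟩

end General

section TestFunctions

variable {X : Type*} [MeasurableSpace X] [PseudoMetricSpace X] {ε δ η : ℝ} {μ ν : Measure X}

/-- Close measures assign close integrals to Lipschitz functions with values in `[0, 1]`. -/
lemma integral_le [OpensMeasurableSpace X] [IsFiniteMeasure μ] [IsFiniteMeasure ν]
    (hν : ν Set.univ ≤ 1) (hε : 0 < ε) (h : LPClose ε μ ν) {K : ℝ} (hK : 0 ≤ K) {g : X → ℝ}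
    (hg : Measurable g) (hg0 : ∀ x, 0 ≤ g x) (hg1 : ∀ x, g x ≤ 1)
    (hgK : ∀ x y, |g x - g y| ≤ K * dist x y) :
    ∫ x, g x ∂μ ≤ ∫ x, g x ∂ν + (K + 1) * ε := by
  have hb : ∀ ρ : Measure X, IsFiniteMeasure ρ → Integrable g ρ := fun ρ _ =>
    Integrable.of_bound hg.aestronglyMeasurable 1 (ae_of_all _ fun x => by
      rw [Real.norm_eq_abs, abs_of_nonneg (hg0 x)]; exact hg1 x)
  have hsub : ∀ t, Metric.thickening ε {x | t ≤ g x} ⊆ {x | t ≤ g x + K * ε} := by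
    intro t x hx
    obtain ⟨z, hz, hxz⟩ := Metric.mem_thickening_iff.1 hx
    have h1 := (abs_le.1 (hgK x z)).1
    have h2 : K * dist x z ≤ K * ε := mul_le_mul_of_nonneg_left hxz.le hK
    have hz' : t ≤ g z := hz
    show t ≤ g x + K * ε
    linarith
  have key : ∫⁻ x, ENNReal.ofReal (g x) ∂μ ≤
      ∫⁻ x, ENNReal.ofReal (g x + K * ε) ∂ν + ENNReal.ofReal ε := by
    rw [lintegral_eq_lintegral_meas_le μ (ae_of_all _ hg0) hg.aemeasurable,
      lintegral_eq_lintegral_meas_le ν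
        (ae_of_all _ fun x => add_nonneg (hg0 x) (mul_nonneg hK hε.le))
        (hg.add_const _).aemeasurable]
    calc ∫⁻ t in Set.Ioi (0 : ℝ), μ {a | t ≤ g a}
        ≤ ∫⁻ t in Set.Ioi (0 : ℝ), (ν {a | t ≤ g a + K * ε} +
            (Set.Ioc (0 : ℝ) 1).indicator (fun _ => ENNReal.ofReal ε) t) := by
          refine lintegral_mono_ae ((ae_restrict_iff' measurableSet_Ioi).2 (ae_of_all _ ?_))
          intro t ht
          by_cases ht1 : t ≤ 1
          · rw [Set.indicator_of_mem (show t ∈ Set.Ioc (0 : ℝ) 1 from ⟨ht, ht1⟩)]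
            exact (h _ (hg measurableSet_Ici)).1.trans
              (add_le_add (measure_mono (hsub t)) le_rfl)
          · have : {a | t ≤ g a} = ∅ := by
              ext a
              simpa using lt_of_le_of_lt (hg1 a) (not_le.1 ht1)
            rw [this, measure_empty]
            exact bot_le
      _ ≤ _ := by
          rw [lintegral_add_right _ (measurable_const.indicator measurableSet_Ioc)]
          gcongr
          rw [lintegral_indicator measurableSet_Ioc, lintegral_const,
            Measure.restrict_apply_univ]
          calc _ ≤ ENNReal.ofReal ε * volume (Set.Ioc (0 : ℝ) 1) := by
                gcongr; exact Measure.restrict_le_self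
            _ = _ := by simp
  have e1 := ofReal_integral_eq_lintegral_ofReal (hb μ inferInstance) (ae_of_all _ hg0)
  have e2 := ofReal_integral_eq_lintegral_ofReal
    ((hb ν inferInstance).add (integrable_const (K * ε)))
    (ae_of_all _ fun x => add_nonneg (hg0 x) (mul_nonneg hK hε.le))
  simp only [Pi.add_apply] at e2
  rw [← e1, ← e2, ← ENNReal.ofReal_add (integral_nonneg fun x =>
    add_nonneg (hg0 x) (mul_nonneg hK hε.le)) hε.le, ENNReal.ofReal_le_ofReal_iff
      (add_nonneg (integral_nonneg fun x => add_nonneg (hg0 x) (mul_nonneg hK hε.le)) hε.le),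
    integral_add (hb ν inferInstance) (integrable_const _)] at key
  have hm : ν.real Set.univ ≤ 1 := ENNReal.toReal_le_of_le_ofReal zero_le_one (by simpa using hν)
  have : ∫ _, K * ε ∂ν ≤ K * ε := by
    rw [integral_const, smul_eq_mul]
    exact mul_le_of_le_one_left (mul_nonneg hK hε.le) hm
  linarith

lemma abs_integral_sub_le [OpensMeasurableSpace X] [IsFiniteMeasure μ] [IsFiniteMeasure ν]
    (hμ : μ Set.univ ≤ 1) (hν : ν Set.univ ≤ 1) (hε : 0 < ε) (h : LPClose ε μ ν) {K : ℝ}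
    (hK : 0 ≤ K) {g : X → ℝ} (hg : Measurable g) (hg0 : ∀ x, 0 ≤ g x) (hg1 : ∀ x, g x ≤ 1)
    (hgK : ∀ x y, |g x - g y| ≤ K * dist x y) :
    |∫ x, g x ∂μ - ∫ x, g x ∂ν| ≤ (K + 1) * ε := by
  rw [abs_le]
  have h1 := integral_le hν hε h hK hg hg0 hg1 hgK
  have h2 := integral_le hμ hε h.symm hK hg hg0 hg1 hgK
  constructor <;> linarith

/-- A finite partition of unity, all of whose members except one have small support, controls the
Lévy–Prokhorov distance: a set `B` is compared through the sum of the functions whose support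
meets `B`. -/
lemma of_partition [OpensMeasurableSpace X] [IsFiniteMeasure μ] [IsFiniteMeasure ν]
    {N : ℕ} {g : Option (Fin N) → X → ℝ}
    (hg : ∀ i, Measurable (g i)) (hg0 : ∀ i x, 0 ≤ g i x) (hg1 : ∀ x, ∑ i, g i x = 1)
    (hgs : ∀ i x y, g (some i) x ≠ 0 → g (some i) y ≠ 0 → dist x y < ε)
    (htail : ∫ x, g none x ∂μ ≤ ε / 2) (hη : 0 ≤ η)
    (hμν : ∀ i, |∫ x, g i x ∂μ - ∫ x, g i x ∂ν| ≤ η) (hε : (N + 1) * η ≤ ε / 2) :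
    LPClose ε μ ν := by
  classical
  have hle1 : ∀ i x, g i x ≤ 1 := fun i x => by
    rw [← hg1 x]
    exact Finset.single_le_sum (fun j _ => hg0 j x) (Finset.mem_univ i)
  have hb : ∀ (ρ : Measure X) (i), IsFiniteMeasure ρ → Integrable (g i) ρ := fun ρ i _ =>
    Integrable.of_bound (hg i).aestronglyMeasurable 1 (ae_of_all _ fun x => by
      rw [Real.norm_eq_abs, abs_of_nonneg (hg0 i x)]; exact hle1 i x)
  have key : ∀ {μ ν : Measure X}, IsFiniteMeasure μ → IsFiniteMeasure ν →
      ∫ x, g none x ∂μ ≤ ε / 2 + η → (∀ i, |∫ x, g i x ∂μ - ∫ x, g i x ∂ν| ≤ η) →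
      ∀ B, MeasurableSet B → μ B ≤ ν (Metric.thickening ε B) + ENNReal.ofReal ε := by
    intro μ ν _ _ htail hμν B hB
    let J : Finset (Fin N) := Finset.univ.filter fun i => ∃ x ∈ B, g (some i) x ≠ 0
    have hT : MeasurableSet (Metric.thickening ε B) := Metric.isOpen_thickening.measurableSet
    have h1 : μ.real B ≤ ∫ x, (∑ i ∈ J, g (some i) x + g none x) ∂μ := by
      rw [← integral_indicator_one hB]
      refine integral_mono ((integrable_const 1).indicator hB)
        ((integrable_finsetSum _ fun i _ => hb μ _ inferInstance).add (hb μ _ inferInstance)) ?_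
      intro x
      show B.indicator 1 x ≤ ∑ i ∈ J, g (some i) x + g none x
      by_cases hx : x ∈ B
      · rw [Set.indicator_of_mem hx, Pi.one_apply, ← hg1 x, Fintype.sum_option, add_comm]
        refine add_le_add (le_of_eq ?_) le_rfl
        refine (Finset.sum_subset (Finset.subset_univ J) fun i _ hi => ?_).symm
        by_contra hne
        exact hi (Finset.mem_filter.2 ⟨Finset.mem_univ i, x, hx, hne⟩)
      · rw [Set.indicator_of_notMem hx]
        exact add_nonneg (Finset.sum_nonneg fun i _ => hg0 _ x) (hg0 _ x)
    have h2 : ∫ x, ∑ i ∈ J, g (some i) x ∂ν ≤ ν.real (Metric.thickening ε B) := by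
      rw [← integral_indicator_one hT]
      refine integral_mono (integrable_finsetSum _ fun i _ => hb ν _ inferInstance)
        ((integrable_const 1).indicator hT) ?_
      intro x
      show ∑ i ∈ J, g (some i) x ≤ (Metric.thickening ε B).indicator 1 x
      by_cases hx : x ∈ Metric.thickening ε B
      · rw [Set.indicator_of_mem hx, Pi.one_apply, ← hg1 x, Fintype.sum_option]
        exact le_add_of_nonneg_of_le (hg0 _ x)
          (Finset.sum_le_sum_of_subset_of_nonneg (Finset.subset_univ J) fun i _ _ => hg0 _ x)
      · rw [Set.indicator_of_notMem hx]
        refine le_of_eq (Finset.sum_eq_zero fun i hi => ?_)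
        obtain ⟨y, hy, hyi⟩ := (Finset.mem_filter.1 hi).2
        by_contra hne
        exact hx (Metric.mem_thickening_iff.2 ⟨y, hy, hgs i x y hne hyi⟩)
    rw [integral_add (integrable_finsetSum _ fun i _ => hb μ _ inferInstance)
        (hb μ _ inferInstance),
      integral_finsetSum _ fun i _ => hb μ _ inferInstance] at h1
    rw [integral_finsetSum _ fun i _ => hb ν _ inferInstance] at h2
    have h3 : ∑ i ∈ J, ∫ x, g (some i) x ∂μ ≤ ∑ i ∈ J, ∫ x, g (some i) x ∂ν + N * η := by
      have : ∑ i ∈ J, ∫ x, g (some i) x ∂μ ≤ ∑ i ∈ J, (∫ x, g (some i) x ∂ν + η) :=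
        Finset.sum_le_sum fun i _ => by linarith [(abs_le.1 (hμν (some i))).2]
      rw [Finset.sum_add_distrib, Finset.sum_const, nsmul_eq_mul] at this
      have hc : ((J.card : ℕ) : ℝ) ≤ N := by
        exact_mod_cast (Finset.card_le_univ J).trans (by simp)
      have := mul_le_mul_of_nonneg_right hc hη
      linarith
    have h4 : μ.real B ≤ ν.real (Metric.thickening ε B) + ε := by
      have : (N + 1) * η = N * η + η := by ring
      linarith
    have hε0 : 0 ≤ ε := by
      have : 0 ≤ (N + 1) * η := by positivity
      linarith
    rw [← ofReal_measureReal (measure_ne_top μ B),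
      ← ofReal_measureReal (measure_ne_top ν (Metric.thickening ε B)),
      ← ENNReal.ofReal_add measureReal_nonneg hε0]
    exact ENNReal.ofReal_le_ofReal h4
  intro B hB
  have htail' : ∫ x, g none x ∂ν ≤ ε / 2 + η := by linarith [(abs_le.1 (hμν none)).1]
  exact ⟨key ‹_› ‹_› (by linarith) hμν B hB,
    key ‹_› ‹_› htail' (fun i => by rw [abs_sub_comm]; exact hμν i) B hB⟩

end TestFunctions

end LPClose

/-- The function that vanishes on `(-∞, 0]`, is `1` on `[δ, ∞)` and is affine in between. -/
def ramp (δ s : ℝ) : ℝ := max 0 (min 1 (s / δ))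

lemma ramp_nonneg (δ s : ℝ) : 0 ≤ ramp δ s := le_max_left _ _

lemma ramp_le_one (δ s : ℝ) : ramp δ s ≤ 1 := max_le zero_le_one (min_le_left _ _)

lemma ramp_mono {δ : ℝ} (hδ : 0 < δ) : Monotone (ramp δ) := fun _ _ h =>
  max_le_max le_rfl (min_le_min le_rfl (div_le_div_of_nonneg_right h hδ.le))

lemma ramp_of_nonpos {δ s : ℝ} (hδ : 0 < δ) (h : s ≤ 0) : ramp δ s = 0 := by
  have : s / δ ≤ 0 := div_nonpos_of_nonpos_of_nonneg h hδ.le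
  exact max_eq_left ((min_le_right _ _).trans this)

lemma ramp_of_le {δ s : ℝ} (hδ : 0 < δ) (h : δ ≤ s) : ramp δ s = 1 := by
  have : 1 ≤ s / δ := (one_le_div hδ).2 h
  rw [ramp, min_eq_left this, max_eq_right zero_le_one]

lemma abs_ramp_sub_le {δ : ℝ} (hδ : 0 < δ) (s t : ℝ) : |ramp δ s - ramp δ t| ≤ δ⁻¹ * |s - t| := by
  have h1 : |ramp δ s - ramp δ t| ≤ |min 1 (s / δ) - min 1 (t / δ)| := by
    simpa [ramp, max_comm] using abs_max_sub_max_le_abs (min 1 (s / δ)) (min 1 (t / δ)) 0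
  have h2 : |min 1 (s / δ) - min 1 (t / δ)| ≤ |s / δ - t / δ| := by
    simpa [min_comm] using abs_min_sub_min_le_max (1 : ℝ) (s / δ) 1 (t / δ)
  refine h1.trans (h2.trans (le_of_eq ?_))
  rw [← sub_div, abs_div, abs_of_pos hδ, div_eq_inv_mul]

/-- On the real line, the Lévy–Prokhorov distance of measures that have little mass outside
`[-R, R]` is controlled by the integrals of finitely many Lipschitz functions with values in `[0, 1]`. -/
theorem exists_test_functions {ε : ℝ} (hε : 0 < ε) (R : ℝ) :
    ∃ (N : ℕ) (g : Option (Fin N) → ℝ → ℝ) (K η : ℝ), 0 ≤ K ∧ 0 < η ∧ (∀ i, Measurable (g i)) ∧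
      (∀ i x, 0 ≤ g i x) ∧ (∀ i x, g i x ≤ 1) ∧ (∀ i x y, |g i x - g i y| ≤ K * dist x y) ∧
      ∀ μ ν : Measure ℝ, IsFiniteMeasure μ → IsFiniteMeasure ν →
        μ {x | R < |x|} ≤ ENNReal.ofReal (ε / 2) →
        (∀ i, |∫ x, g i x ∂μ - ∫ x, g i x ∂ν| ≤ η) → LPClose ε μ ν := by
  let δ : ℝ := ε / 3
  have hδ : 0 < δ := by positivity
  obtain ⟨N, hN⟩ := exists_nat_ge ((2 * |R| + δ) / δ)
  have hN' : 2 * |R| + δ ≤ N * δ := (div_le_iff₀ hδ).1 hN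
  let t : ℕ → ℝ := fun l => -|R| - δ + l * δ
  let g : Option (Fin N) → ℝ → ℝ := fun i x => match i with
    | none => 1 - ramp δ (x - t 0) + ramp δ (x - t N)
    | some l => ramp δ (x - t l) - ramp δ (x - t (l + 1))
  have ht : Monotone t := fun a b h => by
    have : (a : ℝ) ≤ b := by exact_mod_cast h
    have := mul_le_mul_of_nonneg_right this hδ.le
    show -|R| - δ + a * δ ≤ -|R| - δ + b * δ
    linarith
  have hrc : ∀ c, Measurable fun x => ramp δ (x - c) := fun c => by
    unfold ramp; fun_prop
  have hgm : ∀ i, Measurable (g i) := by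
    rintro (_ | l)
    · exact ((hrc _).const_sub 1).add (hrc _)
    · exact (hrc _).sub (hrc _)
  have hg0 : ∀ i x, 0 ≤ g i x := by
    rintro (_ | l) x
    · have := ramp_le_one δ (x - t 0)
      have := ramp_nonneg δ (x - t N)
      show 0 ≤ 1 - ramp δ (x - t 0) + ramp δ (x - t N)
      linarith
    · exact sub_nonneg.2 (ramp_mono hδ (by linarith [ht (Nat.le_succ (l : ℕ))]))
  have hsum : ∀ x, ∑ i, g i x = 1 := fun x => by
    rw [Fintype.sum_option]
    have := Finset.sum_range_sub' (fun l => ramp δ (x - t l)) N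
    rw [← Fin.sum_univ_eq_sum_range
      (fun l => ramp δ (x - t l) - ramp δ (x - t (l + 1)))] at this
    show 1 - ramp δ (x - t 0) + ramp δ (x - t N) +
      ∑ l : Fin N, (ramp δ (x - t l) - ramp δ (x - t (l + 1))) = 1
    rw [this]; ring
  have hg1 : ∀ i x, g i x ≤ 1 := fun i x => by
    rw [← hsum x]
    exact Finset.single_le_sum (fun j _ => hg0 j x) (Finset.mem_univ i)
  have hK : ∀ i x y, |g i x - g i y| ≤ (2 * δ⁻¹) * dist x y := by
    have hr : ∀ c x y, |ramp δ (x - c) - ramp δ (y - c)| ≤ δ⁻¹ * dist x y := fun c x y => by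
      simpa [Real.dist_eq] using abs_ramp_sub_le hδ (x - c) (y - c)
    rintro (_ | l) x y
    · have h1 := abs_le.1 (hr (t 0) x y)
      have h2 := abs_le.1 (hr (t N) x y)
      show |(1 - ramp δ (x - t 0) + ramp δ (x - t N)) -
        (1 - ramp δ (y - t 0) + ramp δ (y - t N))| ≤ _
      rw [abs_le]; constructor <;> linarith [h1.1, h1.2, h2.1, h2.2]
    · have h1 := abs_le.1 (hr (t l) x y)
      have h2 := abs_le.1 (hr (t (l + 1)) x y)
      show |(ramp δ (x - t l) - ramp δ (x - t (l + 1))) -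
        (ramp δ (y - t l) - ramp δ (y - t (l + 1)))| ≤ _
      rw [abs_le]; constructor <;> linarith [h1.1, h1.2, h2.1, h2.2]
  have hsupp : ∀ (l : Fin N) x, g (some l) x ≠ 0 → t l < x ∧ x < t l + 2 * δ := by
    intro l x hx
    have hx : ramp δ (x - t l) - ramp δ (x - t (l + 1)) ≠ 0 := hx
    have e : t (l + 1) = t l + δ := by simp only [t]; push_cast; ring
    by_contra hcon
    rw [not_and_or, not_lt, not_lt] at hcon
    apply hx
    rcases hcon with h | h
    · rw [ramp_of_nonpos hδ (by linarith), ramp_of_nonpos hδ (by linarith), sub_zero]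
    · rw [ramp_of_le hδ (by linarith), ramp_of_le hδ (by linarith), sub_self]
  refine ⟨N, g, 2 * δ⁻¹, ε / 2 / (N + 1), by positivity, by positivity, hgm, hg0, hg1, hK, ?_⟩
  intro μ ν _ _ htail hμν
  refine LPClose.of_partition (η := ε / 2 / (N + 1)) hgm hg0 hsum ?_ ?_ (by positivity) hμν ?_
  · intro l x y hx hy
    have h1 := hsupp l x hx
    have h2 := hsupp l y hy
    have : ε = 3 * δ := by simp only [δ]; ring
    rw [Real.dist_eq, abs_lt]; constructor <;> linarith [h1.1, h1.2, h2.1, h2.2]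
  · have hle : ∀ x, g none x ≤ ({x | R < |x|} : Set ℝ).indicator 1 x := by
      intro x
      by_cases hx : R < |x|
      · rw [Set.indicator_of_mem (by exact hx)]; exact hg1 none x
      · rw [Set.indicator_of_notMem (by exact hx)]
        have hx' : |x| ≤ |R| := (not_lt.1 hx).trans (le_abs_self R)
        have h1 := abs_le.1 hx'
        show 1 - ramp δ (x - t 0) + ramp δ (x - t N) ≤ 0
        rw [ramp_of_le hδ (by simp only [t]; push_cast; linarith [h1.1]),
          ramp_of_nonpos hδ (by simp only [t]; linarith [h1.2])]
        norm_num
    have hms : MeasurableSet {x : ℝ | R < |x|} := measurableSet_lt measurable_const (by fun_prop)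
    have h3 : ∫ x, g none x ∂μ ≤ μ.real {x | R < |x|} := by
      rw [← integral_indicator_one hms]
      refine integral_mono ?_ ((integrable_const 1).indicator hms) hle
      exact Integrable.of_bound (hgm none).aestronglyMeasurable 1 (ae_of_all _ fun x => by
        rw [Real.norm_eq_abs, abs_of_nonneg (hg0 none x)]; exact hg1 none x)
    exact h3.trans (ENNReal.toReal_le_of_le_ofReal (by positivity) htail)
  · rw [mul_div_cancel₀]; positivity

/-! ### Laws on blocks and comparison of colourings -/

/-- The measure `κ(S × T; ·) = ∫_{S × T} κ(x, y; ·) μ(dx) μ(dy)` on `ℝ`. For the Lebesgue measure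
on `[0, 1]` this is `ProbGraphon.integrate`. -/
def blockLaw {X : Type*} [MeasurableSpace X] (μ : Measure X) (κ : Kernel (X × X) ℝ)
    (S T : Set X) : Measure ℝ :=
  ((μ.prod μ).restrict (S ×ˢ T)).bind κ

section BlockLaw

variable {X : Type*} [MeasurableSpace X] {μ : Measure X} {κ : Kernel (X × X) ℝ} {S T : Set X}

lemma blockLaw_apply {B : Set ℝ} (hB : MeasurableSet B) :
    blockLaw μ κ S T B = ∫⁻ p in S ×ˢ T, κ p B ∂(μ.prod μ) :=
  Measure.bind_apply hB κ.measurable.aemeasurable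

lemma blockLaw_univ [SFinite μ] [IsMarkovKernel κ] :
    blockLaw μ κ S T Set.univ = μ S * μ T := by
  rw [blockLaw_apply MeasurableSet.univ]
  simp [Measure.prod_prod]

lemma blockLaw_le_univ {B : Set ℝ} (hB : MeasurableSet B) :
    blockLaw μ κ S T B ≤ blockLaw μ κ Set.univ Set.univ B := by
  rw [blockLaw_apply hB, blockLaw_apply hB]
  exact lintegral_mono' (Measure.restrict_mono (Set.prod_mono (Set.subset_univ _)
    (Set.subset_univ _)) le_rfl) le_rfl

lemma blockLaw_univ_le_one [IsProbabilityMeasure μ] [IsMarkovKernel κ] :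
    blockLaw μ κ S T Set.univ ≤ 1 := by
  rw [blockLaw_univ]
  exact mul_le_one' prob_le_one prob_le_one

instance [IsProbabilityMeasure μ] [IsMarkovKernel κ] : IsFiniteMeasure (blockLaw μ κ S T) :=
  ⟨blockLaw_univ_le_one.trans_lt ENNReal.one_lt_top⟩

lemma integral_blockLaw {g : ℝ → ℝ} (hg : Measurable g)
    (hg0 : ∀ x, 0 ≤ g x) (hg1 : ∀ x, g x ≤ 1) [IsMarkovKernel κ] :
    ∫ x, g x ∂(blockLaw μ κ S T) = ∫ p in S ×ˢ T, (∫ x, g x ∂(κ p)) ∂(μ.prod μ) := by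
  have hm : StronglyMeasurable fun p => ∫ x, g x ∂(κ p) :=
    (hg.stronglyMeasurable.comp_measurable measurable_snd).integral_kernel_prod_right'
      (f := fun q : (X × X) × ℝ => g q.2)
  rw [integral_eq_lintegral_of_nonneg_ae (ae_of_all _ hg0) hg.aestronglyMeasurable,
    integral_eq_lintegral_of_nonneg_ae (ae_of_all _ fun p => integral_nonneg hg0)
      hm.aestronglyMeasurable, blockLaw,
    Measure.lintegral_bind κ.measurable.aemeasurable (by fun_prop)]
  congr 1
  refine lintegral_congr fun p => ?_
  refine (ofReal_integral_eq_lintegral_ofReal ?_ (ae_of_all _ hg0)).symm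
  exact Integrable.of_bound hg.aestronglyMeasurable 1 (ae_of_all _ fun x => by
    rw [Real.norm_eq_abs, abs_of_nonneg (hg0 x)]; exact hg1 x)

/-- Block laws are invariant under measure-preserving substitutions. -/
lemma blockLaw_comap {Y : Type*} [MeasurableSpace Y] {ν : Measure Y} [SFinite μ] [SFinite ν]
    {φ : Y → X} (hφ : MeasurePreserving φ ν μ) (hS : MeasurableSet S) (hT : MeasurableSet T) :
    blockLaw ν (κ.comap (Prod.map φ φ) (hφ.measurable.prodMap hφ.measurable)) (φ ⁻¹' S) (φ ⁻¹' T) =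
      blockLaw μ κ S T := by
  ext B hB
  rw [blockLaw_apply hB, blockLaw_apply hB]
  have h := (hφ.prod hφ).restrict_preimage (hS.prod hT)
  rw [← h.lintegral_comp (κ.measurable_coe hB)]
  rfl

end BlockLaw

/-- Every partition of `X` into `m` measurable classes is imitated by a partition of `Y` into `m`
measurable classes, in the sense that the laws on all `m²` blocks are within `ε` of each other. -/
def Approximates (m : ℕ) (ε : ℝ) {X Y : Type*} [MeasurableSpace X] [MeasurableSpace Y]
    (μ : Measure X) (κ : Kernel (X × X) ℝ) (ν : Measure Y) (κ' : Kernel (Y × Y) ℝ) : Prop :=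
  ∀ c : X → Fin m, Measurable c → ∃ c' : Y → Fin m, Measurable c' ∧
    ∀ a b, LPClose ε (blockLaw μ κ (c ⁻¹' {a}) (c ⁻¹' {b}))
      (blockLaw ν κ' (c' ⁻¹' {a}) (c' ⁻¹' {b}))

namespace Approximates

variable {X Y Z : Type*} [MeasurableSpace X] [MeasurableSpace Y] [MeasurableSpace Z]
  {μ : Measure X} {κ : Kernel (X × X) ℝ} {ν : Measure Y} {κ' : Kernel (Y × Y) ℝ}
  {ρ : Measure Z} {κ'' : Kernel (Z × Z) ℝ} {m : ℕ} {ε δ : ℝ}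

lemma mono (h : Approximates m ε μ κ ν κ') (hεδ : ε ≤ δ) : Approximates m δ μ κ ν κ' :=
  fun c hc => by
    obtain ⟨c', hc', h'⟩ := h c hc
    exact ⟨c', hc', fun a b => (h' a b).mono hεδ⟩

lemma trans (hε : 0 ≤ ε) (hδ : 0 ≤ δ) (h : Approximates m ε μ κ ν κ')
    (h' : Approximates m δ ν κ' ρ κ'') : Approximates m (ε + δ) μ κ ρ κ'' := fun c hc => by
  obtain ⟨c', hc', h1⟩ := h c hc
  obtain ⟨c'', hc'', h2⟩ := h' c' hc'
  exact ⟨c'', hc'', fun a b => (h1 a b).trans hε hδ (h2 a b)⟩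

/-- A colouring is pulled back along a measure-preserving map without changing any block law. -/
lemma comap [SFinite μ] [SFinite ν] {φ : Y → X} (hφ : MeasurePreserving φ ν μ) (hε : 0 < ε) :
    Approximates m ε μ κ ν
      (κ.comap (Prod.map φ φ) (hφ.measurable.prodMap hφ.measurable)) := fun c hc => by
  refine ⟨c ∘ φ, hc.comp hφ.measurable, fun a b => ?_⟩
  rw [Set.preimage_comp, Set.preimage_comp,
    blockLaw_comap hφ (hc (measurableSet_singleton a)) (hc (measurableSet_singleton b))]
  exact LPClose.refl hε _

/-- The total laws are the block laws of the colouring with a single colour. -/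
lemma total (h : Approximates 1 ε μ κ ν κ') :
    LPClose ε (blockLaw μ κ Set.univ Set.univ) (blockLaw ν κ' Set.univ Set.univ) := by
  obtain ⟨c', hc', h'⟩ := h (fun _ => 0) measurable_const
  have h1 : (fun _ : X => (0 : Fin 1)) ⁻¹' {0} = Set.univ := by ext; simp
  have h2 : c' ⁻¹' {0} = Set.univ := by
    ext y; simp [Subsingleton.elim (c' y) 0]
  have := h' 0 0
  rwa [h1, h2] at this

/-- Colours may be taken in any finite type. -/
lemma exists_coloring {C : Type*} [Fintype C] [MeasurableSpace C] [MeasurableSingletonClass C]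
    (h : Approximates (Fintype.card C) ε μ κ ν κ') {c : X → C} (hc : Measurable c) :
    ∃ c' : Y → C, Measurable c' ∧
      ∀ a b, LPClose ε (blockLaw μ κ (c ⁻¹' {a}) (c ⁻¹' {b}))
        (blockLaw ν κ' (c' ⁻¹' {a}) (c' ⁻¹' {b})) := by
  let e := Fintype.equivFin C
  obtain ⟨c', hc', h'⟩ := h (e ∘ c) ((measurable_of_finite e).comp hc)
  refine ⟨e.symm ∘ c', (measurable_of_finite e.symm).comp hc', fun a b => ?_⟩
  have h1 : ∀ a, c ⁻¹' {a} = (e ∘ c) ⁻¹' {e a} := fun a => by ext; simp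
  have h2 : ∀ a, (e.symm ∘ c') ⁻¹' {a} = c' ⁻¹' {e a} := fun a => by
    ext; simp [Equiv.symm_apply_eq]
  rw [h1, h1, h2, h2]
  exact h' _ _

end Approximates

namespace PVariable

variable {Ω₁ : Type*} {Ω₂ : Type*} [MeasurableSpace Ω₁] [MeasurableSpace Ω₂]
  {μ₁ : Measure Ω₁} {μ₂ : Measure Ω₂}

/-- The block laws of the graphon of a `P`-variable are the laws of the variable restricted to
the blocks. -/
lemma blockLaw_graphon [SFinite μ₁] [SFinite μ₂] (W : PVariable μ₁ μ₂) {S T : Set Ω₁}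
    (hS : MeasurableSet S) (hT : MeasurableSet T) {B : Set ℝ} (hB : MeasurableSet B) :
    blockLaw μ₁ W.graphon S T B =
      (μ₁.prod (μ₁.prod μ₂)) {p | p.1 ∈ S ∧ p.2.1 ∈ T ∧ W.toFun p ∈ B} := by
  let E : Set (Ω₁ × Ω₁ × Ω₂) := {p | p.1 ∈ S ∧ p.2.1 ∈ T ∧ W.toFun p ∈ B}
  have hE : MeasurableSet E :=
    (measurable_fst hS).inter ((measurable_snd.fst hT).inter (W.measurable_toFun hB))
  rw [blockLaw_apply hB, ← (measurePreserving_prodAssoc μ₁ μ₁ μ₂).measure_preimage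
    hE.nullMeasurableSet, Measure.prod_apply (MeasurableEquiv.prodAssoc.measurable hE),
    ← lintegral_indicator (hS.prod hT)]
  refine lintegral_congr fun x => ?_
  by_cases hx : x ∈ S ×ˢ T
  · rw [Set.indicator_of_mem hx]
    have hm : Measurable fun z : Ω₂ => W.toFun (x.1, x.2, z) :=
      W.measurable_toFun.comp (by fun_prop)
    refine (Measure.map_apply hm hB).trans ?_
    congr 1
    ext z
    exact ⟨fun h => ⟨hx.1, hx.2, h⟩, fun h => h.2.2⟩
  · rw [Set.indicator_of_notMem hx, eq_comm]
    convert measure_empty (μ := μ₂)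
    ext z
    simp only [Set.mem_preimage, Set.mem_empty_iff_false, iff_false]
    exact fun h => hx ⟨h.1, h.2.1⟩

end PVariable

/-! ### The cut distance -/

namespace ProbGraphon

variable {U V W : Kernel (I × I) ℝ} {ε δ : ℝ}

lemma blockLaw_close_of_cutDist_lt (hε : 0 ≤ ε) (h : cutDist U V < ENNReal.ofReal ε) {S T : Set I}
    (hS : MeasurableSet S) (hT : MeasurableSet T) :
    LPClose ε (blockLaw volume U S T) (blockLaw volume V S T) := by
  refine LPClose.of_edist_lt hε (lt_of_le_of_lt ?_ h)
  exact le_iSup₂_of_le S T (le_iSup₂_of_le hS hT le_rfl)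

lemma cutDist_le_of_blockLaw_close (hε : 0 ≤ ε) (h : ∀ S T, MeasurableSet S → MeasurableSet T →
    LPClose ε (blockLaw volume U S T) (blockLaw volume V S T)) :
    cutDist U V ≤ ENNReal.ofReal ε :=
  iSup₂_le fun S T => iSup₂_le fun hS hT => (h S T hS hT).edist_le hε

lemma cutDist_comm : cutDist U V = cutDist V U := by
  simp only [cutDist, levyProkhorovEDist_comm]

lemma cutDist_triangle : cutDist U W ≤ cutDist U V + cutDist V W := by
  refine iSup₂_le fun S T => iSup₂_le fun hS hT => ?_
  refine (levyProkhorovEDist_triangle _ (integrate V S T) _).trans (add_le_add ?_ ?_)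
  · exact le_iSup₂_of_le S T (le_iSup₂_of_le hS hT le_rfl)
  · exact le_iSup₂_of_le S T (le_iSup₂_of_le hS hT le_rfl)

/-- A bijective measure-preserving map of `[0, 1]` has a measurable inverse, which again preserves
the measure. -/
lemma exists_inverse {φ : I → I} (hφ : MeasurePreserving φ volume volume)
    (hb : Function.Bijective φ) :
    ∃ ψ : I → I, MeasurePreserving ψ volume volume ∧ Function.Bijective ψ ∧
      Function.LeftInverse ψ φ ∧ Function.RightInverse ψ φ := by
  have he : MeasurableEmbedding φ := hφ.measurable.measurableEmbedding hb.injective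
  let e := Equiv.ofBijective φ hb
  have hψ : Measurable e.symm := fun s hs => by
    have : e.symm ⁻¹' s = φ '' s := (e.image_eq_preimage_symm s).symm
    rw [this]
    exact he.measurableSet_image.2 hs
  refine ⟨e.symm, ⟨hψ, ?_⟩, e.symm.bijective, e.symm_apply_apply, e.apply_symm_apply⟩
  conv_lhs => rw [← hφ.map_eq]
  rw [Measure.map_map hψ hφ.measurable]
  have : (e.symm ∘ φ) = id := funext e.symm_apply_apply
  rw [this, Measure.map_id]

lemma relabel_relabel {φ ψ : I → I} (hφ : Measurable φ) (hψ : Measurable ψ) :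
    relabel (relabel W φ hφ) ψ hψ = relabel W (φ ∘ ψ) (hφ.comp hψ) := by
  ext1 x
  rfl

lemma relabel_of_id {φ : I → I} (hφ : Measurable φ) (h : ∀ x, φ x = x) : relabel W φ hφ = W := by
  ext1 x
  simp [relabel, Prod.map, h]

instance {φ : I → I} {hφ : Measurable φ} [IsMarkovKernel W] : IsMarkovKernel (relabel W φ hφ) :=
  inferInstanceAs (IsMarkovKernel (W.comap _ _))

/-- The cut distance does not change if both kernels are relabelled. -/
lemma cutDist_relabel {φ : I → I} (hφ : MeasurePreserving φ volume volume)
    (hb : Function.Bijective φ) :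
    cutDist (relabel U φ hφ.measurable) (relabel V φ hφ.measurable) = cutDist U V := by
  have key : ∀ (U V : Kernel (I × I) ℝ) (φ : I → I) (hφ : MeasurePreserving φ volume volume),
      Function.Bijective φ → cutDist U V ≤
        cutDist (relabel U φ hφ.measurable) (relabel V φ hφ.measurable) := by
    intro U V φ hφ hb
    refine iSup₂_le fun S T => iSup₂_le fun hS hT => ?_
    refine le_iSup₂_of_le (φ ⁻¹' S) (φ ⁻¹' T) (le_iSup₂_of_le (hφ.measurable hS)
      (hφ.measurable hT) (le_of_eq ?_))
    have h : ∀ W : Kernel (I × I) ℝ,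
        integrate (relabel W φ hφ.measurable) (φ ⁻¹' S) (φ ⁻¹' T) = integrate W S T :=
      fun W => blockLaw_comap hφ hS hT
    rw [h, h]
  refine le_antisymm ?_ (key U V φ hφ hb)
  obtain ⟨ψ, hψ, hψb, hl, hr⟩ := exists_inverse hφ hb
  have := key (relabel U φ hφ.measurable) (relabel V φ hφ.measurable) ψ hψ hψb
  rwa [relabel_relabel, relabel_relabel, relabel_of_id (φ := φ ∘ ψ) _ hr,
    relabel_of_id (φ := φ ∘ ψ) _ hr] at this

lemma exists_of_unlabelledCutDist_lt {r : ℝ≥0∞} (h : unlabelledCutDist U V < r) :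
    ∃ (φ : I → I) (hφ : MeasurePreserving φ volume volume), Function.Bijective φ ∧
      cutDist U (relabel V φ hφ.measurable) < r := by
  simpa [unlabelledCutDist, iInf_lt_iff] using h

lemma unlabelledCutDist_le {φ : I → I} (hφ : MeasurePreserving φ volume volume)
    (hb : Function.Bijective φ) :
    unlabelledCutDist U V ≤ cutDist U (relabel V φ hφ.measurable) :=
  iInf_le_of_le φ (iInf₂_le hφ hb)

lemma unlabelledCutDist_comm : unlabelledCutDist U V = unlabelledCutDist V U := by
  have key : ∀ U V : Kernel (I × I) ℝ, unlabelledCutDist U V ≤ unlabelledCutDist V U := by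
    intro U V
    refine le_iInf fun φ => le_iInf₂ fun hφ hb => ?_
    obtain ⟨ψ, hψ, hψb, hl, hr⟩ := exists_inverse hφ hb
    refine (unlabelledCutDist_le hψ hψb).trans (le_of_eq ?_)
    rw [← cutDist_relabel hφ hb, relabel_relabel, relabel_of_id (φ := ψ ∘ φ) _ hl,
      cutDist_comm]
  exact le_antisymm (key U V) (key V U)

lemma unlabelledCutDist_triangle :
    unlabelledCutDist U W ≤ unlabelledCutDist U V + unlabelledCutDist V W := by
  refine ENNReal.le_of_forall_pos_le_add fun ε hε hfin => ?_
  have hε2 : ((ε : ℝ≥0∞) / 2) ≠ 0 := by simpa using hε.ne'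
  have hfin' := ENNReal.add_lt_top.1 hfin
  obtain ⟨φ, hφ, hφb, h1⟩ := exists_of_unlabelledCutDist_lt
    (ENNReal.lt_add_right hfin'.1.ne hε2)
  obtain ⟨ψ, hψ, hψb, h2⟩ := exists_of_unlabelledCutDist_lt
    (ENNReal.lt_add_right hfin'.2.ne hε2)
  refine (unlabelledCutDist_le (hψ.comp hφ) (hψb.comp hφb)).trans ?_
  rw [← relabel_relabel hψ.measurable hφ.measurable]
  refine (cutDist_triangle (V := relabel V φ hφ.measurable)).trans ?_
  rw [← ENNReal.add_halves (ε : ℝ≥0∞), add_add_add_comm]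
  refine add_le_add h1.le ?_
  rw [cutDist_relabel hφ hφb]
  exact h2.le

/-- Graphons that are close in the unlabelled cut distance imitate each other's partitions: the
partition is transported along the relabelling. -/
lemma approximates_of_unlabelledCutDist_lt (hε : 0 ≤ ε) (m : ℕ)
    (h : unlabelledCutDist U V < ENNReal.ofReal ε) : Approximates m ε volume U volume V := by
  obtain ⟨φ, hφ, hb, hlt⟩ := exists_of_unlabelledCutDist_lt h
  obtain ⟨ψ, hψ, hψb, hl, hr⟩ := exists_inverse hφ hb
  intro c hc
  refine ⟨c ∘ ψ, hc.comp hψ.measurable, fun a b => ?_⟩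
  have hS := fun a => hc (measurableSet_singleton a)
  have hS' := fun a => (hc.comp hψ.measurable) (measurableSet_singleton a)
  have := blockLaw_close_of_cutDist_lt hε hlt (hS a) (hS b)
  have e : ∀ a, c ⁻¹' {a} = φ ⁻¹' ((c ∘ ψ) ⁻¹' {a}) := fun a => by
    ext x; simp [hl x]
  have e2 : blockLaw volume (relabel V φ hφ.measurable) (c ⁻¹' {a}) (c ⁻¹' {b}) =
      blockLaw volume V ((c ∘ ψ) ⁻¹' {a}) ((c ∘ ψ) ⁻¹' {b}) := by
    rw [e a, e b]
    exact blockLaw_comap hφ (hS' a) (hS' b)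
  rwa [e2] at this

end ProbGraphon

/-! ### The P-variables metric and imitation of colourings -/

/-- A family of kernels is asymptotically imitated by another one, along a filter: partitions into
any fixed number of classes are imitated with an error that tends to zero. -/
def Imitates {ι : Type*} (l : Filter ι) {X Y : ι → Type*} [∀ i, MeasurableSpace (X i)]
    [∀ i, MeasurableSpace (Y i)] (μ : ∀ i, Measure (X i)) (κ : ∀ i, Kernel (X i × X i) ℝ)
    (ν : ∀ i, Measure (Y i)) (κ' : ∀ i, Kernel (Y i × Y i) ℝ) : Prop :=
  ∀ m, ∀ ε > 0, ∀ᶠ i in l, Approximates m ε (μ i) (κ i) (ν i) (κ' i)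

lemma Imitates.trans {ι : Type*} {l : Filter ι} {X Y Z : ι → Type*} [∀ i, MeasurableSpace (X i)]
    [∀ i, MeasurableSpace (Y i)] [∀ i, MeasurableSpace (Z i)]
    {μ : ∀ i, Measure (X i)} {κ : ∀ i, Kernel (X i × X i) ℝ}
    {ν : ∀ i, Measure (Y i)} {κ' : ∀ i, Kernel (Y i × Y i) ℝ}
    {ρ : ∀ i, Measure (Z i)} {κ'' : ∀ i, Kernel (Z i × Z i) ℝ}
    (h : Imitates l μ κ ν κ') (h' : Imitates l ν κ' ρ κ'') : Imitates l μ κ ρ κ'' := by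
  intro m ε hε
  filter_upwards [h m (ε / 2) (by positivity), h' m (ε / 2) (by positivity)] with i h1 h2
  have := h1.trans (by positivity) (by positivity) h2
  rwa [add_halves] at this

lemma Imitates.comp {ι ι' : Type*} {l : Filter ι} {l' : Filter ι'} {X Y : ι → Type*}
    [∀ i, MeasurableSpace (X i)] [∀ i, MeasurableSpace (Y i)]
    {μ : ∀ i, Measure (X i)} {κ : ∀ i, Kernel (X i × X i) ℝ}
    {ν : ∀ i, Measure (Y i)} {κ' : ∀ i, Kernel (Y i × Y i) ℝ}
    (h : Imitates l μ κ ν κ') {f : ι' → ι} (hf : Tendsto f l' l) :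
    Imitates l' (fun i => μ (f i)) (fun i => κ (f i)) (fun i => ν (f i)) (fun i => κ' (f i)) :=
  fun m ε hε => hf.eventually (h m ε hε)

/-- The colour `a < m` whose code `a / m` is closest to `s`. -/
def decode (m : ℕ) [NeZero m] (s : ℝ) : Fin m :=
  ⟨min ⌊m * s + 1 / 2⌋₊ (m - 1), by have := NeZero.pos m; omega⟩

lemma measurable_decode (m : ℕ) [NeZero m] : Measurable (decode m) := by
  refine measurable_to_countable' fun i => ?_
  have hm : Measurable fun s : ℝ => min ⌊m * s + 1 / 2⌋₊ (m - 1) :=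
    (measurable_of_countable fun j : ℕ => min j (m - 1)).comp
      (Nat.measurable_floor.comp (by fun_prop))
  have : decode m ⁻¹' {i} = (fun s : ℝ => min ⌊m * s + 1 / 2⌋₊ (m - 1)) ⁻¹' {(i : ℕ)} := by
    ext s; simp [decode, Fin.ext_iff]
  rw [this]
  exact hm (measurableSet_singleton _)

lemma decode_eq {m : ℕ} [NeZero m] {s : ℝ} {a : Fin m} (h : |s - a / m| < 1 / (2 * m)) :
    decode m s = a := by
  have hm : (0 : ℝ) < m := by exact_mod_cast NeZero.pos m
  have h1 : |m * s - a| < 1 / 2 := by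
    have : m * s - a = m * (s - a / m) := by field_simp
    rw [this, abs_mul, abs_of_pos hm]
    calc m * |s - a / m| < m * (1 / (2 * m)) := by gcongr
      _ = 1 / 2 := by field_simp
  have h2 := abs_lt.1 h1
  have h3 : ⌊m * s + 1 / 2⌋₊ = (a : ℕ) := by
    rw [Nat.floor_eq_iff (by have : (0 : ℝ) ≤ (a : ℕ) := Nat.cast_nonneg _; linarith [h2.1])]
    constructor <;> linarith [h2.1, h2.2]
  ext
  simp only [decode, h3]
  have := a.2
  omega

namespace PVariable

section

variable {Ω₁ : Type*} {Ω₂ : Type*} [MeasurableSpace Ω₁] [MeasurableSpace Ω₂]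
  {μ₁ : Measure Ω₁} {μ₂ : Measure Ω₂}
  {Ω₁' : Type*} {Ω₂' : Type*} [MeasurableSpace Ω₁'] [MeasurableSpace Ω₂']
  {ν₁ : Measure Ω₁'} {ν₂ : Measure Ω₂'}

lemma measurable_profileVector (W : PVariable μ₁ μ₂) {k : ℕ} {f : Fin k → Ω₁ → ℝ}
    (hf : ∀ i, Measurable (f i)) : Measurable (W.profileVector f) := by
  refine (WithLp.measurable_toLp 2 _).comp (measurable_pi_iff.2 ?_)
  rintro (i | i | i)
  · exact (hf i).comp measurable_fst
  · exact (hf i).comp measurable_snd.fst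
  · exact W.measurable_toFun

lemma isProbabilityMeasure_generatedMeasure [IsProbabilityMeasure μ₁] [IsProbabilityMeasure μ₂]
    (W : PVariable μ₁ μ₂) {k : ℕ} {f : Fin k → Ω₁ → ℝ} (hf : ∀ i, Measurable (f i)) :
    IsProbabilityMeasure (W.generatedMeasure f) :=
  Measure.isProbabilityMeasure_map (W.measurable_profileVector hf).aemeasurable

lemma dist_coord_le {k : ℕ} (z z' : ProfileSpace k) (i : Fin k ⊕ Fin k ⊕ Unit) :
    dist (z i) (z' i) ≤ dist z z' := by
  rw [EuclideanSpace.dist_eq]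
  refine Real.le_sqrt_of_sq_le ?_
  exact Finset.single_le_sum (f := fun i => dist (z i) (z' i) ^ 2) (fun _ _ => sq_nonneg _)
    (Finset.mem_univ i)

/-- The `1`-profile alone sees partitions of `Ω₁` into `m` classes, by coding the classes as
multiples of `1 / m`. -/
lemma approximates_of_dM_lt [IsProbabilityMeasure μ₁] [IsProbabilityMeasure μ₂]
    [IsProbabilityMeasure ν₁] [IsProbabilityMeasure ν₂] (W : PVariable μ₁ μ₂)
    (U : PVariable ν₁ ν₂) {m : ℕ} {η : ℝ} (hη : 0 < η) (hηm : η * (2 * m) ≤ 1)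
    (h : 2 * W.dM U < ENNReal.ofReal η) : Approximates m η μ₁ W.graphon ν₁ U.graphon := by
  intro c hc
  have hm0 : 0 < m := by
    obtain ⟨x⟩ := nonempty_of_isProbabilityMeasure μ₁
    exact (Nat.zero_le _).trans_lt (c x).2
  have : NeZero m := ⟨hm0.ne'⟩
  have hm : (0 : ℝ) < m := by exact_mod_cast hm0
  have hηm' : η ≤ 1 / (2 * m) := by rwa [le_div_iff₀ (by positivity)]
  have hH : Metric.hausdorffEDist (W.profile 1) (U.profile 1) < ENNReal.ofReal η := by
    refine lt_of_le_of_lt ?_ h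
    have h1 : (2⁻¹ : ℝ≥0∞) ^ (0 + 1) * Metric.hausdorffEDist (W.profile (0 + 1))
      (U.profile (0 + 1)) ≤ W.dM U := ENNReal.le_tsum 0
    calc _ = 2 * ((2⁻¹ : ℝ≥0∞) ^ (0 + 1) * Metric.hausdorffEDist (W.profile (0 + 1))
            (U.profile (0 + 1))) := by
          rw [zero_add, pow_one, ← mul_assoc, ENNReal.mul_inv_cancel (by simp) (by simp), one_mul]
      _ ≤ _ := by gcongr
  let f : Fin 1 → Ω₁ → ℝ := fun _ x => (c x : ℝ) / m
  have hf : ∀ i, Measurable (f i) := fun _ =>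
    (measurable_of_finite fun a : Fin m => (a : ℝ) / m).comp hc
  have hmem : LevyProkhorov.ofMeasure (W.generatedMeasure f) ∈ W.profile 1 := by
    refine ⟨f, hf, fun i => ae_of_all _ fun x => ⟨?_, ?_⟩, rfl⟩
    · have : (0 : ℝ) ≤ (c x : ℝ) / m := by positivity
      show -1 ≤ (c x : ℝ) / m
      linarith
    · show (c x : ℝ) / m ≤ 1
      rw [div_le_one hm]
      exact_mod_cast (c x).2.le
  obtain ⟨ν, ⟨f', hf', -, rfl⟩, hd⟩ := Metric.exists_edist_lt_of_hausdorffEDist_lt hmem hH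
  have hclose : LPClose η (W.generatedMeasure f) (U.generatedMeasure f') :=
    LPClose.of_edist_lt hη.le hd
  refine ⟨fun y => decode m (f' 0 y), (measurable_decode m).comp (hf' 0), fun a b B hB => ?_⟩
  have hSa := fun a => hc (measurableSet_singleton a)
  have hSb : ∀ a, MeasurableSet ((fun y => decode m (f' 0 y)) ⁻¹' {a}) := fun a =>
    ((measurable_decode m).comp (hf' 0)) (measurableSet_singleton a)
  have hT : MeasurableSet (Metric.thickening η B) := Metric.isOpen_thickening.measurableSet
  rw [blockLaw_graphon _ (hSa a) (hSa b) hB, blockLaw_graphon _ (hSb a) (hSb b) hT,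
    blockLaw_graphon _ (hSa a) (hSa b) hT, blockLaw_graphon _ (hSb a) (hSb b) hB]
  -- the three coordinates of `ℝ³`
  let x₁ : ProfileSpace 1 → ℝ := fun z => z (Sum.inl 0)
  let x₂ : ProfileSpace 1 → ℝ := fun z => z (Sum.inr (Sum.inl 0))
  let x₃ : ProfileSpace 1 → ℝ := fun z => z (Sum.inr (Sum.inr ()))
  have hx₁ : Measurable x₁ := by fun_prop
  have hx₂ : Measurable x₂ := by fun_prop
  have hx₃ : Measurable x₃ := by fun_prop
  -- the event that the codes are exactly those of `a` and `b`, and its decoded version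
  let D : Set ℝ → Set (ProfileSpace 1) := fun B =>
    {z | x₁ z = a / m ∧ x₂ z = b / m ∧ x₃ z ∈ B}
  let D' : Set ℝ → Set (ProfileSpace 1) := fun B =>
    {z | decode m (x₁ z) = a ∧ decode m (x₂ z) = b ∧ x₃ z ∈ B}
  have hD : ∀ B, MeasurableSet B → MeasurableSet (D B) := fun B hB =>
    (hx₁ (measurableSet_singleton _)).inter ((hx₂ (measurableSet_singleton _)).inter (hx₃ hB))
  have hD' : ∀ B, MeasurableSet B → MeasurableSet (D' B) := fun B hB =>
    (((measurable_decode m).comp hx₁) (measurableSet_singleton _)).inter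
      ((((measurable_decode m).comp hx₂) (measurableSet_singleton _)).inter (hx₃ hB))
  have hinj : ∀ a b : Fin m, (a : ℝ) / m = b / m ↔ a = b := fun a b => by
    rw [div_left_inj' hm.ne', Nat.cast_inj, Fin.ext_iff]
  have hPW : ∀ B, MeasurableSet B → W.generatedMeasure f (D B) = (μ₁.prod (μ₁.prod μ₂))
      {p | p.1 ∈ c ⁻¹' {a} ∧ p.2.1 ∈ c ⁻¹' {b} ∧ W.toFun p ∈ B} := fun B hB => by
    rw [generatedMeasure, Measure.map_apply (W.measurable_profileVector hf) (hD B hB)]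
    congr 1
    ext p
    show ((c p.1 : ℝ) / m = a / m ∧ (c p.2.1 : ℝ) / m = b / m ∧ _) ↔ _
    rw [hinj, hinj]
    rfl
  have hPU : ∀ B, MeasurableSet B → U.generatedMeasure f' (D' B) = (ν₁.prod (ν₁.prod ν₂))
      {p | p.1 ∈ (fun y => decode m (f' 0 y)) ⁻¹' {a} ∧
        p.2.1 ∈ (fun y => decode m (f' 0 y)) ⁻¹' {b} ∧ U.toFun p ∈ B} := fun B hB => by
    rw [generatedMeasure, Measure.map_apply (U.measurable_profileVector hf') (hD' B hB)]
    rfl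
  have := W.isProbabilityMeasure_generatedMeasure hf
  have := U.isProbabilityMeasure_generatedMeasure hf'
  constructor
  · rw [← hPW B hB]
    refine ((hclose _ (hD B hB)).1).trans ?_
    gcongr
    refine (measure_mono ?_).trans (hPU _ hT).le
    intro z hz
    obtain ⟨z', ⟨h1, h2, h3⟩, hzz⟩ := Metric.mem_thickening_iff.1 hz
    refine ⟨decode_eq ?_, decode_eq ?_, Metric.mem_thickening_iff.2 ⟨x₃ z', h3, ?_⟩⟩
    · rw [← h1]; exact (dist_coord_le z z' _).trans_lt (hzz.trans_le hηm')
    · rw [← h2]; exact (dist_coord_le z z' _).trans_lt (hzz.trans_le hηm')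
    · exact (dist_coord_le z z' _).trans_lt hzz
  · rw [← hPU B hB]
    -- pass to complements inside the set of points whose first coordinates are codes
    let E : Set (ProfileSpace 1) :=
      {z | (∃ a' : Fin m, x₁ z = a' / m) ∧ (∃ b' : Fin m, x₂ z = b' / m)} ∩
        (D (Metric.thickening η B))ᶜ
    have hE : MeasurableSet E := by
      refine MeasurableSet.inter (MeasurableSet.inter ?_ ?_) (hD _ hT).compl
      · have : {z | ∃ a' : Fin m, x₁ z = a' / m} = ⋃ a' : Fin m, x₁ ⁻¹' {(a' : ℝ) / m} := by
          ext; simp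
        refine MeasurableSet.congr (MeasurableSet.iUnion fun a' : Fin m =>
          hx₁ (measurableSet_singleton ((a' : ℝ) / m))) this.symm
      · have : {z | ∃ a' : Fin m, x₂ z = a' / m} = ⋃ a' : Fin m, x₂ ⁻¹' {(a' : ℝ) / m} := by
          ext; simp
        refine MeasurableSet.congr (MeasurableSet.iUnion fun a' : Fin m =>
          hx₂ (measurableSet_singleton ((a' : ℝ) / m))) this.symm
    have h1 : W.generatedMeasure f E = W.generatedMeasure f (D (Metric.thickening η B))ᶜ := by
      rw [generatedMeasure, Measure.map_apply (W.measurable_profileVector hf) hE,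
        Measure.map_apply (W.measurable_profileVector hf) (hD _ hT).compl]
      congr 1
      ext p
      exact ⟨fun h => h.2, fun h => ⟨⟨⟨c p.1, rfl⟩, ⟨c p.2.1, rfl⟩⟩, h⟩⟩
    have h2 : Metric.thickening η E ⊆ (D' B)ᶜ := by
      rintro z hz ⟨g1, g2, g3⟩
      obtain ⟨z', ⟨⟨⟨a', h1⟩, ⟨b', h2⟩⟩, h3⟩, hzz⟩ := Metric.mem_thickening_iff.1 hz
      have e1 : decode m (x₁ z) = a' := decode_eq (by
        rw [← h1]; exact (dist_coord_le z z' _).trans_lt (hzz.trans_le hηm'))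
      have e2 : decode m (x₂ z) = b' := decode_eq (by
        rw [← h2]; exact (dist_coord_le z z' _).trans_lt (hzz.trans_le hηm'))
      refine h3 ⟨by rw [h1, ← e1, g1], by rw [h2, ← e2, g2],
        Metric.mem_thickening_iff.2 ⟨x₃ z, g3, ?_⟩⟩
      rw [dist_comm]
      exact (dist_coord_le z z' _).trans_lt hzz
    have h3 := (hclose E hE).1
    rw [h1] at h3
    have h4 := h3.trans (add_le_add (measure_mono h2) le_rfl)
    have h5 := prob_add_prob_compl (μ := W.generatedMeasure f) (hD _ hT)
    have h6 := prob_add_prob_compl (μ := U.generatedMeasure f') (hD' _ hB)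
    rw [← hPW _ hT]
    have h7 : U.generatedMeasure f' (D' B) + U.generatedMeasure f' (D' B)ᶜ ≤
        W.generatedMeasure f (D (Metric.thickening η B)) + ENNReal.ofReal η +
          U.generatedMeasure f' (D' B)ᶜ := by
      rw [h6, ← h5, add_assoc, add_comm (ENNReal.ofReal η)]
      gcongr
    exact (ENNReal.add_le_add_iff_right (measure_ne_top _ _)).1 h7

/-- The law generated through test functions that only depend on a colouring is determined by the
block laws of the colouring. -/
lemma generatedMeasure_coloring [SFinite μ₁] [SFinite μ₂] (W : PVariable μ₁ μ₂) {k : ℕ}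
    {C : Type*} [Fintype C] [MeasurableSpace C] [MeasurableSingletonClass C] {c : Ω₁ → C}
    (hc : Measurable c) (val : Fin k → C → ℝ) {B : Set (ProfileSpace k)} (hB : MeasurableSet B) :
    W.generatedMeasure (fun i x => val i (c x)) B =
      ∑ q : C × C, blockLaw μ₁ W.graphon (c ⁻¹' {q.1}) (c ⁻¹' {q.2})
        {w | WithLp.toLp 2 (Sum.elim (fun i => val i q.1)
          (Sum.elim (fun i => val i q.2) (fun _ => w))) ∈ B} := by
  have hf : ∀ i, Measurable fun x => val i (c x) := fun i =>
    (measurable_of_finite (val i)).comp hc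
  have hvec : ∀ q : C × C, Measurable fun w : ℝ => (WithLp.toLp 2 (Sum.elim (fun i => val i q.1)
          (Sum.elim (fun i => val i q.2) (fun _ => w))) : ProfileSpace k) := fun q => by
    refine (WithLp.measurable_toLp 2 _).comp (measurable_pi_iff.2 ?_)
    rintro (i | i | i)
    · exact measurable_const
    · exact measurable_const
    · exact measurable_id
  have hcc : Measurable fun p : Ω₁ × Ω₁ × Ω₂ => (c p.1, c p.2.1) :=
    (hc.comp measurable_fst).prodMk (hc.comp measurable_snd.fst)
  rw [generatedMeasure, Measure.map_apply (W.measurable_profileVector hf) hB]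
  have hun : W.profileVector (fun i x => val i (c x)) ⁻¹' B =
      ⋃ q : C × C, W.profileVector (fun i x => val i (c x)) ⁻¹' B ∩
        (fun p : Ω₁ × Ω₁ × Ω₂ => (c p.1, c p.2.1)) ⁻¹' {q} := by
    ext p; simp
  rw [hun, measure_iUnion, tsum_fintype]
  · refine Finset.sum_congr rfl fun q _ => ?_
    have hBq : MeasurableSet {w : ℝ | WithLp.toLp 2 (Sum.elim (fun i => val i q.1)
          (Sum.elim (fun i => val i q.2) (fun _ => w))) ∈ B} := hvec q hB
    rw [blockLaw_graphon _ (hc (measurableSet_singleton _)) (hc (measurableSet_singleton _)) hBq]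
    congr 1
    ext p
    constructor
    · rintro ⟨h1, rfl⟩
      exact ⟨rfl, rfl, h1⟩
    · rintro ⟨h1, h2, h3⟩
      have h1 : c p.1 = q.1 := h1
      have h2 : c p.2.1 = q.2 := h2
      refine ⟨?_, Prod.ext h1 h2⟩
      show WithLp.toLp 2 (Sum.elim (fun i => val i (c p.1)) (Sum.elim (fun i => val i (c p.2.1))
        (fun _ => W.toFun p))) ∈ B
      rw [h1, h2]
      exact h3
  · intro q q' hqq
    refine Set.disjoint_left.2 fun p h1 h2 => hqq ?_
    exact (Set.mem_singleton_iff.1 h1.2).symm.trans h2.2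
  · exact fun q => (W.measurable_profileVector hf hB).inter (hcc (measurableSet_singleton q))

lemma generatedMeasure_close_of_blockLaw_close [IsProbabilityMeasure μ₁] [IsProbabilityMeasure μ₂]
    [IsProbabilityMeasure ν₁] [IsProbabilityMeasure ν₂] (W : PVariable μ₁ μ₂)
    (U : PVariable ν₁ ν₂) {k : ℕ} {C : Type*} [Fintype C] [MeasurableSpace C]
    [MeasurableSingletonClass C] {c : Ω₁ → C} (hc : Measurable c) {c' : Ω₁' → C}
    (hc' : Measurable c') (val : Fin k → C → ℝ) {η : ℝ} (hη : 0 ≤ η)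
    (h : ∀ a b, LPClose η (blockLaw μ₁ W.graphon (c ⁻¹' {a}) (c ⁻¹' {b}))
        (blockLaw ν₁ U.graphon (c' ⁻¹' {a}) (c' ⁻¹' {b}))) :
    LPClose ((Fintype.card (C × C) : ℝ) * η) (W.generatedMeasure fun i x => val i (c x))
      (U.generatedMeasure fun i x => val i (c' x)) := by
  have hf : ∀ i, Measurable fun x => val i (c x) := fun i =>
    (measurable_of_finite (val i)).comp hc
  have hf' : ∀ i, Measurable fun x => val i (c' x) := fun i =>
    (measurable_of_finite (val i)).comp hc'
  have := W.isProbabilityMeasure_generatedMeasure hf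
  have := U.isProbabilityMeasure_generatedMeasure hf'
  have hcard : (1 : ℝ) ≤ Fintype.card (C × C) := by
    obtain ⟨x⟩ := nonempty_of_isProbabilityMeasure μ₁
    have : 0 < Fintype.card (C × C) := Fintype.card_pos_iff.2 ⟨(c x, c x)⟩
    exact_mod_cast this
  refine LPClose.of_left (by simp) fun B hB => ?_
  have hT : MeasurableSet (Metric.thickening ((Fintype.card (C × C) : ℝ) * η) B) :=
    Metric.isOpen_thickening.measurableSet
  have hsum : ENNReal.ofReal ((Fintype.card (C × C) : ℝ) * η) =
      ∑ _q : C × C, ENNReal.ofReal η := by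
    rw [ENNReal.ofReal_mul (by positivity), ENNReal.ofReal_natCast, Finset.sum_const,
      nsmul_eq_mul, Finset.card_univ]
  rw [generatedMeasure_coloring W hc val hB, generatedMeasure_coloring U hc' val hT, hsum,
    ← Finset.sum_add_distrib]
  refine Finset.sum_le_sum fun q _ => ?_
  have hvec : Measurable fun w : ℝ => (WithLp.toLp 2 (Sum.elim (fun i => val i q.1)
          (Sum.elim (fun i => val i q.2) (fun _ => w))) : ProfileSpace k) := by
    refine (WithLp.measurable_toLp 2 _).comp (measurable_pi_iff.2 ?_)
    rintro (i | i | i)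
    · exact measurable_const
    · exact measurable_const
    · exact measurable_id
  refine ((h q.1 q.2 _ (hvec hB)).1).trans ?_
  gcongr
  intro w hw
  obtain ⟨w', hw', hww⟩ := Metric.mem_thickening_iff.1 hw
  refine Metric.mem_thickening_iff.2 ⟨_, hw', ?_⟩
  rw [EuclideanSpace.dist_eq]
  simp only [Fintype.sum_sum_type, Sum.elim_inl, Sum.elim_inr, dist_self]
  simp only [ne_eq, OfNat.ofNat_ne_zero, not_false_eq_true, zero_pow, Finset.sum_const_zero,
    zero_add, Finset.univ_unique, Finset.sum_singleton, Real.sqrt_sq dist_nonneg]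
  exact hww.trans_le (le_mul_of_one_le_left hη hcard)

end

end PVariable

/-- The index of the point of the grid `-1, -1 + 2/N, …, 1` just below `s`. -/
def gridIndex (N : ℕ) (s : ℝ) : Fin (N + 1) :=
  ⟨min ⌊(s + 1) * N / 2⌋₊ N, by omega⟩

/-- The points of the grid `-1, -1 + 2/N, …, 1`. -/
def gridPoint (N : ℕ) (j : Fin (N + 1)) : ℝ := -1 + 2 * j / N

lemma measurable_gridIndex (N : ℕ) : Measurable (gridIndex N) := by
  refine measurable_to_countable' fun i => ?_
  have hm : Measurable fun s : ℝ => min ⌊(s + 1) * N / 2⌋₊ N :=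
    (measurable_of_countable fun j : ℕ => min j N).comp
      (Nat.measurable_floor.comp (by fun_prop))
  have : gridIndex N ⁻¹' {i} = (fun s : ℝ => min ⌊(s + 1) * N / 2⌋₊ N) ⁻¹' {(i : ℕ)} := by
    ext s; simp [gridIndex, Fin.ext_iff]
  rw [this]
  exact hm (measurableSet_singleton _)

lemma gridPoint_mem {N : ℕ} (hN : 0 < N) (j : Fin (N + 1)) :
    gridPoint N j ∈ Set.Icc (-1 : ℝ) 1 := by
  have hN' : (0 : ℝ) < N := by exact_mod_cast hN
  have h1 : (j : ℝ) ≤ N := by exact_mod_cast Nat.le_of_lt_succ j.2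
  have h0 : (0 : ℝ) ≤ (j : ℕ) := Nat.cast_nonneg _
  have h2 : 2 * (j : ℝ) / N ≤ 2 := by rw [div_le_iff₀ hN']; linarith
  have h3 : 0 ≤ 2 * (j : ℝ) / N := by positivity
  constructor <;> simp only [gridPoint] <;> linarith

lemma abs_sub_gridPoint_le {N : ℕ} (hN : 0 < N) {s : ℝ} (hs : s ∈ Set.Icc (-1 : ℝ) 1) :
    |s - gridPoint N (gridIndex N s)| ≤ 2 / N := by
  have hN' : (0 : ℝ) < N := by exact_mod_cast hN
  have ht0 : 0 ≤ (s + 1) * N / 2 := by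
    have : 0 ≤ s + 1 := by linarith [hs.1]
    positivity
  have htN : (s + 1) * N / 2 ≤ N := by
    have : (s + 1) * N ≤ 2 * N := mul_le_mul_of_nonneg_right (by linarith [hs.2]) hN'.le
    linarith
  have hidx : ((gridIndex N s : ℕ) : ℝ) = ⌊(s + 1) * N / 2⌋₊ := by
    have : ⌊(s + 1) * N / 2⌋₊ ≤ N := Nat.floor_le_of_le htN
    simp [gridIndex, this]
  have h1 := Nat.floor_le ht0
  have h2 := (Nat.lt_floor_add_one ((s + 1) * N / 2)).le
  have h3 : s - gridPoint N (gridIndex N s) =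
      2 / N * ((s + 1) * N / 2 - ⌊(s + 1) * N / 2⌋₊) := by
    rw [gridPoint, hidx]; field_simp; ring
  rw [h3, abs_mul, abs_of_pos (by positivity)]
  refine mul_le_of_le_one_right (by positivity) ?_
  rw [abs_le]; constructor <;> linarith

namespace PVariable

section

variable {Ω₁ : Type*} {Ω₂ : Type*} [MeasurableSpace Ω₁] [MeasurableSpace Ω₂]
  {μ₁ : Measure Ω₁} {μ₂ : Measure Ω₂}
  {Ω₁' : Type*} {Ω₂' : Type*} [MeasurableSpace Ω₁'] [MeasurableSpace Ω₂']
  {ν₁ : Measure Ω₁'} {ν₂ : Measure Ω₂'}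

lemma dist_le_of_coord_le {k : ℕ} {z z' : ProfileSpace k} {r : ℝ} (hr : 0 ≤ r)
    (h : ∀ i, dist (z i) (z' i) ≤ r) : dist z z' ≤ (2 * k + 1) * r := by
  rw [EuclideanSpace.dist_eq]
  refine Real.sqrt_le_iff.2 ⟨by positivity, ?_⟩
  calc ∑ i, dist (z i) (z' i) ^ 2 ≤ ∑ _i : Fin k ⊕ Fin k ⊕ Unit, r ^ 2 :=
        Finset.sum_le_sum fun i _ => pow_le_pow_left₀ dist_nonneg (h i) 2
    _ = (2 * k + 1) * r ^ 2 := by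
        simp only [Finset.sum_const, Finset.card_univ, Fintype.card_sum, Fintype.card_fin,
          Fintype.card_unit, nsmul_eq_mul]
        push_cast; ring
    _ ≤ ((2 * k + 1) * r) ^ 2 := by
        have h1 : (1 : ℝ) ≤ 2 * k + 1 := by
          have : (0 : ℝ) ≤ k := Nat.cast_nonneg k
          linarith
        rw [mul_pow]
        gcongr
        exact le_self_pow₀ h1 two_ne_zero

/-- Test functions are replaced by functions with values in a finite grid, which only depend on a
colouring; an imitating colouring then provides test functions on the other space. -/
lemma exists_mem_profile_close [IsProbabilityMeasure μ₁] [IsProbabilityMeasure μ₂]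
    [IsProbabilityMeasure ν₁] [IsProbabilityMeasure ν₂] (W : PVariable μ₁ μ₂)
    (U : PVariable ν₁ ν₂) {k N : ℕ} (hN : 0 < N) {η : ℝ} (hη : 0 ≤ η)
    (h : Approximates (Fintype.card (Fin k → Fin (N + 1))) η μ₁ W.graphon ν₁ U.graphon)
    {x : LevyProkhorov (Measure (ProfileSpace k))} (hx : x ∈ W.profile k) :
    ∃ y ∈ U.profile k, edist x y ≤ ENNReal.ofReal ((2 * k + 1) * (3 / N) +
      Fintype.card ((Fin k → Fin (N + 1)) × (Fin k → Fin (N + 1))) * η) := by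
  have hN' : (0 : ℝ) < N := by exact_mod_cast hN
  obtain ⟨f, hf, hf1, rfl⟩ := hx
  let c : Ω₁ → Fin k → Fin (N + 1) := fun x i => gridIndex N (f i x)
  have hc : Measurable c := measurable_pi_iff.2 fun i => (measurable_gridIndex N).comp (hf i)
  obtain ⟨c', hc', hcc'⟩ := h.exists_coloring hc
  let val : Fin k → (Fin k → Fin (N + 1)) → ℝ := fun i q => gridPoint N (q i)
  have hfc : ∀ i, Measurable fun x => val i (c x) := fun i => (measurable_of_finite (val i)).comp hc
  refine ⟨LevyProkhorov.ofMeasure (U.generatedMeasure fun i y => val i (c' y)),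
    ⟨_, fun i => (measurable_of_finite (val i)).comp hc',
      fun i => ae_of_all _ fun y => gridPoint_mem hN _, rfl⟩, ?_⟩
  refine LPClose.edist_le (by positivity) (LPClose.trans (by positivity) (by positivity)
    (ν := W.generatedMeasure fun i x => val i (c x)) ?_
    (generatedMeasure_close_of_blockLaw_close W U hc hc' val hη hcc'))
  refine LPClose.map_of_ae (W.measurable_profileVector hf) (W.measurable_profileVector hfc) ?_
  have h1 : ∀ᵐ p ∂(μ₁.prod (μ₁.prod μ₂)), ∀ i, f i p.1 ∈ Set.Icc (-1 : ℝ) 1 :=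
    Measure.quasiMeasurePreserving_fst.ae (ae_all_iff.2 hf1)
  have h2 : ∀ᵐ p ∂(μ₁.prod (μ₁.prod μ₂)), ∀ i, f i p.2.1 ∈ Set.Icc (-1 : ℝ) 1 :=
    (Measure.quasiMeasurePreserving_fst.comp Measure.quasiMeasurePreserving_snd).ae
      (ae_all_iff.2 hf1)
  filter_upwards [h1, h2] with p hp1 hp2
  rw [edist_lt_ofReal]
  refine (dist_le_of_coord_le (r := 2 / N) (by positivity) ?_).trans_lt ?_
  · rintro (i | i | i)
    · exact abs_sub_gridPoint_le hN (hp1 i)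
    · exact abs_sub_gridPoint_le hN (hp2 i)
    · exact (dist_self (W.toFun p)).trans_le (by positivity)
  · gcongr
    norm_num

lemma hausdorffEDist_profile_le_one [IsProbabilityMeasure μ₁] [IsProbabilityMeasure μ₂]
    [IsProbabilityMeasure ν₁] [IsProbabilityMeasure ν₂] (W : PVariable μ₁ μ₂)
    (U : PVariable ν₁ ν₂) (k : ℕ) :
    Metric.hausdorffEDist (W.profile k) (U.profile k) ≤ 1 := by
  have key : ∀ {x y : LevyProkhorov (Measure (ProfileSpace k))}, x ∈ W.profile k →
      y ∈ U.profile k → edist x y ≤ 1 := by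
    rintro x y ⟨f, hf, -, rfl⟩ ⟨f', hf', -, rfl⟩
    have := W.isProbabilityMeasure_generatedMeasure hf
    have := U.isProbabilityMeasure_generatedMeasure hf'
    refine (levyProkhorovEDist_le_max_measure_univ _ _).trans ?_
    simp
  have hW : LevyProkhorov.ofMeasure (W.generatedMeasure (fun (_ : Fin k) _ => 0)) ∈ W.profile k :=
    ⟨_, fun _ => measurable_const, fun _ => ae_of_all _ fun _ => by simp, rfl⟩
  have hU : LevyProkhorov.ofMeasure (U.generatedMeasure (fun (_ : Fin k) _ => 0)) ∈ U.profile k :=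
    ⟨_, fun _ => measurable_const, fun _ => ae_of_all _ fun _ => by simp, rfl⟩
  refine Metric.hausdorffEDist_le_of_mem_edist (fun x hx => ⟨_, hU, key hx hU⟩)
    fun y hy => ⟨_, hW, ?_⟩
  rw [edist_comm]
  exact key hW hy

end

section Families

variable {ι : Type*} {l : Filter ι}
  {X : ι → Type*} {X' : ι → Type*} [∀ i, MeasurableSpace (X i)] [∀ i, MeasurableSpace (X' i)]
  {μ : ∀ i, Measure (X i)} {μ' : ∀ i, Measure (X' i)}
  [∀ i, IsProbabilityMeasure (μ i)] [∀ i, IsProbabilityMeasure (μ' i)]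
  {Y : ι → Type*} {Y' : ι → Type*} [∀ i, MeasurableSpace (Y i)] [∀ i, MeasurableSpace (Y' i)]
  {ν : ∀ i, Measure (Y i)} {ν' : ∀ i, Measure (Y' i)}
  [∀ i, IsProbabilityMeasure (ν i)] [∀ i, IsProbabilityMeasure (ν' i)]
  {W : ∀ i, PVariable (μ i) (μ' i)} {U : ∀ i, PVariable (ν i) (ν' i)}

lemma dM_comm {Ω₁ : Type*} {Ω₂ : Type*} [MeasurableSpace Ω₁] [MeasurableSpace Ω₂]
    {μ₁ : Measure Ω₁} {μ₂ : Measure Ω₂}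
    {Ω₁' : Type*} {Ω₂' : Type*} [MeasurableSpace Ω₁'] [MeasurableSpace Ω₂']
    {ν₁ : Measure Ω₁'} {ν₂ : Measure Ω₂'} (W : PVariable μ₁ μ₂) (U : PVariable ν₁ ν₂) :
    W.dM U = U.dM W := by
  simp only [dM, Metric.hausdorffEDist_comm]

lemma imitates_of_tendsto_dM (h : Tendsto (fun i => (W i).dM (U i)) l (𝓝 0)) :
    Imitates l μ (fun i => (W i).graphon) ν (fun i => (U i).graphon) := by
  intro m ε hε
  let η : ℝ := min ε (1 / (2 * m + 1))
  have hη : 0 < η := lt_min hε (by positivity)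
  have hηm : η * (2 * m) ≤ 1 := by
    calc η * (2 * m) ≤ 1 / (2 * m + 1) * (2 * m + 1) := by
          gcongr
          · exact min_le_right _ _
          · linarith
      _ = 1 := by field_simp
  have h2 : Tendsto (fun i => 2 * (W i).dM (U i)) l (𝓝 0) := by
    simpa using ENNReal.Tendsto.const_mul h (Or.inr (by simp : (2 : ℝ≥0∞) ≠ ∞))
  filter_upwards [h2.eventually (gt_mem_nhds (ENNReal.ofReal_pos.2 hη))] with i hi
  exact (approximates_of_dM_lt (W i) (U i) hη hηm hi).mono (min_le_left _ _)

lemma tendsto_hausdorffEDist_profile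
    (h : Imitates l μ (fun i => (W i).graphon) ν (fun i => (U i).graphon))
    (h' : Imitates l ν (fun i => (U i).graphon) μ (fun i => (W i).graphon)) (k : ℕ) :
    Tendsto (fun i => Metric.hausdorffEDist ((W i).profile k) ((U i).profile k)) l (𝓝 0) := by
  refine ENNReal.tendsto_nhds_zero.2 fun r hr => ?_
  obtain ⟨ε, hε, hεr⟩ := exists_ofReal_le hr
  obtain ⟨N, hN⟩ := exists_nat_gt ((2 * k + 1) * 3 / (ε / 2))
  have hN0 : (0 : ℝ) < N := lt_of_le_of_lt (by positivity) hN
  have hN1 : 0 < N := by exact_mod_cast hN0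
  have hN2 : (2 * k + 1) * (3 / N) ≤ ε / 2 := by
    rw [div_lt_iff₀ (by positivity)] at hN
    rw [mul_div_assoc', div_le_iff₀ hN0]
    linarith
  let M : ℝ := Fintype.card ((Fin k → Fin (N + 1)) × (Fin k → Fin (N + 1)))
  have hM : 0 < M := by
    have : 0 < Fintype.card ((Fin k → Fin (N + 1)) × (Fin k → Fin (N + 1))) := Fintype.card_pos
    exact Nat.cast_pos.2 this
  have hη : 0 < ε / 2 / M := by positivity
  have hsum : (2 * k + 1) * (3 / N) + M * (ε / 2 / M) ≤ ε := by
    rw [mul_div_cancel₀ _ hM.ne']; linarith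
  filter_upwards [h _ _ hη, h' _ _ hη] with i h1 h2
  refine Metric.hausdorffEDist_le_of_mem_edist (fun x hx => ?_) (fun x hx => ?_)
  · obtain ⟨y, hy, hxy⟩ := exists_mem_profile_close (W i) (U i) hN1 hη.le h1 hx
    exact ⟨y, hy, hxy.trans ((ENNReal.ofReal_le_ofReal hsum).trans hεr)⟩
  · obtain ⟨y, hy, hxy⟩ := exists_mem_profile_close (U i) (W i) hN1 hη.le h2 hx
    exact ⟨y, hy, hxy.trans ((ENNReal.ofReal_le_ofReal hsum).trans hεr)⟩

lemma tendsto_dM_of_imitates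
    (h : Imitates l μ (fun i => (W i).graphon) ν (fun i => (U i).graphon))
    (h' : Imitates l ν (fun i => (U i).graphon) μ (fun i => (W i).graphon)) :
    Tendsto (fun i => (W i).dM (U i)) l (𝓝 0) := by
  refine ENNReal.tendsto_nhds_zero.2 fun r hr => ?_
  have hgeom : ∑' k : ℕ, (2⁻¹ : ℝ≥0∞) ^ (k + 1) ≠ ∞ := by
    rw [ENNReal.tsum_geometric_add_one, ENNReal.one_sub_inv_two, inv_inv]
    simp
  have hr2 : 0 < r / 2 := ENNReal.half_pos hr.ne'
  obtain ⟨K, hK⟩ := (ENNReal.tendsto_nhds_zero.1 (ENNReal.tendsto_sum_nat_add _ hgeom) _ hr2).exists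
  have hfin : Tendsto (fun i => ∑ k ∈ Finset.range K, (2⁻¹ : ℝ≥0∞) ^ (k + 1) *
      Metric.hausdorffEDist ((W i).profile (k + 1)) ((U i).profile (k + 1))) l (𝓝 0) := by
    have h0 : (0 : ℝ≥0∞) = ∑ _k ∈ Finset.range K, 0 := by simp
    rw [h0]
    refine tendsto_finsetSum _ fun k _ => ?_
    simpa using ENNReal.Tendsto.const_mul (a := (2⁻¹ : ℝ≥0∞) ^ (k + 1))
      (tendsto_hausdorffEDist_profile h h' (k + 1)) (Or.inr (by simp))
  filter_upwards [ENNReal.tendsto_nhds_zero.1 hfin _ hr2] with i hi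
  rw [dM, ← ENNReal.summable.sum_add_tsum_nat_add' (k := K), ← ENNReal.add_halves r]
  refine add_le_add hi (le_trans (ENNReal.tsum_le_tsum fun k => ?_) hK)
  exact mul_le_of_le_one_right' (hausdorffEDist_profile_le_one _ _ _)

end Families

end PVariable

/-! ### Energy of colourings and weak regularity -/

section Energy

variable {X Y : Type*} [MeasurableSpace X] [MeasurableSpace Y] {Λ : Type*}

/-- The energy of a system of step functions `M l (c x) (c y)` with respect to a system `w` of
functions on `X × X`, which is `∑ l, (‖w l‖² - ‖w l - M l (c ·) (c ·)‖²)` in `L²`. -/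
def energy [Fintype Λ] (μ : Measure X) (w : Λ → X × X → ℝ) {C : Type*} (c : X → C)
    (M : Λ → C → C → ℝ) : ℝ :=
  ∑ l, ∫ p, (2 * M l (c p.1) (c p.2) * w l p - M l (c p.1) (c p.2) ^ 2) ∂(μ.prod μ)

/-- The step functions `M l (c x) (c y)` approximate the functions `w l` up to `η` in the cut
norm. -/
def CutRegular (μ : Measure X) (η : ℝ) (w : Λ → X × X → ℝ) {C : Type*} (c : X → C)
    (M : Λ → C → C → ℝ) : Prop :=
  ∀ l S T, MeasurableSet S → MeasurableSet T →
    |∫ p in S ×ˢ T, (w l p - M l (c p.1) (c p.2)) ∂(μ.prod μ)| ≤ η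

/-- The averages of two systems of functions over the blocks of two colourings, and the measures
of the blocks, differ by at most `τ`. -/
def BlockClose (τ : ℝ) (μ : Measure X) (w : Λ → X × X → ℝ) (ν : Measure Y) (w' : Λ → Y × Y → ℝ)
    {C : Type*} (c : X → C) (c' : Y → C) : Prop :=
  ∀ a b, (∀ l, |∫ p in (c ⁻¹' {a}) ×ˢ (c ⁻¹' {b}), w l p ∂(μ.prod μ) -
      ∫ p in (c' ⁻¹' {a}) ×ˢ (c' ⁻¹' {b}), w' l p ∂(ν.prod ν)| ≤ τ) ∧
    |μ.real (c ⁻¹' {a}) * μ.real (c ⁻¹' {b}) - ν.real (c' ⁻¹' {a}) * ν.real (c' ⁻¹' {b})| ≤ τ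

variable {μ : Measure X} [IsProbabilityMeasure μ] {w : Λ → X × X → ℝ}
  {ν : Measure Y} [IsProbabilityMeasure ν] {w' : Λ → Y × Y → ℝ}
  {C : Type*} [Fintype C] [MeasurableSpace C] [MeasurableSingletonClass C] {c : X → C} {c' : Y → C}
  {M : Λ → C → C → ℝ} {η τ K : ℝ}

lemma measurable_step (hc : Measurable c) (m : C → C → ℝ) :
    Measurable fun p : X × X => m (c p.1) (c p.2) :=
  (measurable_of_finite fun q : C × C => m q.1 q.2).comp
    ((hc.comp measurable_fst).prodMk (hc.comp measurable_snd))

lemma integrable_of_mem_unit (hw : ∀ l, Measurable (w l)) (hw0 : ∀ l p, 0 ≤ w l p)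
    (hw1 : ∀ l p, w l p ≤ 1) (l : Λ) : Integrable (w l) (μ.prod μ) :=
  Integrable.of_bound (hw l).aestronglyMeasurable 1 (ae_of_all _ fun p => by
    rw [Real.norm_eq_abs, abs_of_nonneg (hw0 l p)]; exact hw1 l p)

lemma integrable_step (hc : Measurable c) (m : C → C → ℝ) :
    Integrable (fun p : X × X => m (c p.1) (c p.2)) (μ.prod μ) := by
  refine Integrable.of_bound (measurable_step hc m).aestronglyMeasurable (∑ a, ∑ b, |m a b|)
    (ae_of_all _ fun p => ?_)
  rw [Real.norm_eq_abs]
  calc |m (c p.1) (c p.2)| ≤ ∑ b, |m (c p.1) b| :=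
        Finset.single_le_sum (f := fun b => |m (c p.1) b|) (fun _ _ => abs_nonneg _)
          (Finset.mem_univ _)
    _ ≤ ∑ a, ∑ b, |m a b| :=
        Finset.single_le_sum (f := fun a => ∑ b, |m a b|)
          (fun _ _ => Finset.sum_nonneg fun _ _ => abs_nonneg _) (Finset.mem_univ _)

lemma integrable_step_mul (hw : ∀ l, Measurable (w l)) (hw0 : ∀ l p, 0 ≤ w l p)
    (hw1 : ∀ l p, w l p ≤ 1) (hc : Measurable c) (m : C → C → ℝ) (l : Λ) :
    Integrable (fun p : X × X => m (c p.1) (c p.2) * w l p) (μ.prod μ) :=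
  (integrable_step hc m).mul_bdd (c := 1) (hw l).aestronglyMeasurable (ae_of_all _ fun p => by
    rw [Real.norm_eq_abs, abs_of_nonneg (hw0 l p)]; exact hw1 l p)

lemma integrable_energy (hw : ∀ l, Measurable (w l)) (hw0 : ∀ l p, 0 ≤ w l p)
    (hw1 : ∀ l p, w l p ≤ 1) (hc : Measurable c) (m : C → C → ℝ) (l : Λ) :
    Integrable (fun p : X × X => 2 * m (c p.1) (c p.2) * w l p - m (c p.1) (c p.2) ^ 2)
      (μ.prod μ) :=
  (integrable_step_mul hw hw0 hw1 hc (fun a b => 2 * m a b) l).sub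
    (integrable_step hc (fun a b => m a b ^ 2))

variable [Fintype Λ]

lemma energy_le_card (hw : ∀ l, Measurable (w l)) (hw0 : ∀ l p, 0 ≤ w l p)
    (hw1 : ∀ l p, w l p ≤ 1) (hc : Measurable c) : energy μ w c M ≤ Fintype.card Λ := by
  rw [energy, ← Finset.card_univ, Finset.cast_card]
  refine Finset.sum_le_sum fun l _ => ?_
  calc _ ≤ ∫ _, (1 : ℝ) ∂(μ.prod μ) := by
        refine integral_mono (integrable_energy hw hw0 hw1 hc (M l) l) (integrable_const 1) ?_
        intro p
        have h0 := hw0 l p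
        have h1 := hw1 l p
        show 2 * M l (c p.1) (c p.2) * w l p - M l (c p.1) (c p.2) ^ 2 ≤ 1
        nlinarith [sq_nonneg (M l (c p.1) (c p.2) - w l p)]
    _ = 1 := by simp

/-- The energy only depends on the integrals over the blocks and on the sizes of the blocks. -/
lemma energy_eq_sum (hw : ∀ l, Measurable (w l)) (hw0 : ∀ l p, 0 ≤ w l p)
    (hw1 : ∀ l p, w l p ≤ 1) (hc : Measurable c) :
    energy μ w c M = ∑ l, ∑ q : C × C,
      (2 * M l q.1 q.2 * ∫ p in (c ⁻¹' {q.1}) ×ˢ (c ⁻¹' {q.2}), w l p ∂(μ.prod μ) -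
        M l q.1 q.2 ^ 2 * (μ.real (c ⁻¹' {q.1}) * μ.real (c ⁻¹' {q.2}))) := by
  refine Finset.sum_congr rfl fun l _ => ?_
  have hcs := fun a : C => hc (measurableSet_singleton a)
  have hun : (⋃ q : C × C, (c ⁻¹' {q.1}) ×ˢ (c ⁻¹' {q.2})) = Set.univ := by
    ext p; simp
  rw [← setIntegral_univ, ← hun, integral_iUnion_fintype
    (fun q : C × C => (hcs q.1).prod (hcs q.2)) ?_
    (fun q => (integrable_energy hw hw0 hw1 hc (M l) l).integrableOn)]
  · refine Finset.sum_congr rfl fun q _ => ?_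
    have hq : MeasurableSet ((c ⁻¹' {q.1}) ×ˢ (c ⁻¹' {q.2})) := (hcs q.1).prod (hcs q.2)
    rw [setIntegral_congr_fun (g := fun p => 2 * M l q.1 q.2 * w l p - M l q.1 q.2 ^ 2) hq,
      integral_sub, integral_const_mul, setIntegral_const, smul_eq_mul, measureReal_prod_prod,
      mul_comm (M l q.1 q.2 ^ 2)]
    · exact ((integrable_of_mem_unit hw hw0 hw1 l).const_mul _).integrableOn
    · exact integrable_const _
    · rintro p ⟨h1, h2⟩
      have h1 : c p.1 = q.1 := h1
      have h2 : c p.2 = q.2 := h2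
      simp only [h1, h2]
  · intro q q' hqq
    refine Set.disjoint_left.2 fun p h1 h2 => hqq (Prod.ext ?_ ?_)
    · exact (show c p.1 = q.1 from h1.1).symm.trans h2.1
    · exact (show c p.2 = q.2 from h1.2).symm.trans h2.2

lemma energy_le_of_blockClose (hw : ∀ l, Measurable (w l)) (hw0 : ∀ l p, 0 ≤ w l p)
    (hw1 : ∀ l p, w l p ≤ 1) (hc : Measurable c) (hw' : ∀ l, Measurable (w' l))
    (hw0' : ∀ l p, 0 ≤ w' l p) (hw1' : ∀ l p, w' l p ≤ 1) (hc' : Measurable c')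
    (h : BlockClose τ μ w ν w' c c') (hM : ∀ l a b, |M l a b| ≤ K) :
    energy μ w c M ≤ energy ν w' c' M +
      Fintype.card Λ * (Fintype.card C ^ 2 * ((2 * K + K ^ 2) * τ)) := by
  rw [energy_eq_sum hw hw0 hw1 hc, energy_eq_sum hw' hw0' hw1' hc']
  have hconst : (Fintype.card Λ : ℝ) * (Fintype.card C ^ 2 * ((2 * K + K ^ 2) * τ)) =
      ∑ _l : Λ, ∑ _q : C × C, (2 * K + K ^ 2) * τ := by
    simp only [Finset.sum_const, Finset.card_univ, Fintype.card_prod, nsmul_eq_mul]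
    push_cast; ring
  rw [hconst, ← Finset.sum_add_distrib]
  refine Finset.sum_le_sum fun l _ => ?_
  rw [← Finset.sum_add_distrib]
  refine Finset.sum_le_sum fun q _ => ?_
  have h1 := (h q.1 q.2).1 l
  have h2 := (h q.1 q.2).2
  have hMq := hM l q.1 q.2
  set m := M l q.1 q.2
  set i1 := ∫ p in (c ⁻¹' {q.1}) ×ˢ (c ⁻¹' {q.2}), w l p ∂(μ.prod μ)
  set i2 := ∫ p in (c' ⁻¹' {q.1}) ×ˢ (c' ⁻¹' {q.2}), w' l p ∂(ν.prod ν)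
  set s1 := μ.real (c ⁻¹' {q.1}) * μ.real (c ⁻¹' {q.2})
  set s2 := ν.real (c' ⁻¹' {q.1}) * ν.real (c' ⁻¹' {q.2})
  have hK : 0 ≤ K := (abs_nonneg _).trans hMq
  have h3 : |m * (i1 - i2)| ≤ K * τ := by
    rw [abs_mul]; exact mul_le_mul hMq h1 (abs_nonneg _) hK
  have h4 : |m ^ 2 * (s1 - s2)| ≤ K ^ 2 * τ := by
    rw [abs_mul, abs_pow]
    exact mul_le_mul (pow_le_pow_left₀ (abs_nonneg _) hMq 2) h2 (abs_nonneg _) (by positivity)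
  have h5 := (abs_le.1 h3).2
  have h6 := (abs_le.1 h4).1
  nlinarith

/-- Adding `r • 1_{S × T}` to one of the step functions gives step functions for a colouring with
four times as many colours. -/
lemma energy_add_rectangle [DecidableEq Λ] (hw : ∀ l, Measurable (w l)) (hw0 : ∀ l p, 0 ≤ w l p)
    (hw1 : ∀ l p, w l p ≤ 1) (hc : Measurable c) {S T : Set X} (hS : MeasurableSet S)
    (hT : MeasurableSet T) (hM : ∀ l a b, |M l a b| ≤ K) (l₀ : Λ) (r : ℝ) :
    ∃ (c₂ : X → C × Bool × Bool) (M₂ : Λ → C × Bool × Bool → C × Bool × Bool → ℝ),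
      Measurable c₂ ∧ (∀ l a b, |M₂ l a b| ≤ K + |r|) ∧
      energy μ w c M + (2 * (r * ∫ p in S ×ˢ T, (w l₀ p - M l₀ (c p.1) (c p.2)) ∂(μ.prod μ)) -
        r ^ 2) ≤ energy μ w c₂ M₂ := by
  classical
  let c₂ : X → C × Bool × Bool := fun x =>
    (c x, if x ∈ S then true else false, if x ∈ T then true else false)
  let M₂ : Λ → C × Bool × Bool → C × Bool × Bool → ℝ := fun l a b =>
    M l a.1 b.1 + if l = l₀ ∧ a.2.1 = true ∧ b.2.2 = true then r else 0
  have hc₂ : Measurable c₂ :=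
    hc.prodMk ((Measurable.ite hS measurable_const measurable_const).prodMk
      (Measurable.ite hT measurable_const measurable_const))
  refine ⟨c₂, M₂, hc₂, fun l a b => (abs_add_le _ _).trans (add_le_add (hM _ _ _) ?_), ?_⟩
  · split_ifs
    · exact le_rfl
    · rw [abs_zero]; exact abs_nonneg r
  have hR : MeasurableSet (S ×ˢ T) := hS.prod hT
  have hd : Integrable (fun p => w l₀ p - M l₀ (c p.1) (c p.2)) (μ.prod μ) :=
    (integrable_of_mem_unit hw hw0 hw1 l₀).sub (integrable_step hc (M l₀))
  have hterm : ∀ l, ∫ p, (2 * M₂ l (c₂ p.1) (c₂ p.2) * w l p - M₂ l (c₂ p.1) (c₂ p.2) ^ 2)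
      ∂(μ.prod μ) = ∫ p, (2 * M l (c p.1) (c p.2) * w l p - M l (c p.1) (c p.2) ^ 2) ∂(μ.prod μ) +
      if l = l₀ then 2 * (r * ∫ p in S ×ˢ T, (w l₀ p - M l₀ (c p.1) (c p.2)) ∂(μ.prod μ)) -
        r ^ 2 * (μ.prod μ).real (S ×ˢ T) else 0 := by
    intro l
    by_cases hl : l = l₀
    · subst hl
      rw [if_pos rfl]
      have e : ∀ p, 2 * M₂ l (c₂ p.1) (c₂ p.2) * w l p - M₂ l (c₂ p.1) (c₂ p.2) ^ 2 =
          (2 * M l (c p.1) (c p.2) * w l p - M l (c p.1) (c p.2) ^ 2) +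
          (S ×ˢ T).indicator (fun p => 2 * r * (w l p - M l (c p.1) (c p.2)) - r ^ 2) p := by
        intro p
        by_cases hp : p ∈ S ×ˢ T
        · rw [Set.indicator_of_mem hp]
          have hM₂ : M₂ l (c₂ p.1) (c₂ p.2) = M l (c p.1) (c p.2) + r := by
            simp [M₂, c₂, hp.1, hp.2]
          rw [hM₂]; ring
        · rw [Set.indicator_of_notMem hp]
          have hM₂ : M₂ l (c₂ p.1) (c₂ p.2) = M l (c p.1) (c p.2) := by
            have : ¬ (p.1 ∈ S ∧ p.2 ∈ T) := hp
            simp [M₂, c₂, this]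
          rw [hM₂, add_zero]
      simp_rw [e]
      rw [integral_add (integrable_energy hw hw0 hw1 hc (M l) l)
        (Integrable.indicator (f := fun p => 2 * r * (w l p - M l (c p.1) (c p.2)) - r ^ 2)
          ((hd.const_mul (2 * r)).sub (integrable_const (r ^ 2))) hR),
        integral_indicator hR, integral_sub (hd.const_mul (2 * r)).integrableOn
        (integrable_const _), integral_const_mul, setIntegral_const, smul_eq_mul]
      ring
    · rw [if_neg hl, add_zero]
      have hM₂ : ∀ p : X × X, M₂ l (c₂ p.1) (c₂ p.2) = M l (c p.1) (c p.2) := fun p => by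
        simp [M₂, c₂, hl]
      simp_rw [hM₂]
  rw [energy, energy, Finset.sum_congr rfl fun l _ => hterm l, Finset.sum_add_distrib,
    Finset.sum_ite_eq' Finset.univ l₀, if_pos (Finset.mem_univ _)]
  have h1 : (μ.prod μ).real (S ×ˢ T) ≤ 1 := measureReal_le_one
  have h2 : r ^ 2 * (μ.prod μ).real (S ×ˢ T) ≤ r ^ 2 := mul_le_of_le_one_right (sq_nonneg r) h1
  linarith

/-- Step functions whose energy cannot be increased by `η²` by a refinement into four times as many
colours are regular. -/
lemma cutRegular_of_energy_lt (hw : ∀ l, Measurable (w l)) (hw0 : ∀ l p, 0 ≤ w l p)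
    (hw1 : ∀ l p, w l p ≤ 1) (hc : Measurable c) (hM : ∀ l a b, |M l a b| ≤ K)
    (hη : 0 < η) (hη1 : η ≤ 1)
    (h : ∀ (c₂ : X → C × Bool × Bool) (M₂ : Λ → C × Bool × Bool → C × Bool × Bool → ℝ),
      Measurable c₂ → (∀ l a b, |M₂ l a b| ≤ K + 1) →
        energy μ w c₂ M₂ ≤ energy μ w c M + η ^ 2) :
    CutRegular μ η w c M := by
  classical
  intro l S T hS hT
  by_contra! hlt
  obtain ⟨r, hr, hrη⟩ : ∃ r : ℝ, |r| = η ∧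
      η < r / η * ∫ p in S ×ˢ T, (w l p - M l (c p.1) (c p.2)) ∂(μ.prod μ) := by
    rcases lt_abs.1 hlt with h1 | h1
    · exact ⟨η, abs_of_pos hη, by rwa [div_self hη.ne', one_mul]⟩
    · exact ⟨-η, by rw [abs_neg, abs_of_pos hη], by rw [neg_div, div_self hη.ne']; linarith⟩
  obtain ⟨c₂, M₂, hc₂, hM₂, hE⟩ := energy_add_rectangle (μ := μ) hw hw0 hw1 hc hS hT hM l r
  have h2 := h c₂ M₂ hc₂ fun l a b => (hM₂ l a b).trans (by rw [hr]; linarith)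
  have h3 : r ^ 2 = η ^ 2 := by rw [← sq_abs, hr]
  rw [div_mul_eq_mul_div, lt_div_iff₀ hη] at hrη
  nlinarith

end Energy

section Transfer

variable {X Y : Type*} [MeasurableSpace X] [MeasurableSpace Y] {Λ : Type*} [Fintype Λ]
  {μ : Measure X} [IsProbabilityMeasure μ] {w : Λ → X × X → ℝ}
  {ν : Measure Y} [IsProbabilityMeasure ν] {w' : Λ → Y × Y → ℝ}

/-- The supremum of the energy over colourings with `4 ^ t` colours and coefficients bounded
by `t`. -/
def maxEnergy (μ : Measure X) (w : Λ → X × X → ℝ) (t : ℕ) : ℝ :=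
  sSup {E | ∃ (c : X → Fin (4 ^ t)) (M : Λ → Fin (4 ^ t) → Fin (4 ^ t) → ℝ), Measurable c ∧
    (∀ l a b, |M l a b| ≤ t) ∧ E = energy μ w c M}

lemma energy_le_maxEnergy (hw : ∀ l, Measurable (w l)) (hw0 : ∀ l p, 0 ≤ w l p)
    (hw1 : ∀ l p, w l p ≤ 1) {t : ℕ} {c : X → Fin (4 ^ t)} (hc : Measurable c)
    {M : Λ → Fin (4 ^ t) → Fin (4 ^ t) → ℝ} (hM : ∀ l a b, |M l a b| ≤ t) :
    energy μ w c M ≤ maxEnergy μ w t := by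
  refine le_csSup ⟨Fintype.card Λ, ?_⟩ ⟨c, M, hc, hM, rfl⟩
  rintro _ ⟨c, M, hc, -, rfl⟩
  exact energy_le_card hw hw0 hw1 hc

lemma exists_lt_energy (μ : Measure X) (w : Λ → X × X → ℝ) (t : ℕ) {r : ℝ}
    (hr : r < maxEnergy μ w t) :
    ∃ (c : X → Fin (4 ^ t)) (M : Λ → Fin (4 ^ t) → Fin (4 ^ t) → ℝ), Measurable c ∧
      (∀ l a b, |M l a b| ≤ t) ∧ r < energy μ w c M := by
  have hne : {E | ∃ (c : X → Fin (4 ^ t)) (M : Λ → Fin (4 ^ t) → Fin (4 ^ t) → ℝ), Measurable c ∧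
      (∀ l a b, |M l a b| ≤ t) ∧ E = energy μ w c M}.Nonempty :=
    ⟨_, fun _ => ⟨0, by positivity⟩, fun _ _ _ => 0, measurable_const, fun _ _ _ => by simp, rfl⟩
  obtain ⟨_, ⟨c, M, hc, hM, rfl⟩, h⟩ := exists_lt_of_lt_csSup hne hr
  exact ⟨c, M, hc, hM, h⟩

/-- The maximal energies are bounded by the number of functions, so they cannot increase by a fixed
amount too often. -/
lemma exists_maxEnergy_succ_le (hw : ∀ l, Measurable (w l)) (hw0 : ∀ l p, 0 ≤ w l p)
    (hw1 : ∀ l p, w l p ≤ 1) {δ : ℝ} {T : ℕ} (hT : Fintype.card Λ < T * δ) :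
    ∃ t < T, maxEnergy μ w (t + 1) ≤ maxEnergy μ w t + δ := by
  by_contra! hcon
  have hE0 : 0 ≤ maxEnergy μ w 0 := by
    have h := energy_le_maxEnergy (μ := μ) (t := 0) hw hw0 hw1 (measurable_const (a := 0))
      (M := fun _ _ _ => 0) (fun _ _ _ => by simp)
    simpa [energy] using h
  have h1 : ∀ t ≤ T, t * δ ≤ maxEnergy μ w t := by
    intro t
    induction t with
    | zero => intro _; simpa using hE0
    | succ t ih =>
      intro ht
      have h2 := ih (by omega)
      have h3 := hcon t (by omega)
      push_cast
      linarith
  have h4 : maxEnergy μ w T ≤ Fintype.card Λ := by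
    by_contra! h5
    obtain ⟨c, M, hc, -, h6⟩ := exists_lt_energy μ w T h5
    exact absurd (energy_le_card hw hw0 hw1 hc) (not_le.2 h6)
  linarith [h1 T le_rfl]

lemma energy_reindex {C C' : Type*} (e : C ≃ C') (μ : Measure X) (w : Λ → X × X → ℝ) (c : X → C)
    (M : Λ → C → C → ℝ) :
    energy μ w c M = energy μ w (e ∘ c) (fun l a b => M l (e.symm a) (e.symm b)) := by
  simp [energy]

/-- Two systems of functions that imitate each other's colourings well enough admit simultaneous
regular step approximations with the same coefficients, on colourings that imitate each other: a
colouring of almost maximal energy at a level where the maximal energy is almost stationary is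
regular, and so is its imitation, because every refinement of the imitation is imitated in turn. -/
theorem exists_cutRegular_pair (Λ : Type*) [Fintype Λ] {η : ℝ} (hη : 0 < η) (hη1 : η ≤ 1) :
    ∃ (T : ℕ) (τ : ℝ), 0 < τ ∧ ∀ {X : Type u} {Y : Type v} [MeasurableSpace X] [MeasurableSpace Y]
      (μ : Measure X) (ν : Measure Y) [IsProbabilityMeasure μ] [IsProbabilityMeasure ν]
      (w : Λ → X × X → ℝ) (w' : Λ → Y × Y → ℝ)
      (_ : ∀ l, Measurable (w l)) (_ : ∀ l p, 0 ≤ w l p) (_ : ∀ l p, w l p ≤ 1)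
      (_ : ∀ l, Measurable (w' l)) (_ : ∀ l p, 0 ≤ w' l p) (_ : ∀ l p, w' l p ≤ 1) (θ : ℝ),
      θ ≤ τ →
      (∀ t ≤ T, ∀ c : X → Fin (4 ^ t), Measurable c → ∃ c' : Y → Fin (4 ^ t), Measurable c' ∧
        BlockClose θ μ w ν w' c c') →
      (∀ t ≤ T, ∀ c : Y → Fin (4 ^ t), Measurable c → ∃ c' : X → Fin (4 ^ t), Measurable c' ∧
        BlockClose θ ν w' μ w c c') →
      ∃ t ≤ T, ∃ (c : X → Fin (4 ^ t)) (c' : Y → Fin (4 ^ t))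
        (M : Λ → Fin (4 ^ t) → Fin (4 ^ t) → ℝ), Measurable c ∧ Measurable c' ∧
        (∀ l a b, |M l a b| ≤ T) ∧ BlockClose θ μ w ν w' c c' ∧
        CutRegular μ η w c M ∧ CutRegular ν η w' c' M := by
  obtain ⟨T, hT⟩ := exists_nat_gt (Fintype.card Λ / (η ^ 2 / 4))
  rw [div_lt_iff₀ (by positivity)] at hT
  let A : ℝ := Fintype.card Λ * ((4 ^ T : ℕ) ^ 2 * (2 * T + T ^ 2)) + 1
  have hA : 0 < A := by positivity
  refine ⟨T, η ^ 2 / 8 / A, by positivity, ?_⟩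
  intro X Y _ _ μ ν _ _ w w' hw hw0 hw1 hw' hw0' hw1' θ hθ himit himit'
  have hA' : ∀ s ≤ T, 0 ≤ θ → (Fintype.card Λ : ℝ) * ((Fintype.card (Fin (4 ^ s))) ^ 2 *
      ((2 * (s : ℝ) + s ^ 2) * θ)) ≤ η ^ 2 / 8 := by
    intro s hs hθ0
    have h1 : (s : ℝ) ≤ T := by exact_mod_cast hs
    have h2 : ((4 ^ s : ℕ) : ℝ) ≤ ((4 ^ T : ℕ) : ℝ) := by
      exact_mod_cast Nat.pow_le_pow_right (by norm_num) hs
    rw [Fintype.card_fin]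
    calc (Fintype.card Λ : ℝ) * (((4 ^ s : ℕ) : ℝ) ^ 2 * ((2 * (s : ℝ) + s ^ 2) * θ))
        ≤ Fintype.card Λ * (((4 ^ T : ℕ) : ℝ) ^ 2 * ((2 * (T : ℝ) + T ^ 2) * θ)) := by
          gcongr
      _ = (Fintype.card Λ * (((4 ^ T : ℕ) : ℝ) ^ 2 * (2 * (T : ℝ) + T ^ 2))) * θ := by ring
      _ ≤ A * (η ^ 2 / 8 / A) := by
          refine mul_le_mul (by simp only [A]; linarith) hθ hθ0 hA.le
      _ = η ^ 2 / 8 := by field_simp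
  -- of the increment `η²` that an irregular colouring would allow, one quarter is lost at each of
  -- the next two choices, and one eighth at each of the two imitations
  obtain ⟨t, htT, ht⟩ := exists_maxEnergy_succ_le (μ := μ) hw hw0 hw1 hT
  obtain ⟨c, M, hc, hM, hE⟩ := exists_lt_energy μ w t
    (r := maxEnergy μ w t - η ^ 2 / 4) (sub_lt_self _ (by positivity))
  obtain ⟨c', hc', hcc'⟩ := himit t htT.le c hc
  have hθ0 : 0 ≤ θ := (abs_nonneg _).trans (hcc' (c' (nonempty_of_isProbabilityMeasure ν).some)
    (c' (nonempty_of_isProbabilityMeasure ν).some)).2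
  -- a refinement into `4 ^ t * 4` colours is a colouring of the next level
  have hcard : Fintype.card (Fin (4 ^ t) × Bool × Bool) = Fintype.card (Fin (4 ^ (t + 1))) := by
    simp [pow_succ]
  let e := Fintype.equivOfCardEq hcard
  have hME : ∀ M₂ : Λ → Fin (4 ^ t) × Bool × Bool → Fin (4 ^ t) × Bool × Bool → ℝ,
      (∀ l a b, |M₂ l a b| ≤ (t : ℝ) + 1) →
      ∀ l a b, |M₂ l (e.symm a) (e.symm b)| ≤ ((t + 1 : ℕ) : ℝ) := fun M₂ h l a b => by
    push_cast; exact h _ _ _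
  have hη2 : 0 < η ^ 2 := by positivity
  refine ⟨t, htT.le, c, c', M, hc, hc', fun l a b => (hM l a b).trans (by exact_mod_cast htT.le),
    hcc', ?_, ?_⟩
  · refine cutRegular_of_energy_lt hw hw0 hw1 hc hM hη hη1 fun c₂ M₂ hc₂ hM₂ => ?_
    rw [energy_reindex e]
    have := energy_le_maxEnergy (μ := μ) hw hw0 hw1 ((measurable_of_finite e).comp hc₂) (hME M₂ hM₂)
    linarith
  -- a refinement of the imitation `c'` is carried back to `X`, where the maximal energy bounds it
  · refine cutRegular_of_energy_lt hw' hw0' hw1' hc' hM hη hη1 fun c₂ M₂ hc₂ hM₂ => ?_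
    rw [energy_reindex e]
    obtain ⟨c₃, hc₃, hcc₃⟩ := himit' (t + 1) htT (e ∘ c₂) ((measurable_of_finite e).comp hc₂)
    have h1 := energy_le_of_blockClose hw' hw0' hw1' ((measurable_of_finite e).comp hc₂)
      hw hw0 hw1 hc₃ hcc₃ (hME M₂ hM₂)
    have h2 := energy_le_maxEnergy (μ := μ) hw hw0 hw1 hc₃ (hME M₂ hM₂)
    have h3 := energy_le_of_blockClose hw hw0 hw1 hc hw' hw0' hw1' hc' hcc' hM
    have h4 := hA' (t + 1) htT hθ0
    have h5 := hA' t htT.le hθ0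
    linarith

end Transfer

/-! ### Matching colourings of `[0, 1]` by interval permutations -/

/-- Two colourings of a finite set can be matched by a permutation up to the unavoidable
discrepancy of the sizes of the colour classes: the truncated subtraction counts the excess of each
class of `d` over the class of `d'`. -/
lemma exists_perm_matching {V C : Type*} [Fintype V] [DecidableEq V] [Fintype C] [DecidableEq C]
    (d d' : V → C) :
    ∃ τ : Equiv.Perm V, (Finset.univ.filter fun i => d i ≠ d' (τ i)).card ≤
      ∑ a, ((Finset.univ.filter fun i => d i = a).card -
        (Finset.univ.filter fun i => d' i = a).card) := by
  obtain ⟨τ, hτ⟩ := Finite.exists_min fun τ : Equiv.Perm V =>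
    (Finset.univ.filter fun i => d i ≠ d' (τ i)).card
  refine ⟨τ, ?_⟩
  have hfib := Finset.card_eq_sum_card_fiberwise (s := Finset.univ.filter fun i => d i ≠ d' (τ i))
    (t := Finset.univ) (f := d) (fun _ _ => by simp)
  rw [hfib]
  refine Finset.sum_le_sum fun a _ => ?_
  by_cases hne : ((Finset.univ.filter fun i => d i ≠ d' (τ i)).filter fun i => d i = a) = ∅
  · rw [hne]; simp
  obtain ⟨i, hi⟩ := Finset.nonempty_iff_ne_empty.2 hne
  simp only [Finset.mem_filter, Finset.mem_univ, true_and] at hi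
  -- every vertex matched to the colour `a` has the colour `a`: otherwise a swap would do better
  have hsub : ∀ j, d' (τ j) = a → d j = a := by
    intro j hj
    by_contra hja
    have hlt : (Finset.univ.filter fun k => d k ≠ d' ((Equiv.swap i j).trans τ k)).card <
        (Finset.univ.filter fun k => d k ≠ d' (τ k)).card := by
      refine Finset.card_lt_card ⟨fun k hk => ?_, fun hss => ?_⟩
      · have hk := (Finset.mem_filter.1 hk).2
        refine Finset.mem_filter.2 ⟨Finset.mem_univ k, ?_⟩
        by_cases hki : k = i
        · rw [hki]; exact hi.1
        by_cases hkj : k = j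
        · rw [hkj, hj]; exact hja
        rwa [Equiv.trans_apply, Equiv.swap_apply_of_ne_of_ne hki hkj] at hk
      · have := (Finset.mem_filter.1 (hss (Finset.mem_filter.2 ⟨Finset.mem_univ i, hi.1⟩))).2
        rw [Equiv.trans_apply, Equiv.swap_apply_left] at this
        exact this (hi.2.trans hj.symm)
    exact absurd (hτ ((Equiv.swap i j).trans τ)) (not_le.2 hlt)
  have hcard : (Finset.univ.filter fun i => d' i = a).card =
      (Finset.univ.filter fun j => d' (τ j) = a).card :=
    (Finset.card_bij (fun j _ => τ j) (fun j hj => by simpa using hj)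
      (fun _ _ _ _ h => τ.injective h) fun k hk => ⟨τ.symm k, by simpa using hk, by simp⟩).symm
  rw [hcard, ← Finset.card_sdiff_of_subset fun j hj => by
    simp only [Finset.mem_filter, Finset.mem_univ, true_and] at hj ⊢; exact hsub j hj]
  refine Finset.card_le_card fun j hj => ?_
  simp only [Finset.mem_filter, Finset.mem_univ, true_and, Finset.mem_sdiff] at hj ⊢
  exact ⟨hj.2, fun h => hj.1 (hj.2.trans h.symm)⟩

/-- The index of the interval among `[0, 1/n], (1/n, 2/n], …` that contains `x`; for `n` the order
of a graph this is `WeightedGraph.stepIndex`. -/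
def cell (n : ℕ) [NeZero n] (x : I) : Fin n :=
  ⟨⌈(x : ℝ) * n⌉₊ - 1, by
    have h1 : ⌈(x : ℝ) * n⌉₊ ≤ n :=
      Nat.ceil_le.2 (mul_le_of_le_one_left (Nat.cast_nonneg _) x.2.2)
    have h2 := NeZero.pos n
    omega⟩

section Cell

variable {n : ℕ} [NeZero n]

lemma cell_eq_iff {x : I} (hx : x ≠ 0) (i : Fin n) :
    cell n x = i ↔ (i : ℝ) / n < x ∧ (x : ℝ) ≤ (i + 1) / n := by
  have hn : (0 : ℝ) < n := by exact_mod_cast NeZero.pos n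
  have hx0 : 0 < (x : ℝ) := lt_of_le_of_ne x.2.1 fun h => hx (Subtype.ext h.symm)
  have hpos : 0 < ⌈(x : ℝ) * n⌉₊ := Nat.ceil_pos.2 (by positivity)
  have h1 : cell n x = i ↔ ⌈(x : ℝ) * n⌉₊ = (i : ℕ) + 1 := by
    rw [Fin.ext_iff]
    show ⌈(x : ℝ) * n⌉₊ - 1 = (i : ℕ) ↔ _
    omega
  rw [h1, Nat.ceil_eq_iff (by omega), div_lt_iff₀ hn, le_div_iff₀ hn]
  simp

lemma measurable_cell : Measurable (cell n) := by
  refine measurable_to_countable' fun i => ?_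
  have hm : Measurable fun x : I => ⌈(x : ℝ) * n⌉₊ - 1 :=
    (measurable_of_countable fun m : ℕ => m - 1).comp
      (Nat.measurable_ceil.comp (measurable_subtype_coe.mul_const _))
  have : cell n ⁻¹' {i} = (fun x : I => ⌈(x : ℝ) * n⌉₊ - 1) ⁻¹' {(i : ℕ)} := by
    ext x
    simp [cell, Fin.ext_iff]
  rw [this]
  exact hm (measurableSet_singleton _)

lemma abs_sub_le_of_cell (x : I) : |(x : ℝ) - ((cell n x : ℕ) + 1) / n| ≤ 1 / n := by
  have hn : (0 : ℝ) < n := by exact_mod_cast NeZero.pos n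
  by_cases hx : x = 0
  · subst hx
    have : (cell n 0 : ℕ) = 0 := by simp [cell]
    rw [this]
    simp [abs_of_pos hn]
  · obtain ⟨h1, h2⟩ := (cell_eq_iff hx (cell n x)).1 rfl
    rw [add_div] at h2 ⊢
    have : (0 : ℝ) ≤ 1 / n := by positivity
    rw [abs_le]; constructor <;> linarith

lemma image_coe_cell (i : Fin n) :
    ((↑) : I → ℝ) '' (cell n ⁻¹' {i} \ {0}) = Set.Ioc ((i : ℝ) / n) ((i + 1) / n) := by
  have hn : (0 : ℝ) < n := by exact_mod_cast NeZero.pos n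
  ext y
  constructor
  · rintro ⟨x, ⟨hx, hx0⟩, rfl⟩
    exact (cell_eq_iff hx0 i).1 hx
  · intro hy
    have h0 : 0 < y := lt_of_le_of_lt (by positivity) hy.1
    have h1 : y ≤ 1 := hy.2.trans (by
      rw [div_le_one hn]; exact_mod_cast i.2)
    have hne : (⟨y, h0.le, h1⟩ : I) ≠ 0 := fun h => h0.ne' (congrArg Subtype.val h)
    exact ⟨⟨y, h0.le, h1⟩, ⟨(cell_eq_iff hne i).2 hy, hne⟩, rfl⟩

lemma volume_cell (i : Fin n) : volume (cell n ⁻¹' {i}) = (n : ℝ≥0∞)⁻¹ := by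
  have hn : (0 : ℝ) < n := by exact_mod_cast NeZero.pos n
  rw [← measure_sdiff_null (s := cell n ⁻¹' {i}) (measure_singleton (0 : I)),
    unitInterval.volume_apply, image_coe_cell, Real.volume_Ioc, ← sub_div, add_sub_cancel_left,
    one_div, ENNReal.ofReal_inv_of_pos hn, ENNReal.ofReal_natCast]

/-- The map that fixes `0` and permutes the intervals `(i/n, (i+1)/n]` of `[0, 1]` by translations.
The projection to `[0, 1]` only serves to provide the proof of membership. -/
def permCells (τ : Equiv.Perm (Fin n)) (x : I) : I :=
  Set.projIcc (0 : ℝ) 1 zero_le_one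
    (if x = 0 then 0 else (x : ℝ) + ((τ (cell n x) : ℕ) - (cell n x : ℕ)) / n)

lemma permCells_zero (τ : Equiv.Perm (Fin n)) : permCells τ 0 = 0 := by
  rw [permCells, if_pos rfl, Set.projIcc_left]
  rfl

lemma permCells_spec (τ : Equiv.Perm (Fin n)) {x : I} (hx : x ≠ 0) :
    permCells τ x ≠ 0 ∧ cell n (permCells τ x) = τ (cell n x) ∧
      (permCells τ x : ℝ) = (x : ℝ) + ((τ (cell n x) : ℕ) - (cell n x : ℕ)) / n := by
  have hn : (0 : ℝ) < n := by exact_mod_cast NeZero.pos n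
  obtain ⟨h1, h2⟩ := (cell_eq_iff hx (cell n x)).1 rfl
  set y : ℝ := (x : ℝ) + ((τ (cell n x) : ℕ) - (cell n x : ℕ)) / n with hy
  have hy1 : ((τ (cell n x) : ℕ) : ℝ) / n < y := by rw [hy, sub_div]; linarith
  have hy2 : y ≤ ((τ (cell n x) : ℕ) + 1) / n := by
    rw [add_div] at h2 ⊢
    rw [hy, sub_div]; linarith
  have h0 : 0 < y := lt_of_le_of_lt (by positivity) hy1
  have h1' : y ≤ 1 := hy2.trans (by
    rw [div_le_one hn]; exact_mod_cast (τ (cell n x)).2)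
  have hval : (permCells τ x : ℝ) = y := by
    rw [permCells, if_neg hx, ← hy, Set.projIcc_of_mem zero_le_one ⟨h0.le, h1'⟩]
  have hne : permCells τ x ≠ 0 := fun h => by
    rw [h] at hval; exact h0.ne hval
  exact ⟨hne, (cell_eq_iff hne _).2 (by rw [hval]; exact ⟨hy1, hy2⟩), hval⟩

lemma permCells_symm_apply (τ : Equiv.Perm (Fin n)) (x : I) :
    permCells τ.symm (permCells τ x) = x := by
  by_cases hx : x = 0
  · rw [hx, permCells_zero, permCells_zero]
  · obtain ⟨h1, h2, h3⟩ := permCells_spec τ hx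
    obtain ⟨-, -, h4⟩ := permCells_spec τ.symm h1
    refine Subtype.ext ?_
    rw [h4, h3, h2, Equiv.symm_apply_apply]
    ring

lemma bijective_permCells (τ : Equiv.Perm (Fin n)) : Function.Bijective (permCells τ) :=
  Function.bijective_iff_has_inverse.2 ⟨permCells τ.symm, permCells_symm_apply τ, fun x => by
    simpa using permCells_symm_apply τ.symm x⟩

lemma measurable_permCells (τ : Equiv.Perm (Fin n)) : Measurable (permCells τ) := by
  refine continuous_projIcc.measurable.comp
    (Measurable.ite (measurableSet_singleton 0) measurable_const ?_)
  exact measurable_subtype_coe.add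
    ((measurable_of_finite fun i : Fin n => (((τ i : ℕ) : ℝ) - (i : ℕ)) / n).comp measurable_cell)

lemma measurePreserving_permCells (τ : Equiv.Perm (Fin n)) :
    MeasurePreserving (permCells τ) volume volume := by
  refine ⟨measurable_permCells τ, ?_⟩
  ext B hB
  rw [Measure.map_apply (measurable_permCells τ) hB]
  have hsplit : ∀ A : Set I, MeasurableSet A →
      volume A = ∑ i : Fin n, volume (A ∩ (cell n ⁻¹' {i} \ {0})) := by
    intro A hA
    rw [← measure_sdiff_null (s := A) (measure_singleton (0 : I))]
    have hun : A \ {0} = ⋃ i : Fin n, A ∩ (cell n ⁻¹' {i} \ {0}) := by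
      ext x; simp
    rw [hun, measure_iUnion, tsum_fintype]
    · intro i j hij
      refine Set.disjoint_left.2 fun x h1 h2 => hij ?_
      exact (show cell n x = i from h1.2.1).symm.trans h2.2.1
    · exact fun i => hA.inter ((measurable_cell (measurableSet_singleton i)).diff
        (measurableSet_singleton 0))
  rw [hsplit _ (measurable_permCells τ hB), hsplit _ hB,
    ← Equiv.sum_comp τ fun i => volume (B ∩ (cell n ⁻¹' {i} \ {0}))]
  refine Finset.sum_congr rfl fun i _ => ?_
  rw [unitInterval.volume_apply, unitInterval.volume_apply]
  have himg : ((↑) : I → ℝ) '' (B ∩ (cell n ⁻¹' {τ i} \ {0})) =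
      (fun y => y + (((τ i : ℕ) : ℝ) - (i : ℕ)) / n) ''
        (((↑) : I → ℝ) '' (permCells τ ⁻¹' B ∩ (cell n ⁻¹' {i} \ {0}))) := by
    rw [← Set.image_comp]
    ext y
    constructor
    · rintro ⟨x, ⟨hxB, hx, hx0⟩, rfl⟩
      have hx : cell n x = τ i := hx
      obtain ⟨h1, h2, h3⟩ := permCells_spec τ.symm hx0
      rw [hx, Equiv.symm_apply_apply] at h2 h3
      have hb : permCells τ (permCells τ.symm x) = x := by
        simpa using permCells_symm_apply τ.symm x
      refine ⟨permCells τ.symm x, ⟨by rw [Set.mem_preimage, hb]; exact hxB, h2, h1⟩, ?_⟩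
      show (permCells τ.symm x : ℝ) + _ = _
      rw [h3]; ring
    · rintro ⟨x, ⟨hxB, hx, hx0⟩, rfl⟩
      have hx : cell n x = i := hx
      obtain ⟨h1, h2, h3⟩ := permCells_spec τ hx0
      rw [hx] at h2 h3
      exact ⟨permCells τ x, ⟨hxB, h2, h1⟩, h3⟩
  rw [himg, Set.image_add_right, measure_preimage_add_right]

end Cell

/-- A measurable colouring of `[0, 1]` is almost constant on the intervals of length `1 / n`. -/
lemma exists_step_coloring {m : ℕ} {c : I → Fin m} (hc : Measurable c) {ε : ℝ} (hε : 0 < ε) :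
    ∃ N : ℕ, ∀ (n : ℕ) [NeZero n], N ≤ n → ∃ d : Fin n → Fin m,
      volume {x | c x ≠ d (cell n x)} ≤ ENNReal.ofReal ε := by
  have : NeZero m := ⟨by rintro rfl; exact (c 0).elim0⟩
  have hm : (0 : ℝ) < m := by exact_mod_cast NeZero.pos m
  have hcm : Measurable fun x => ((c x : ℕ) : ℝ) :=
    (measurable_of_finite fun a : Fin m => ((a : ℕ) : ℝ)).comp hc
  have hint : Integrable (fun x => ((c x : ℕ) : ℝ)) (volume : Measure I) := by
    refine Integrable.of_bound hcm.aestronglyMeasurable m (ae_of_all _ fun x => ?_)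
    rw [Real.norm_eq_abs, abs_of_nonneg (Nat.cast_nonneg _)]
    exact_mod_cast (c x).2.le
  obtain ⟨h, hh, -⟩ := hint.exists_boundedContinuous_lintegral_sub_le
    (ε := ENNReal.ofReal (ε / 4)) (ENNReal.ofReal_pos.2 (by positivity)).ne'
  have huc := CompactSpace.uniformContinuous_of_continuous h.continuous
  obtain ⟨δ, hδ, hδh⟩ := Metric.uniformContinuous_iff.1 huc (1 / 4) (by norm_num)
  obtain ⟨N, hN⟩ := exists_nat_gt (1 / δ)
  refine ⟨N, fun n _ hn => ?_⟩
  have hn0 : (0 : ℝ) < n := by exact_mod_cast NeZero.pos n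
  have hnδ : 1 / (n : ℝ) < δ := by
    rw [div_lt_iff₀ hδ] at hN
    rw [div_lt_iff₀ hn0]
    have : (N : ℝ) ≤ n := by exact_mod_cast hn
    nlinarith
  have hmem : ∀ i : Fin n, ((i : ℕ) + 1 : ℝ) / n ∈ Set.Icc (0 : ℝ) 1 := fun i =>
    ⟨by positivity, by rw [div_le_one hn0]; exact_mod_cast i.2⟩
  refine ⟨fun i => decode m (h ⟨((i : ℕ) + 1 : ℝ) / n, hmem i⟩ / m), ?_⟩
  -- where the continuous approximation is within `1/4` of `c`, rounding recovers `c`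
  have hsub : {x | c x ≠ decode m (h ⟨((cell n x : ℕ) + 1 : ℝ) / n, hmem (cell n x)⟩ / m)} ⊆
      {x | ENNReal.ofReal (1 / 4) ≤ ‖((c x : ℕ) : ℝ) - h x‖ₑ} := by
    intro x hx
    by_contra hlt
    have hlt : ‖((c x : ℕ) : ℝ) - h x‖ₑ < ENNReal.ofReal (1 / 4) := not_le.1 hlt
    rw [← ofReal_norm, ENNReal.ofReal_lt_ofReal_iff (by norm_num), Real.norm_eq_abs] at hlt
    have hd : dist (h x) (h ⟨((cell n x : ℕ) + 1 : ℝ) / n, hmem (cell n x)⟩) < 1 / 4 :=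
      hδh ((abs_sub_le_of_cell x).trans_lt hnδ)
    rw [Real.dist_eq] at hd
    refine hx (decode_eq ?_).symm
    rw [← sub_div, abs_div, abs_of_pos hm, div_lt_iff₀ hm]
    have e : 1 / (2 * (m : ℝ)) * m = 1 / 2 := by field_simp
    rw [e]
    have h1 := abs_lt.1 hlt
    have h2 := abs_lt.1 hd
    rw [abs_lt]; constructor <;> linarith [h1.1, h1.2, h2.1, h2.2]
  refine (measure_mono hsub).trans ?_
  have hmeas : AEMeasurable (fun x => ‖((c x : ℕ) : ℝ) - h x‖ₑ) (volume : Measure I) :=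
    (hcm.sub h.continuous.measurable).enorm.aemeasurable
  refine (meas_ge_le_lintegral_div hmeas (by simp) (by simp)).trans ?_
  rw [ENNReal.div_le_iff (by simp) (by simp), ← ENNReal.ofReal_mul hε.le]
  refine hh.trans (le_of_eq ?_)
  congr 1
  ring

/-- Two colourings of `[0, 1]` whose colour classes have almost the same sizes are almost equal
after a measure-preserving bijection. -/
theorem exists_measurePreserving_matching {m : ℕ} {c c' : I → Fin m} (hc : Measurable c)
    (hc' : Measurable c') {θ : ℝ}
    (h : ∀ a, volume.real (c ⁻¹' {a}) ≤ volume.real (c' ⁻¹' {a}) + θ) (hθ : 0 ≤ θ)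
    {ε : ℝ} (hε : 0 < ε) :
    ∃ φ : I → I, MeasurePreserving φ volume volume ∧ Function.Bijective φ ∧
      volume.real {x | c x ≠ c' (φ x)} ≤ m * θ + ε := by
  classical
  let ε' : ℝ := ε / (2 * m + 2)
  have hε' : 0 < ε' := by positivity
  obtain ⟨N, hN⟩ := exists_step_coloring hc hε'
  obtain ⟨N', hN'⟩ := exists_step_coloring hc' hε'
  let n : ℕ := N + N' + 1
  have : NeZero n := ⟨by omega⟩
  have hn0 : (0 : ℝ) < n := by exact_mod_cast NeZero.pos n
  obtain ⟨d, hd⟩ := hN n (by omega)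
  obtain ⟨d', hd'⟩ := hN' n (by omega)
  have hreal : ∀ {A : Set I}, volume A ≤ ENNReal.ofReal ε' → volume.real A ≤ ε' := fun hA =>
    ENNReal.toReal_le_of_le_ofReal hε'.le hA
  have hd := hreal hd
  have hd' := hreal hd'
  -- preimages of sets of cells
  have hcell : ∀ A : Finset (Fin n), volume.real (cell n ⁻¹' (A : Set (Fin n))) = A.card / n := by
    intro A
    have hun : cell n ⁻¹' (A : Set (Fin n)) = ⋃ i ∈ A, cell n ⁻¹' {i} := by
      ext x; simp
    rw [measureReal_def, hun, measure_biUnion_finset]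
    · simp_rw [volume_cell]
      rw [Finset.sum_const, nsmul_eq_mul, ENNReal.toReal_mul, ENNReal.toReal_inv,
        ENNReal.toReal_natCast, ENNReal.toReal_natCast, div_eq_mul_inv]
    · intro i _ j _ hij
      refine Set.disjoint_left.2 fun x h1 h2 => hij ?_
      exact (show cell n x = i from h1).symm.trans h2
    · exact fun i _ => measurable_cell (measurableSet_singleton i)
  have hclose : ∀ {c : I → Fin m} {d : Fin n → Fin m},
      volume.real {x | c x ≠ d (cell n x)} ≤ ε' → ∀ a,
      |volume.real (c ⁻¹' {a}) - ((Finset.univ.filter fun i => d i = a).card : ℝ) / n| ≤ ε' := by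
    intro c d hcd a
    rw [← hcell]
    have h1 : volume.real (c ⁻¹' {a}) ≤
        volume.real (cell n ⁻¹' ((Finset.univ.filter fun i => d i = a : Finset (Fin n)) :
          Set (Fin n))) + volume.real {x | c x ≠ d (cell n x)} := by
      refine (measureReal_mono ?_).trans (measureReal_union_le _ _)
      intro x hx
      have hx : c x = a := hx
      by_cases hxd : c x = d (cell n x)
      · left; simp [← hxd, hx]
      · right; exact hxd
    have h2 : volume.real (cell n ⁻¹' ((Finset.univ.filter fun i => d i = a : Finset (Fin n)) :
          Set (Fin n))) ≤ volume.real (c ⁻¹' {a}) + volume.real {x | c x ≠ d (cell n x)} := by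
      refine (measureReal_mono ?_).trans (measureReal_union_le _ _)
      intro x hx
      have hx : d (cell n x) = a := by simpa using hx
      by_cases hxd : c x = d (cell n x)
      · left; exact hxd.trans hx
      · right; exact hxd
    rw [abs_le]; constructor <;> linarith
  obtain ⟨τ, hτ⟩ := exists_perm_matching d d'
  have hmp := measurePreserving_permCells τ
  refine ⟨permCells τ, hmp, bijective_permCells τ, ?_⟩
  let F : Finset (Fin n) := Finset.univ.filter fun i => d i ≠ d' (τ i)
  have hsub : {x | c x ≠ c' (permCells τ x)} ⊆ {x | c x ≠ d (cell n x)} ∪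
      (cell n ⁻¹' (F : Set (Fin n)) ∪
      (permCells τ ⁻¹' {x | c' x ≠ d' (cell n x)} ∪ {0})) := by
    intro x hx
    by_contra hcon
    simp only [Set.mem_union, not_or] at hcon
    obtain ⟨h1, h2, h3, h4⟩ := hcon
    have h1 : c x = d (cell n x) := not_not.1 h1
    have h2 : d (cell n x) = d' (τ (cell n x)) := by simpa [F] using h2
    have h3 : c' (permCells τ x) = d' (cell n (permCells τ x)) := not_not.1 h3
    refine hx ?_
    rw [h1, h2, h3, (permCells_spec τ h4).2.1]
  have hpre : volume.real (permCells τ ⁻¹' {x | c' x ≠ d' (cell n x)}) ≤ ε' := by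
    have hms : MeasurableSet {x | c' x ≠ d' (cell n x)} :=
      (measurableSet_eq_fun hc' ((measurable_of_finite d').comp measurable_cell)).compl
    rw [measureReal_def, hmp.measure_preimage hms.nullMeasurableSet]
    exact hd'
  have hF : volume.real (cell n ⁻¹' (F : Set (Fin n))) ≤ m * (θ + 2 * ε') := by
    rw [hcell]
    have h1 : (F.card : ℝ) ≤ ∑ a : Fin m, (n : ℝ) * (θ + 2 * ε') := by
      refine (Nat.cast_le.2 hτ).trans ?_
      rw [Nat.cast_sum]
      refine Finset.sum_le_sum fun a _ => ?_
      have h2 := abs_le.1 (hclose hd a)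
      have h3 := abs_le.1 (hclose hd' a)
      have h4 := h a
      set p := (Finset.univ.filter fun i => d i = a).card
      set q := (Finset.univ.filter fun i => d' i = a).card
      have h5 : (p : ℝ) / n - q / n ≤ θ + 2 * ε' := by linarith [h2.1, h3.2]
      rw [← sub_div, div_le_iff₀ hn0] at h5
      rcases le_total q p with hqp | hqp
      · rw [Nat.cast_sub hqp]; linarith
      · rw [Nat.sub_eq_zero_of_le hqp, Nat.cast_zero]; positivity
    rw [Finset.sum_const, Finset.card_univ, Fintype.card_fin, nsmul_eq_mul] at h1
    rw [div_le_iff₀ hn0]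
    linarith
  have h0 : volume.real ({0} : Set I) = 0 := by simp [measureReal_def]
  calc volume.real {x | c x ≠ c' (permCells τ x)} ≤ ε' + (m * (θ + 2 * ε') + (ε' + 0)) := by
        refine (measureReal_mono hsub).trans ((measureReal_union_le _ _).trans (add_le_add hd
          ((measureReal_union_le _ _).trans (add_le_add hF ((measureReal_union_le _ _).trans
            (add_le_add hpre h0.le))))))
    _ = m * θ + (2 * m + 2) * ε' := by ring
    _ = m * θ + ε := by
        simp only [ε']
        rw [mul_div_cancel₀ _ (by positivity)]

/-! ### Imitation of colourings implies closeness in the unlabelled cut distance -/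

section KernelIntegral

variable {X : Type*} [MeasurableSpace X] {κ : Kernel X ℝ} {g : ℝ → ℝ}

lemma measurable_integral_kernel [IsSFiniteKernel κ] (hg : Measurable g) :
    Measurable fun p => ∫ x, g x ∂(κ p) :=
  ((hg.stronglyMeasurable.comp_measurable measurable_snd).integral_kernel_prod_right'
    (f := fun q : X × ℝ => g q.2)).measurable

lemma integral_kernel_le_one [IsMarkovKernel κ] (hg : Measurable g)
    (hg0 : ∀ x, 0 ≤ g x) (hg1 : ∀ x, g x ≤ 1) (p : X) : ∫ x, g x ∂(κ p) ≤ 1 := by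
  calc ∫ x, g x ∂(κ p) ≤ ∫ _, (1 : ℝ) ∂(κ p) := by
        refine integral_mono (Integrable.of_bound hg.aestronglyMeasurable 1
          (ae_of_all _ fun x => ?_)) (integrable_const 1) hg1
        rw [Real.norm_eq_abs, abs_of_nonneg (hg0 x)]; exact hg1 x
    _ = 1 := by simp

end KernelIntegral

/-- Imitating colourings are block close for the averages of Lipschitz functions. -/
lemma blockClose_of_LPClose {X Y : Type*} [MeasurableSpace X] [MeasurableSpace Y]
    {μ : Measure X} [IsProbabilityMeasure μ] {ν : Measure Y} [IsProbabilityMeasure ν]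
    {κ : Kernel (X × X) ℝ} {κ' : Kernel (Y × Y) ℝ} [IsMarkovKernel κ] [IsMarkovKernel κ']
    {Λ C : Type*} {g : Λ → ℝ → ℝ} {K τ : ℝ} (hK : 0 ≤ K) (hτ : 0 < τ)
    (hg : ∀ l, Measurable (g l)) (hg0 : ∀ l x, 0 ≤ g l x) (hg1 : ∀ l x, g l x ≤ 1)
    (hgK : ∀ l x y, |g l x - g l y| ≤ K * dist x y) {c : X → C} {c' : Y → C}
    (h : ∀ a b, LPClose τ (blockLaw μ κ (c ⁻¹' {a}) (c ⁻¹' {b}))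
      (blockLaw ν κ' (c' ⁻¹' {a}) (c' ⁻¹' {b}))) :
    BlockClose ((K + 1) * τ) μ (fun l p => ∫ x, g l x ∂(κ p)) ν (fun l p => ∫ x, g l x ∂(κ' p))
      c c' := by
  intro a b
  refine ⟨fun l => ?_, ?_⟩
  · rw [← integral_blockLaw (hg l) (hg0 l) (hg1 l), ← integral_blockLaw (hg l) (hg0 l) (hg1 l)]
    exact (h a b).abs_integral_sub_le blockLaw_univ_le_one blockLaw_univ_le_one hτ hK (hg l)
      (hg0 l) (hg1 l) (hgK l)
  · have h1 := (h a b).abs_integral_sub_le blockLaw_univ_le_one blockLaw_univ_le_one hτ le_rfl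
      (measurable_const (a := (1 : ℝ))) (fun _ => zero_le_one) (fun _ => le_rfl) (by simp)
    simp only [integral_const, smul_eq_mul, mul_one, measureReal_def, blockLaw_univ,
      ENNReal.toReal_mul] at h1
    refine h1.trans ?_
    gcongr

lemma sum_measureReal_coloring {X : Type*} [MeasurableSpace X] {μ : Measure X}
    [IsProbabilityMeasure μ] {m : ℕ} {c : X → Fin m} (hc : Measurable c) :
    ∑ b, μ.real (c ⁻¹' {b}) = 1 := by
  have hun : (⋃ b : Fin m, c ⁻¹' {b}) = Set.univ := by ext; simp
  rw [← measureReal_iUnion_fintype _ fun b => hc (measurableSet_singleton b), hun]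
  · simp
  · intro b b' hbb
    refine Set.disjoint_left.2 fun x h1 h2 => hbb ?_
    exact (show c x = b from h1).symm.trans h2

lemma measureReal_le_of_blockClose {X Y : Type*} [MeasurableSpace X] [MeasurableSpace Y]
    {μ : Measure X} [IsProbabilityMeasure μ] {ν : Measure Y} [IsProbabilityMeasure ν]
    {Λ : Type*} {m : ℕ} {θ : ℝ} {w : Λ → X × X → ℝ} {w' : Λ → Y × Y → ℝ} {c : X → Fin m}
    {c' : Y → Fin m} (hc : Measurable c) (hc' : Measurable c') (h : BlockClose θ μ w ν w' c c')
    (a : Fin m) : μ.real (c ⁻¹' {a}) ≤ ν.real (c' ⁻¹' {a}) + m * θ := by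
  have hconst : (m : ℝ) * θ = ∑ _b : Fin m, θ := by simp
  rw [← mul_one (μ.real (c ⁻¹' {a})), ← sum_measureReal_coloring (μ := μ) hc,
    ← mul_one (ν.real (c' ⁻¹' {a})), ← sum_measureReal_coloring (μ := ν) hc', hconst,
    Finset.mul_sum, Finset.mul_sum, ← Finset.sum_add_distrib]
  exact Finset.sum_le_sum fun b _ => by linarith [(abs_le.1 (h a b).2).2]

/-- Step functions for two colourings that are almost equal have almost equal integrals. -/
lemma abs_setIntegral_step_sub_le {X : Type*} [MeasurableSpace X] {μ : Measure X}
    [IsProbabilityMeasure μ] {m : ℕ} {c d : X → Fin m} (hc : Measurable c) (hd : Measurable d)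
    {M : Fin m → Fin m → ℝ} {K : ℝ} (hM : ∀ a b, |M a b| ≤ K) (A : Set (X × X)) :
    |∫ p in A, M (c p.1) (c p.2) ∂(μ.prod μ) - ∫ p in A, M (d p.1) (d p.2) ∂(μ.prod μ)| ≤
      4 * K * μ.real {x | c x ≠ d x} := by
  let D : Set X := {x | c x ≠ d x}
  have hD : MeasurableSet D := (measurableSet_eq_fun hc hd).compl
  have hi1 := integrable_step (μ := μ) hc M
  have hi2 := integrable_step (μ := μ) hd M
  have hiD : Integrable (D.indicator (fun _ => 2 * K)) μ := (integrable_const _).indicator hD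
  have hK : ∀ p : X × X, 0 ≤ K := fun p => (abs_nonneg _).trans (hM (c p.1) (c p.1))
  rw [← integral_sub hi1.integrableOn hi2.integrableOn, ← Real.norm_eq_abs]
  refine (norm_integral_le_integral_norm _).trans ?_
  calc ∫ p in A, ‖M (c p.1) (c p.2) - M (d p.1) (d p.2)‖ ∂(μ.prod μ)
      ≤ ∫ p, ‖M (c p.1) (c p.2) - M (d p.1) (d p.2)‖ ∂(μ.prod μ) :=
        setIntegral_le_integral (hi1.sub hi2).norm (ae_of_all _ fun p => norm_nonneg _)
    _ ≤ ∫ p, (D.indicator (fun _ => 2 * K) p.1 + D.indicator (fun _ => 2 * K) p.2)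
          ∂(μ.prod μ) := by
        refine integral_mono (hi1.sub hi2).norm ((hiD.comp_fst μ).add (hiD.comp_snd μ)) ?_
        intro p
        have h1 : ∀ x, 0 ≤ D.indicator (fun _ => 2 * K) x := fun x =>
          Set.indicator_nonneg (fun _ _ => by linarith [hK (x, x)]) x
        have h2 : ‖M (c p.1) (c p.2) - M (d p.1) (d p.2)‖ ≤ 2 * K := by
          rw [Real.norm_eq_abs]
          refine (abs_sub _ _).trans ?_
          linarith [hM (c p.1) (c p.2), hM (d p.1) (d p.2)]
        show ‖M (c p.1) (c p.2) - M (d p.1) (d p.2)‖ ≤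
          D.indicator (fun _ => 2 * K) p.1 + D.indicator (fun _ => 2 * K) p.2
        by_cases hp1 : p.1 ∈ D
        · rw [Set.indicator_of_mem hp1]; linarith [h1 p.2]
        by_cases hp2 : p.2 ∈ D
        · rw [Set.indicator_of_mem hp2]; linarith [h1 p.1]
        have e1 : c p.1 = d p.1 := not_not.1 hp1
        have e2 : c p.2 = d p.2 := not_not.1 hp2
        rw [e1, e2, sub_self, norm_zero]
        exact add_nonneg (h1 _) (h1 _)
    _ = 4 * K * μ.real D := by
        rw [integral_add (hiD.comp_fst μ) (hiD.comp_snd μ), integral_fun_fst, integral_fun_snd,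
          integral_indicator hD, setIntegral_const]
        simp only [probReal_univ, smul_eq_mul]
        ring

/-- The total laws of a family of kernels are tight along a filter. -/
def TightAlong {ι : Type*} (l : Filter ι) {X : ι → Type*} [∀ i, MeasurableSpace (X i)]
    (μ : ∀ i, Measure (X i)) (κ : ∀ i, Kernel (X i × X i) ℝ) : Prop :=
  ∀ ε > 0, ∃ R : ℝ, ∀ᶠ i in l,
    blockLaw (μ i) (κ i) Set.univ Set.univ {x | R < |x|} ≤ ENNReal.ofReal ε

namespace ProbGraphon

/-- Graphons that imitate each other's colourings are close in the unlabelled cut distance, with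
a modulus that only depends on the tightness of the first one. -/
theorem exists_unlabelledCutDist_le {ε : ℝ} (hε : 0 < ε) (R : ℝ) :
    ∃ (T : ℕ) (τ : ℝ), 0 < τ ∧ ∀ (U V : Kernel (I × I) ℝ) [IsMarkovKernel U] [IsMarkovKernel V],
      blockLaw volume U Set.univ Set.univ {x | R < |x|} ≤ ENNReal.ofReal (ε / 2) →
      (∀ m ≤ T, Approximates m τ volume U volume V) →
      (∀ m ≤ T, Approximates m τ volume V volume U) →
      unlabelledCutDist U V ≤ ENNReal.ofReal ε := by
  obtain ⟨N, g, K, η₀, hK, hη₀, hg, hg0, hg1, hgK, hLP⟩ := exists_test_functions hε R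
  -- the error `η₀` is shared by the regular approximations of the two kernels and the mismatch of
  -- their colourings
  let η : ℝ := min (η₀ / 3) 1
  have hη : 0 < η := lt_min (by positivity) one_pos
  obtain ⟨T, θ₀, hθ₀, hreg⟩ := exists_cutRegular_pair (Option (Fin N)) hη (min_le_right _ _)
  let B : ℝ := 4 * T * ((4 : ℝ) ^ T * (4 : ℝ) ^ T * (4 : ℝ) ^ T + 1) + 1
  have hB : 0 < B := by positivity
  let θ : ℝ := min θ₀ (η₀ / 3 / B)
  have hθ : 0 < θ := lt_min hθ₀ (by positivity)
  refine ⟨4 ^ T, θ / (K + 1), by positivity, ?_⟩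
  intro U V _ _ htail hUV hVU
  set τ : ℝ := θ / (K + 1)
  have hτ : 0 < τ := by positivity
  have hτθ : (K + 1) * τ ≤ θ := by
    rw [mul_div_cancel₀]
    positivity
  have hpow : ∀ t ≤ T, (4 : ℕ) ^ t ≤ 4 ^ T := fun t ht => Nat.pow_le_pow_right (by norm_num) ht
  let u : Option (Fin N) → I × I → ℝ := fun l p => ∫ x, g l x ∂(U p)
  let v : Option (Fin N) → I × I → ℝ := fun l p => ∫ x, g l x ∂(V p)
  have hu : ∀ l, Measurable (u l) := fun l => measurable_integral_kernel (hg l)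
  have hv : ∀ l, Measurable (v l) := fun l => measurable_integral_kernel (hg l)
  have hu0 : ∀ l p, 0 ≤ u l p := fun l p => integral_nonneg (hg0 l)
  have hv0 : ∀ l p, 0 ≤ v l p := fun l p => integral_nonneg (hg0 l)
  have hu1 : ∀ l p, u l p ≤ 1 := fun l p => integral_kernel_le_one (hg l) (hg0 l) (hg1 l) p
  have hv1 : ∀ l p, v l p ≤ 1 := fun l p => integral_kernel_le_one (hg l) (hg0 l) (hg1 l) p
  obtain ⟨t, htT, c, c', M, hc, hc', hM, hcc', hregU, hregV⟩ := hreg volume volume u v hu hu0 hu1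
    hv hv0 hv1 ((K + 1) * τ) (hτθ.trans (min_le_left _ _))
    (fun t ht c hc => by
      obtain ⟨c', hc', h⟩ := hUV _ (hpow t ht) c hc
      exact ⟨c', hc', blockClose_of_LPClose hK hτ hg hg0 hg1 hgK h⟩)
    (fun t ht c hc => by
      obtain ⟨c', hc', h⟩ := hVU _ (hpow t ht) c hc
      exact ⟨c', hc', blockClose_of_LPClose hK hτ hg hg0 hg1 hgK h⟩)
  obtain ⟨φ, hφ, hφb, hφc⟩ := exists_measurePreserving_matching hc hc'
    (measureReal_le_of_blockClose hc hc' hcc') (by positivity) hθ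
  have hbad : 4 * T * volume.real {x | c x ≠ c' (φ x)} ≤ η₀ / 3 := by
    have h1 : ((4 ^ t : ℕ) : ℝ) ≤ (4 : ℝ) ^ T := by exact_mod_cast hpow t htT
    have h1' : (1 : ℝ) ≤ (4 : ℝ) ^ T := one_le_pow₀ (by norm_num)
    have h2 : volume.real {x | c x ≠ c' (φ x)} ≤
        ((4 : ℝ) ^ T * (4 : ℝ) ^ T * (4 : ℝ) ^ T + 1) * θ := by
      refine hφc.trans ?_
      calc ((4 ^ t : ℕ) : ℝ) * (((4 ^ t : ℕ) : ℝ) * ((K + 1) * τ)) + θ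
          ≤ (4 : ℝ) ^ T * ((4 : ℝ) ^ T * ((4 : ℝ) ^ T * θ)) + θ := by
            have h3 : (K + 1) * τ ≤ (4 : ℝ) ^ T * θ := hτθ.trans (le_mul_of_one_le_left hθ.le h1')
            have h4 : 0 ≤ (K + 1) * τ := by positivity
            exact add_le_add (mul_le_mul h1 (mul_le_mul h1 h3 h4 (by positivity)) (by positivity)
              (by positivity)) le_rfl
        _ = _ := by ring
    calc 4 * T * volume.real {x | c x ≠ c' (φ x)}
        ≤ 4 * T * (((4 : ℝ) ^ T * (4 : ℝ) ^ T * (4 : ℝ) ^ T + 1) * θ) := by gcongr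
      _ ≤ B * θ := by
          rw [← mul_assoc]
          exact mul_le_mul_of_nonneg_right (by simp only [B]; linarith) hθ.le
      _ ≤ B * (η₀ / 3 / B) := by gcongr; exact min_le_right _ _
      _ = η₀ / 3 := by field_simp
  obtain ⟨ψ, hψ, hψb, hl, hr⟩ := exists_inverse hφ hφb
  refine (unlabelledCutDist_le hφ hφb).trans (cutDist_le_of_blockLaw_close hε.le ?_)
  intro S T' hS hT'
  refine hLP _ _ inferInstance inferInstance ?_ fun l => ?_
  · exact (blockLaw_le_univ (measurableSet_lt measurable_const (by fun_prop))).trans htail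
  have hpre : ∀ A : Set I, φ ⁻¹' (ψ ⁻¹' A) = A := fun A => by
    ext x; simp [hl x]
  have hS' := hψ.measurable hS
  have hT'' := hψ.measurable hT'
  have e1 : blockLaw volume (relabel V φ hφ.measurable) S T' =
      blockLaw volume V (ψ ⁻¹' S) (ψ ⁻¹' T') := by
    conv_lhs => rw [← hpre S, ← hpre T']
    exact blockLaw_comap hφ hS' hT''
  rw [e1, integral_blockLaw (hg l) (hg0 l) (hg1 l), integral_blockLaw (hg l) (hg0 l) (hg1 l)]
  have hcφ : Measurable fun x => c' (φ x) := hc'.comp hφ.measurable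
  have e2 : ∫ p in (ψ ⁻¹' S) ×ˢ (ψ ⁻¹' T'), M l (c' p.1) (c' p.2) ∂(volume.prod volume) =
      ∫ p in S ×ˢ T', M l (c' (φ p.1)) (c' (φ p.2)) ∂(volume.prod volume) := by
    have hres := (hφ.prod hφ).restrict_preimage (hS'.prod hT'')
    have hset : Prod.map φ φ ⁻¹' ((ψ ⁻¹' S) ×ˢ (ψ ⁻¹' T')) = S ×ˢ T' := by
      ext p
      simp [hl p.1, hl p.2]
    rw [hset] at hres
    rw [← hres.map_eq, integral_map hres.measurable.aemeasurable
      (measurable_step hc' (M l)).aestronglyMeasurable]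
    rfl
  -- compare `U` and the relabelled `V` through their step approximations, whose coefficients agree
  have h1 := hregU l S T' hS hT'
  have h2 := hregV l _ _ hS' hT''
  have h3 := (abs_setIntegral_step_sub_le hc hcφ (hM l) (S ×ˢ T') (μ := volume)).trans hbad
  rw [integral_sub (integrable_of_mem_unit hu hu0 hu1 l).integrableOn
    (integrable_step hc (M l)).integrableOn] at h1
  rw [integral_sub (integrable_of_mem_unit hv hv0 hv1 l).integrableOn
    (integrable_step hc' (M l)).integrableOn, e2] at h2
  have hη3 : η ≤ η₀ / 3 := min_le_left _ _
  have h1 := abs_le.1 h1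
  have h2 := abs_le.1 h2
  have h3 := abs_le.1 h3
  rw [abs_le]
  constructor <;> linarith [h1.1, h1.2, h2.1, h2.2, h3.1, h3.2]

/-- The family version of `exists_unlabelledCutDist_le`. -/
lemma tendsto_unlabelledCutDist_of_imitates {ι : Type*} {l : Filter ι} {U V : ι → Kernel (I × I) ℝ}
    [∀ i, IsMarkovKernel (U i)] [∀ i, IsMarkovKernel (V i)]
    (htight : TightAlong l (fun _ => volume) U)
    (h : Imitates l (fun _ => volume) U (fun _ => volume) V)
    (h' : Imitates l (fun _ => volume) V (fun _ => volume) U) :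
    Tendsto (fun i => unlabelledCutDist (U i) (V i)) l (𝓝 0) := by
  refine ENNReal.tendsto_nhds_zero.2 fun r hr => ?_
  obtain ⟨ε, hε, hεr⟩ := exists_ofReal_le hr
  obtain ⟨R, hR⟩ := htight (ε / 2) (by positivity)
  obtain ⟨T, τ, hτ, hT⟩ := exists_unlabelledCutDist_le hε R
  have h1 : ∀ᶠ i in l, ∀ m ∈ Finset.range (T + 1), Approximates m τ volume (U i) volume (V i) :=
    (Filter.eventually_all_finset _).2 fun m _ => h m τ hτ
  have h2 : ∀ᶠ i in l, ∀ m ∈ Finset.range (T + 1), Approximates m τ volume (V i) volume (U i) :=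
    (Filter.eventually_all_finset _).2 fun m _ => h' m τ hτ
  filter_upwards [hR, h1, h2] with i hi h1 h2
  exact (hT (U i) (V i) hi (fun m hm => h1 m (Finset.mem_range.2 (by omega)))
    fun m hm => h2 m (Finset.mem_range.2 (by omega))).trans hεr

end ProbGraphon

/-! ### Rounding fractional colourings of large vertex sets -/

/-- A greedy selection: from finitely supported random vectors with mean zero one can choose values
whose sum is as short as if they were orthogonal, by keeping the next vector at an obtuse angle to
the partial sum. -/
lemma exists_selection_norm_sum_sq_le {E ι A : Type*} [NormedAddCommGroup E]
    [InnerProductSpace ℝ E] [Fintype A] [Nonempty A] (s : Finset ι) (α : ι → A → ℝ) (v : ι → A → E)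
    (hα0 : ∀ i a, 0 ≤ α i a) (hα1 : ∀ i, ∑ a, α i a = 1) (hv : ∀ i, ∑ a, α i a • v i a = 0)
    {r : ℝ} (hr : ∀ i a, ‖v i a‖ ^ 2 ≤ r) :
    ∃ f : ι → A, ‖∑ i ∈ s, v i (f i)‖ ^ 2 ≤ s.card * r := by
  classical
  induction s using Finset.induction_on with
  | empty => exact ⟨fun _ => Classical.arbitrary A, by simp⟩
  | insert i s hi ih =>
    obtain ⟨f, hf⟩ := ih
    obtain ⟨a, ha⟩ : ∃ a, inner ℝ (∑ j ∈ s, v j (f j)) (v i a) ≤ 0 := by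
      by_contra! hpos
      have h1 : ∑ a, α i a * inner ℝ (∑ j ∈ s, v j (f j)) (v i a) = 0 := by
        simp_rw [← real_inner_smul_right]
        rw [← inner_sum, hv, inner_zero_right]
      have h2 := (Finset.sum_eq_zero_iff_of_nonneg fun a _ =>
        mul_nonneg (hα0 i a) (hpos a).le).1 h1
      have h3 : ∑ a, α i a = 0 := Finset.sum_eq_zero fun a ha =>
        (mul_eq_zero.1 (h2 a ha)).resolve_right (hpos a).ne'
      rw [hα1] at h3
      exact one_ne_zero h3
    refine ⟨Function.update f i a, ?_⟩
    have h4 : ∑ j ∈ s, v j (Function.update f i a j) = ∑ j ∈ s, v j (f j) :=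
      Finset.sum_congr rfl fun j hj => by
        rw [Function.update_of_ne (ne_of_mem_of_not_mem hj hi)]
    rw [Finset.sum_insert hi, h4, Function.update_self, add_comm, norm_add_sq_real,
      Finset.card_insert_of_notMem hi]
    push_cast
    linarith [hr i a]

/-- A fractional colouring of `n` vertices can be rounded to a colouring such that all colour
densities of finitely many weighted graphs change by at most `O(n ^ (-1 / 2))`. -/
lemma exists_rounding {n m : ℕ} [NeZero m] {Λ : Type*} [Fintype Λ] (α : Fin n → Fin m → ℝ)
    (hα0 : ∀ i a, 0 ≤ α i a) (hα1 : ∀ i, ∑ a, α i a = 1) (G : Λ → Fin n → Fin n → ℝ)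
    (hG : ∀ l i j, |G l i j| ≤ 1) :
    ∃ f : Fin n → Fin m, ∀ l a b,
      |∑ i, ∑ j, α i a * α j b * G l i j -
        ∑ i, ∑ j, (if f i = a then 1 else 0) * (if f j = b then 1 else 0) * G l i j| ≤
      2 * √(n * (n * (m * (Fintype.card Λ * (n * 2))))) := by
  -- `ξ i a b` is the error in the weight of `b` at `i` if `i` receives the colour `a`
  let ξ : Fin n → Fin m → Fin m → ℝ := fun i a b => (if a = b then 1 else 0) - α i b
  have hα1' : ∀ i a, α i a ≤ 1 := fun i a => by
    rw [← hα1 i]; exact Finset.single_le_sum (fun a _ => hα0 i a) (Finset.mem_univ a)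
  have hξ : ∀ i a b, |ξ i a b| ≤ 1 := fun i a b => by
    have h0 := hα0 i b
    have h1 := hα1' i b
    simp only [ξ]
    rw [abs_le]
    split_ifs <;> constructor <;> linarith
  -- the vector `v i a` records that error times all rows and columns of the weights, so that the
  -- sum of the chosen vectors consists of the weighted row and column sums of the errors
  let v : Fin n → Fin m → EuclideanSpace ℝ (Fin m × Λ × Fin n × Bool) := fun i a =>
    WithLp.toLp 2 fun q => ξ i a q.1 * if q.2.2.2 then G q.2.1 i q.2.2.1 else G q.2.1 q.2.2.1 i
  have hv : ∀ i, ∑ a, α i a • v i a = 0 := by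
    intro i
    ext q
    have h1 : ∑ a, α i a * ξ i a q.1 = 0 := by
      simp only [ξ, mul_sub, mul_ite, mul_one, mul_zero, Finset.sum_sub_distrib,
        Finset.sum_ite_eq', Finset.mem_univ, if_true]
      rw [← Finset.sum_mul, hα1, one_mul, sub_self]
    simp only [v, WithLp.ofLp_sum, WithLp.ofLp_smul, Finset.sum_apply, Pi.smul_apply, smul_eq_mul,
      WithLp.ofLp_zero, Pi.zero_apply]
    simp_rw [← mul_assoc]
    rw [← Finset.sum_mul, h1, zero_mul]
  have hr : ∀ i a, ‖v i a‖ ^ 2 ≤ m * (Fintype.card Λ * (n * 2)) := by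
    intro i a
    rw [EuclideanSpace.norm_sq_eq]
    calc ∑ q, ‖v i a q‖ ^ 2 ≤ ∑ _q : Fin m × Λ × Fin n × Bool, (1 : ℝ) := by
          refine Finset.sum_le_sum fun q _ => pow_le_one₀ (norm_nonneg _) ?_
          simp only [v, Real.norm_eq_abs, abs_mul]
          refine mul_le_one₀ (hξ _ _ _) (abs_nonneg _) ?_
          split_ifs <;> exact hG _ _ _
      _ = m * (Fintype.card Λ * (n * 2)) := by simp
  obtain ⟨f, hf⟩ := exists_selection_norm_sum_sq_le Finset.univ α v hα0 hα1 hv hr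
  rw [Finset.card_univ, Fintype.card_fin, EuclideanSpace.norm_sq_eq] at hf
  refine ⟨f, fun l a b => ?_⟩
  set Q : ℝ := n * (m * (Fintype.card Λ * (n * 2))) with hQ
  have hcoord : ∀ (b : Fin m) (l : Λ) (j : Fin n) (β : Bool),
      (∑ i, v i (f i)) (b, l, j, β) =
        ∑ i, ξ i (f i) b * if β then G l i j else G l j i := by
    intro b l j β
    simp [v, WithLp.ofLp_sum]
  -- the squares of the weighted row sums and column sums of the rounding errors
  have hpart : ∀ (b : Fin m) (l : Λ) (β : Bool),
      ∑ j, (∑ i, ξ i (f i) b * if β then G l i j else G l j i) ^ 2 ≤ Q := by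
    intro b l β
    refine le_trans ?_ hf
    rw [Fintype.sum_prod_type]
    refine le_trans ?_ (Finset.single_le_sum (f := fun b => ∑ q : Λ × Fin n × Bool,
      ‖(∑ i, v i (f i)) (b, q)‖ ^ 2) (fun _ _ => Finset.sum_nonneg fun _ _ => sq_nonneg _)
      (Finset.mem_univ b))
    simp only [Fintype.sum_prod_type]
    refine le_trans ?_ (Finset.single_le_sum (f := fun l => ∑ j : Fin n, ∑ β : Bool,
      ‖(∑ i, v i (f i)) (b, l, j, β)‖ ^ 2) (fun _ _ => Finset.sum_nonneg fun _ _ =>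
        Finset.sum_nonneg fun _ _ => sq_nonneg _) (Finset.mem_univ l))
    refine Finset.sum_le_sum fun j _ => ?_
    refine le_trans (le_of_eq ?_) (Finset.single_le_sum (f := fun β : Bool =>
      ‖(∑ i, v i (f i)) (b, l, j, β)‖ ^ 2) (fun _ _ => sq_nonneg _) (Finset.mem_univ β))
    simp only [hcoord, Real.norm_eq_abs, sq_abs]
  have hCS : ∀ (x y : Fin n → ℝ), (∀ j, |x j| ≤ 1) → ∑ j, y j ^ 2 ≤ Q →
      |∑ j, x j * y j| ≤ √(n * Q) := by
    intro x y hx hy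
    refine Real.abs_le_sqrt ((Finset.sum_mul_sq_le_sq_mul_sq _ _ _).trans ?_)
    refine mul_le_mul ?_ hy (Finset.sum_nonneg fun _ _ => sq_nonneg _) (Nat.cast_nonneg _)
    calc ∑ j, x j ^ 2 ≤ ∑ _j : Fin n, (1 : ℝ) := Finset.sum_le_sum fun j _ => by
          rw [← sq_abs]; exact pow_le_one₀ (abs_nonneg _) (hx j)
      _ = n := by simp
  have h1 := hCS (fun j => if f j = b then 1 else 0)
    (fun j => ∑ i, ξ i (f i) a * if true then G l i j else G l j i)
    (fun j => by split_ifs <;> simp) (hpart a l true)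
  have h2 := hCS (fun i => α i a) (fun j => ∑ i, ξ i (f i) b * if false then G l i j else G l j i)
    (fun j => by rw [abs_of_nonneg (hα0 _ _)]; exact hα1' _ _) (hpart b l false)
  -- the two colour indicators are replaced by the fractional weights one after the other
  have e : ∑ i, ∑ j, α i a * α j b * G l i j -
      ∑ i, ∑ j, (if f i = a then 1 else 0) * (if f j = b then 1 else 0) * G l i j =
      -(∑ j, (if f j = b then 1 else 0) *
        ∑ i, ξ i (f i) a * if true then G l i j else G l j i) -
      ∑ i, α i a * ∑ j, ξ j (f j) b * if false then G l j i else G l i j := by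
    simp only [Finset.mul_sum, if_true, Bool.false_eq_true, if_false]
    rw [Finset.sum_comm (f := fun j i => (if f j = b then (1 : ℝ) else 0) *
      (ξ i (f i) a * G l i j)), ← Finset.sum_sub_distrib, ← Finset.sum_neg_distrib,
      ← Finset.sum_sub_distrib]
    refine Finset.sum_congr rfl fun i _ => ?_
    rw [← Finset.sum_sub_distrib, ← Finset.sum_neg_distrib, ← Finset.sum_sub_distrib]
    refine Finset.sum_congr rfl fun j _ => ?_
    simp only [ξ]
    ring
  rw [e]
  have h1 := abs_le.1 h1
  have h2 := abs_le.1 h2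
  rw [abs_le]
  constructor <;> linarith [h1.1, h1.2, h2.1, h2.2]

section Step

variable {n : ℕ}

lemma uniformOn_univ_fin_singleton (i : Fin n) :
    uniformOn (Set.univ : Set (Fin n)) {i} = (n : ℝ≥0∞)⁻¹ := by
  rw [uniformOn_univ, Measure.count_singleton, Fintype.card_fin, one_div]

/-- Integrals over rectangles of a step function. -/
lemma setIntegral_step_eq_sum {X : Type*} [MeasurableSpace X] {μ : Measure X}
    [IsProbabilityMeasure μ] {q : X → Fin n} (hq : Measurable q) (G : Fin n → Fin n → ℝ)
    {S T : Set X} (hS : MeasurableSet S) (hT : MeasurableSet T) :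
    ∫ p in S ×ˢ T, G (q p.1) (q p.2) ∂(μ.prod μ) =
      ∑ i, ∑ j, μ.real (S ∩ q ⁻¹' {i}) * μ.real (T ∩ q ⁻¹' {j}) * G i j := by
  have hqs := fun i => hq (measurableSet_singleton i)
  have hun : S ×ˢ T = ⋃ r : Fin n × Fin n, (S ∩ q ⁻¹' {r.1}) ×ˢ (T ∩ q ⁻¹' {r.2}) := by
    ext p; simp
  rw [hun, integral_iUnion_fintype (fun r : Fin n × Fin n =>
    (hS.inter (hqs r.1)).prod (hT.inter (hqs r.2))) ?_
    (fun r => (integrable_step hq G).integrableOn), Fintype.sum_prod_type]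
  · refine Finset.sum_congr rfl fun i _ => Finset.sum_congr rfl fun j _ => ?_
    rw [setIntegral_congr_fun (g := fun _ => G i j)
      ((hS.inter (hqs i)).prod (hT.inter (hqs j))), setIntegral_const, smul_eq_mul,
      measureReal_prod_prod]
    rintro p ⟨h1, h2⟩
    have h1 : q p.1 = i := h1.2
    have h2 : q p.2 = j := h2.2
    simp only [h1, h2]
  · intro r r' hrr
    refine Set.disjoint_left.2 fun p h1 h2 => hrr (Prod.ext ?_ ?_)
    · exact (show q p.1 = r.1 from h1.1.2).symm.trans h2.1.2
    · exact (show q p.2 = r.2 from h1.2.2).symm.trans h2.2.2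

variable [NeZero n]

lemma measurePreserving_cell :
    MeasurePreserving (cell n) volume (uniformOn (Set.univ : Set (Fin n))) := by
  refine ⟨measurable_cell, Measure.ext_of_singleton fun i => ?_⟩
  rw [Measure.map_apply measurable_cell (measurableSet_singleton i), volume_cell,
    uniformOn_univ_fin_singleton]

/-- The step representation of a kernel on a large vertex set is imitated by the kernel: the
proportions in which a colouring of `[0, 1]` divides the cells are rounded. -/
lemma exists_approximates_of_step (m : ℕ) {ε : ℝ} (hε : 0 < ε) (R : ℝ) :
    ∃ n₀ : ℕ, ∀ (n : ℕ) [NeZero n], n₀ ≤ n → ∀ (κ : Kernel (Fin n × Fin n) ℝ) [IsMarkovKernel κ],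
      blockLaw (uniformOn Set.univ) κ Set.univ Set.univ {x | R < |x|} ≤ ENNReal.ofReal (ε / 2) →
      Approximates m ε volume
        (κ.comap (Prod.map (cell n) (cell n)) (measurable_cell.prodMap measurable_cell))
        (uniformOn (Set.univ : Set (Fin n))) κ := by
  obtain ⟨N, g, K, η, hK, hη, hg, hg0, hg1, hgK, hLP⟩ := exists_test_functions hε R
  obtain ⟨n₀, hn₀⟩ := exists_nat_ge (8 * m * (N + 1) / η ^ 2)
  refine ⟨n₀, fun n _ hn κ _ htail c hc => ?_⟩
  have : NeZero m := ⟨by rintro rfl; exact (c 0).elim0⟩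
  have hn0 : (0 : ℝ) < n := by exact_mod_cast NeZero.pos n
  let G : Option (Fin N) → Fin n → Fin n → ℝ := fun l i j => ∫ x, g l x ∂(κ (i, j))
  have hG : ∀ l i j, |G l i j| ≤ 1 := fun l i j => by
    rw [abs_of_nonneg (integral_nonneg (hg0 l))]
    exact integral_kernel_le_one (hg l) (hg0 l) (hg1 l) _
  -- the proportion of the cell `i` that has the colour `a`
  let α : Fin n → Fin m → ℝ := fun i a => n * volume.real (c ⁻¹' {a} ∩ cell n ⁻¹' {i})
  have hcs := fun a => hc (measurableSet_singleton a)
  have hα1 : ∀ i, ∑ a, α i a = 1 := by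
    intro i
    have hi : MeasurableSet (cell n ⁻¹' {i}) := measurable_cell (measurableSet_singleton i)
    have hun : (⋃ a : Fin m, c ⁻¹' {a} ∩ cell n ⁻¹' {i}) = cell n ⁻¹' {i} := by ext; simp
    rw [← Finset.mul_sum, ← measureReal_iUnion_fintype _ fun a => (hcs a).inter hi, hun,
      measureReal_def, volume_cell, ENNReal.toReal_inv, ENNReal.toReal_natCast,
      mul_inv_cancel₀ hn0.ne']
    intro a a' haa
    refine Set.disjoint_left.2 fun x h1 h2 => haa ?_
    exact (show c x = a from h1.1).symm.trans h2.1
  obtain ⟨f, hf⟩ := exists_rounding α (fun i a => by positivity) hα1 G hG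
  have hbound : 2 * √(n * (n * (m * (Fintype.card (Option (Fin N)) * (n * 2))))) ≤ n ^ 2 * η := by
    have h1 : 8 * m * (N + 1) ≤ n * η ^ 2 := by
      have : (n₀ : ℝ) ≤ n := by exact_mod_cast hn
      exact (div_le_iff₀ (by positivity)).1 (hn₀.trans this)
    have h2 : √((n : ℝ) * (n * (m * (Fintype.card (Option (Fin N)) * (n * 2))))) ≤
        n ^ 2 * η / 2 := by
      refine Real.sqrt_le_iff.2 ⟨by positivity, ?_⟩
      rw [Fintype.card_option, Fintype.card_fin]
      push_cast
      have h3 : (n : ℝ) ^ 3 * (8 * m * (N + 1)) ≤ n ^ 3 * (n * η ^ 2) := by gcongr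
      nlinarith
    linarith
  refine ⟨f, measurable_of_finite f, fun a b => hLP _ _ inferInstance inferInstance ?_ fun l => ?_⟩
  · refine (blockLaw_le_univ (measurableSet_lt measurable_const (by fun_prop))).trans ?_
    have := blockLaw_comap (κ := κ) (measurePreserving_cell (n := n)) MeasurableSet.univ
      MeasurableSet.univ
    rw [Set.preimage_univ] at this
    rwa [this]
  · have e1 : ∫ x, g l x ∂(blockLaw volume (κ.comap (Prod.map (cell n) (cell n))
        (measurable_cell.prodMap measurable_cell)) (c ⁻¹' {a}) (c ⁻¹' {b})) =
        (∑ i, ∑ j, α i a * α j b * G l i j) / n ^ 2 := by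
      rw [integral_blockLaw (hg l) (hg0 l) (hg1 l)]
      refine (setIntegral_step_eq_sum measurable_cell (G l) (hcs a) (hcs b)).trans ?_
      rw [Finset.sum_div]
      refine Finset.sum_congr rfl fun i _ => ?_
      rw [Finset.sum_div]
      refine Finset.sum_congr rfl fun j _ => ?_
      simp only [α]
      field_simp
    have hone : ∀ (a : Fin m) (i : Fin n),
        (uniformOn (Set.univ : Set (Fin n))).real (f ⁻¹' {a} ∩ id ⁻¹' {i}) =
        (if f i = a then 1 else 0) / n := by
      intro a i
      by_cases h : f i = a
      · have : f ⁻¹' {a} ∩ id ⁻¹' {i} = {i} := by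
          ext j; simp only [Set.mem_inter_iff, Set.mem_preimage, Set.mem_singleton_iff, id]
          exact ⟨fun h => h.2, fun hj => ⟨hj ▸ h, hj⟩⟩
        rw [this, if_pos h, measureReal_def, uniformOn_univ_fin_singleton, ENNReal.toReal_inv,
          ENNReal.toReal_natCast, one_div]
      · have : f ⁻¹' {a} ∩ id ⁻¹' {i} = ∅ := by
          ext j; simp only [Set.mem_inter_iff, Set.mem_preimage, Set.mem_singleton_iff, id,
            Set.mem_empty_iff_false, iff_false]
          exact fun hj => h (hj.2 ▸ hj.1)
        rw [this, if_neg h, measureReal_empty, zero_div]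
    have e2 : ∫ x, g l x ∂(blockLaw (uniformOn (Set.univ : Set (Fin n))) κ (f ⁻¹' {a})
        (f ⁻¹' {b})) = (∑ i, ∑ j, (if f i = a then 1 else 0) * (if f j = b then 1 else 0) *
          G l i j) / n ^ 2 := by
      rw [integral_blockLaw (hg l) (hg0 l) (hg1 l)]
      refine (setIntegral_step_eq_sum (q := id) measurable_id (G l) (Set.toFinite _).measurableSet
        (Set.toFinite _).measurableSet).trans ?_
      rw [Finset.sum_div]
      refine Finset.sum_congr rfl fun i _ => ?_
      rw [Finset.sum_div]
      refine Finset.sum_congr rfl fun j _ => ?_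
      rw [hone, hone]
      field_simp
    rw [e1, e2, ← sub_div, abs_div, abs_of_pos (by positivity : (0 : ℝ) < n ^ 2),
      div_le_iff₀ (by positivity), mul_comm η]
    exact (hf l a b).trans hbound

end Step

/-! ### Completeness of the unlabelled cut distance -/

/-- Measures on the real line that are eventually close to a fixed finite measure, at every scale,
are eventually tight. -/
lemma eventually_tail_le_of_LPClose {ι : Type*} {l : Filter ι} {μ : ι → Measure ℝ}
    (h : ∀ ε > 0, ∃ ν : Measure ℝ, IsFiniteMeasure ν ∧ ∀ᶠ i in l, LPClose ε (μ i) ν) {ε : ℝ}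
    (hε : 0 < ε) : ∃ R : ℝ, ∀ᶠ i in l, μ i {x | R < |x|} ≤ ENNReal.ofReal ε := by
  obtain ⟨ν, _, hν⟩ := h (ε / 2) (by positivity)
  have htail := tendsto_measure_norm_gt_of_isTightMeasureSet (isTightMeasureSet_singleton (μ := ν))
  obtain ⟨R, hR⟩ := (ENNReal.tendsto_nhds_zero.1 htail (ENNReal.ofReal (ε / 2))
    (ENNReal.ofReal_pos.2 (by positivity))).exists
  simp only [Set.mem_singleton_iff, iSup_iSup_eq_left, Real.norm_eq_abs] at hR
  refine ⟨R + ε / 2, ?_⟩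
  filter_upwards [hν] with i hi
  refine ((hi _ (measurableSet_lt measurable_const (by fun_prop))).1).trans ?_
  rw [show ε = ε / 2 + ε / 2 by ring, ENNReal.ofReal_add (by positivity) (by positivity),
    ← show ε = ε / 2 + ε / 2 by ring]
  refine add_le_add ((measure_mono fun x hx => ?_).trans hR) le_rfl
  obtain ⟨z, hz, hxz⟩ := Metric.mem_thickening_iff.1 hx
  have hz : R + ε / 2 < |z| := hz
  rw [Real.dist_eq] at hxz
  have := abs_sub_abs_le_abs_sub z x
  rw [abs_sub_comm] at this
  show R < |x|
  linarith

namespace ProbGraphon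

/-- One of the two inequalities for the limit of block laws. The block is enclosed in an open set
and the portmanteau theorem is applied to the joint laws of the position and the value. -/
lemma exists_blockLaw_le_of_tendsto {ι : Type*} {l : Filter ι} [l.NeBot] {Z : ι → Kernel (I × I) ℝ}
    [∀ i, IsMarkovKernel (Z i)] {V : Kernel (I × I) ℝ} [IsMarkovKernel V]
    {ρ : ι → ProbabilityMeasure ((I × I) × ℝ)} {ρ' : ProbabilityMeasure ((I × I) × ℝ)}
    (hρ : ∀ i, (ρ i : Measure ((I × I) × ℝ)) = (volume : Measure (I × I)) ⊗ₘ Z i)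
    (hρ' : (ρ' : Measure ((I × I) × ℝ)) = (volume : Measure (I × I)) ⊗ₘ V)
    (h : Tendsto ρ l (𝓝 ρ')) {S T : Set I} (hS : MeasurableSet S) (hT : MeasurableSet T)
    {G : Set ℝ} (hG : IsOpen G) {δ : ℝ≥0∞} (hδ : δ ≠ 0) :
    ∀ᶠ i in l, blockLaw volume V S T G ≤ blockLaw volume (Z i) S T G + δ := by
  have hδ2 : δ / 2 ≠ 0 := by simpa using hδ
  obtain ⟨O, hSO, hO, hOlt⟩ := Set.exists_isOpen_lt_add (μ := (volume : Measure (I × I)))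
    (S ×ˢ T) (measure_ne_top _ _) hδ2
  have hOG := hO.prod hG
  have hlim := ProbabilityMeasure.le_liminf_measure_open_of_tendsto h hOG
  have hev : ∀ᶠ i in l, (ρ' : Measure ((I × I) × ℝ)) (O ×ˢ G) ≤
      (ρ i : Measure ((I × I) × ℝ)) (O ×ˢ G) + δ / 2 := by
    rcases eq_or_ne ((ρ' : Measure ((I × I) × ℝ)) (O ×ˢ G)) 0 with h0 | h0
    · rw [h0]; exact Eventually.of_forall fun _ => bot_le
    · have hlt := (ENNReal.sub_lt_self (measure_ne_top _ _) h0 hδ2).trans_le hlim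
      filter_upwards [eventually_lt_of_lt_liminf hlt] with i hi
      exact tsub_le_iff_right.1 hi.le
  filter_upwards [hev] with i hi
  rw [hρ, hρ', Measure.compProd_apply_prod hO.measurableSet hG.measurableSet,
    Measure.compProd_apply_prod hO.measurableSet hG.measurableSet] at hi
  rw [blockLaw_apply hG.measurableSet, blockLaw_apply hG.measurableSet]
  calc ∫⁻ p in S ×ˢ T, V p G ∂(volume.prod volume)
      ≤ ∫⁻ p in O, V p G ∂volume := lintegral_mono' (Measure.restrict_mono hSO le_rfl) le_rfl
    _ ≤ ∫⁻ p in O, Z i p G ∂volume + δ / 2 := hi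
    _ ≤ (∫⁻ p in S ×ˢ T, Z i p G ∂(volume.prod volume) + δ / 2) + δ / 2 := by
        gcongr
        rw [← Set.union_sdiff_cancel hSO]
        refine (lintegral_union_le _ _ _).trans (add_le_add le_rfl ?_)
        calc ∫⁻ p in O \ S ×ˢ T, Z i p G ∂volume ≤ ∫⁻ p in O \ S ×ˢ T, 1 ∂volume :=
              lintegral_mono fun p => prob_le_one
          _ ≤ δ / 2 := by
              rw [setLIntegral_one, measure_sdiff hSO (hS.prod hT).nullMeasurableSet
                (measure_ne_top _ _)]
              exact tsub_le_iff_left.2 hOlt.le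
    _ = _ := by rw [add_assoc, ENNReal.add_halves]

/-- The cut distance is complete: the joint laws of the position and the value are tight, and the
disintegration of a limit point is the limit. -/
lemma exists_cutDist_limit {Z : ℕ → Kernel (I × I) ℝ} [∀ i, IsMarkovKernel (Z i)]
    (h : ∀ ε : ℝ, 0 < ε → ∃ N, ∀ m ≥ N, ∀ n ≥ N, cutDist (Z m) (Z n) < ENNReal.ofReal ε) :
    ∃ V : Kernel (I × I) ℝ, IsMarkovKernel V ∧
      Tendsto (fun n => cutDist (Z n) V) atTop (𝓝 0) := by
  let ρ : ℕ → ProbabilityMeasure ((I × I) × ℝ) := fun n =>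
    ⟨(volume : Measure (I × I)) ⊗ₘ Z n, inferInstance⟩
  have hfst : ∀ n, (ρ n : Measure ((I × I) × ℝ)).fst = volume := fun n =>
    Measure.fst_compProd _ _
  have hsnd : ∀ n, (ρ n : Measure ((I × I) × ℝ)).snd = blockLaw volume (Z n) Set.univ Set.univ := by
    intro n
    ext B hB
    rw [Measure.snd_apply hB, blockLaw_apply hB, ← Set.univ_prod]
    refine (Measure.compProd_apply_prod MeasurableSet.univ hB).trans ?_
    rw [Set.univ_prod_univ]
    rfl
  have htight : IsTightMeasureSet {((μ : ProbabilityMeasure ((I × I) × ℝ)) :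
      Measure ((I × I) × ℝ)) | μ ∈ Set.range ρ} := by
    refine IsTightMeasureSet.prodMk IsTightMeasureSet.of_compactSpace ?_
    refine IsTightMeasureSet.subset (T := Set.range fun n =>
      blockLaw volume (Z n) Set.univ Set.univ) ?_ ?_
    · refine isTightMeasureSet_range_of_tendsto_limsup_measure_norm_gt ?_
      refine ENNReal.tendsto_nhds_zero.2 fun r hr => ?_
      obtain ⟨ε, hε, hεr⟩ := exists_ofReal_le hr
      obtain ⟨R, hR⟩ := eventually_tail_le_of_LPClose (l := atTop)
        (μ := fun n => blockLaw volume (Z n) Set.univ Set.univ) (fun ε hε => by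
          obtain ⟨N, hN⟩ := h ε hε
          refine ⟨blockLaw volume (Z N) Set.univ Set.univ, inferInstance, ?_⟩
          filter_upwards [eventually_ge_atTop N] with n hn
          exact blockLaw_close_of_cutDist_lt hε.le (hN n hn N le_rfl) MeasurableSet.univ
            MeasurableSet.univ) hε
      filter_upwards [eventually_ge_atTop R] with R' hR'
      refine limsup_le_of_le (by isBoundedDefault) ?_
      filter_upwards [hR] with n hn
      refine (measure_mono fun x hx => ?_).trans (hn.trans hεr)
      exact lt_of_le_of_lt hR' hx
    · rintro _ ⟨_, ⟨_, ⟨n, rfl⟩, rfl⟩, rfl⟩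
      exact ⟨n, (hsnd n).symm⟩
  let F : Ultrafilter ℕ := Ultrafilter.of atTop
  have hF : (F : Filter ℕ) ≤ atTop := Ultrafilter.of_le _
  obtain ⟨ρ', -, hρ'⟩ := (isCompact_closure_of_isTightMeasureSet htight).ultrafilter_le_nhds
    (F.map ρ) (le_principal_iff.2 (mem_of_superset (Ultrafilter.mem_map.2
      (univ_mem' fun n => Set.mem_range_self n)) subset_closure))
  have hlim : Tendsto ρ F (𝓝 ρ') := hρ'
  have hfst' : (ρ' : Measure ((I × I) × ℝ)).fst = volume := by
    have h1 := ProbabilityMeasure.tendsto_map_of_tendsto_of_continuous ρ ρ' hlim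
      (continuous_fst (X := I × I) (Y := ℝ))
    have h2 : Tendsto (fun n =>
        (ρ n).map (continuous_fst (X := I × I) (Y := ℝ)).measurable.aemeasurable) F (𝓝 (⟨volume, inferInstance⟩ : ProbabilityMeasure (I × I))) := by
      refine tendsto_const_nhds.congr fun n => ?_
      exact Subtype.ext (hfst n).symm
    exact congrArg (fun μ : ProbabilityMeasure (I × I) => (μ : Measure (I × I)))
      (tendsto_nhds_unique h1 h2)
  have hV : (ρ' : Measure ((I × I) × ℝ)) =
      (volume : Measure (I × I)) ⊗ₘ (ρ' : Measure ((I × I) × ℝ)).condKernel := by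
    conv_lhs => rw [← (ρ' : Measure ((I × I) × ℝ)).disintegrate
      (ρ' : Measure ((I × I) × ℝ)).condKernel, hfst']
  set V : Kernel (I × I) ℝ := (ρ' : Measure ((I × I) × ℝ)).condKernel
  refine ⟨V, inferInstance, ENNReal.tendsto_nhds_zero.2 fun r hr => ?_⟩
  obtain ⟨ε, hε, hεr⟩ := exists_ofReal_le hr
  obtain ⟨N, hN⟩ := h (ε / 2) (by positivity)
  filter_upwards [eventually_ge_atTop N] with n hn
  refine le_trans (cutDist_le_of_blockLaw_close hε.le fun S T hS hT => ?_) hεr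
  refine LPClose.symm (LPClose.of_left (by rw [blockLaw_univ, blockLaw_univ]) fun B hB => ?_)
  have hε2 : ENNReal.ofReal (ε / 2) ≠ 0 := (ENNReal.ofReal_pos.2 (by positivity)).ne'
  obtain ⟨m, hm1, hm2⟩ := ((exists_blockLaw_le_of_tendsto (fun n => rfl) hV hlim hS hT
    (Metric.isOpen_thickening (δ := ε / 2) (E := B)) hε2).and
    (hF (eventually_ge_atTop N))).exists
  have hclose := blockLaw_close_of_cutDist_lt (by positivity) (hN m hm2 n hn) hS hT
  calc blockLaw volume V S T B
      ≤ blockLaw volume V S T (Metric.thickening (ε / 2) B) :=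
        measure_mono (Metric.self_subset_thickening (by positivity) B)
    _ ≤ blockLaw volume (Z m) S T (Metric.thickening (ε / 2) B) + ENNReal.ofReal (ε / 2) := hm1
    _ ≤ blockLaw volume (Z n) S T (Metric.thickening (ε / 2) (Metric.thickening (ε / 2) B)) +
          ENNReal.ofReal (ε / 2) + ENNReal.ofReal (ε / 2) := by
        gcongr
        exact (hclose _ Metric.isOpen_thickening.measurableSet).1
    _ ≤ blockLaw volume (Z n) S T (Metric.thickening ε B) + ENNReal.ofReal ε := by
        rw [add_assoc, ← ENNReal.ofReal_add (by positivity) (by positivity), add_halves]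
        gcongr
        refine (Metric.thickening_thickening_subset _ _ _).trans ?_
        rw [add_halves]

lemma cutDist_self (U : Kernel (I × I) ℝ) : cutDist U U = 0 := by
  simp [cutDist, levyProkhorovEDist_self]

lemma unlabelledCutDist_self (U : Kernel (I × I) ℝ) : unlabelledCutDist U U = 0 := by
  refine le_antisymm ((unlabelledCutDist_le (MeasurePreserving.id volume)
    Function.bijective_id).trans ?_) bot_le
  rw [relabel_of_id (φ := id) _ fun _ => rfl, cutDist_self]

/-- The relabellings that nearly attain the distances of consecutive terms of a fast Cauchy sequence
are composed, which turns it into a Cauchy sequence for the cut distance. -/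
lemma exists_limit_of_unlabelledCutDist_lt {U : ℕ → Kernel (I × I) ℝ} [∀ i, IsMarkovKernel (U i)]
    (h : ∀ n, unlabelledCutDist (U n) (U (n + 1)) < 1 / 2 ^ n) :
    ∃ V : Kernel (I × I) ℝ, IsMarkovKernel V ∧
      Tendsto (fun n => unlabelledCutDist (U n) V) atTop (𝓝 0) := by
  choose φ hφ hφb hlt using fun n => exists_of_unlabelledCutDist_lt (h n)
  let ψ : ℕ → {f : I → I // MeasurePreserving f volume volume ∧ Function.Bijective f} := fun n =>
    Nat.rec ⟨id, MeasurePreserving.id volume, Function.bijective_id⟩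
      (fun n f => ⟨φ n ∘ f.1, (hφ n).comp f.2.1, (hφb n).comp f.2.2⟩) n
  let Z : ℕ → Kernel (I × I) ℝ := fun n => relabel (U n) (ψ n).1 (ψ n).2.1.measurable
  have hZ : ∀ n, cutDist (Z n) (Z (n + 1)) ≤ 1 / 2 ^ n := by
    intro n
    have e : Z (n + 1) = relabel (relabel (U (n + 1)) (φ n) (hφ n).measurable) (ψ n).1
        (ψ n).2.1.measurable := (relabel_relabel (hφ n).measurable (ψ n).2.1.measurable).symm
    rw [e]
    exact (cutDist_relabel (ψ n).2.1 (ψ n).2.2).trans_le (hlt n).le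
  let : PseudoEMetricSpace (Kernel (I × I) ℝ) :=
    { edist := cutDist
      edist_self := cutDist_self
      edist_comm := fun _ _ => cutDist_comm
      edist_triangle := fun _ _ _ => cutDist_triangle }
  have hcauchy : CauchySeq Z := cauchySeq_of_edist_le_geometric_two (C := 1) (by simp) hZ
  have : ∀ n, IsMarkovKernel (Z n) := fun n =>
    inferInstanceAs (IsMarkovKernel (relabel (U n) _ _))
  obtain ⟨V, hV, hlim⟩ := exists_cutDist_limit (Z := Z) fun ε hε =>
    EMetric.cauchySeq_iff.1 hcauchy _ (ENNReal.ofReal_pos.2 hε)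
  refine ⟨V, hV, tendsto_of_tendsto_of_tendsto_of_le_of_le tendsto_const_nhds hlim
    (fun _ => bot_le) fun n => ?_⟩
  obtain ⟨χ, hχ, hχb, hl, hr⟩ := exists_inverse (ψ n).2.1 (ψ n).2.2
  refine (unlabelledCutDist_le hχ hχb).trans (le_of_eq ?_)
  rw [← cutDist_relabel (ψ n).2.1 (ψ n).2.2, relabel_relabel, relabel_of_id (φ := χ ∘ _) _ hl]

/-- The unlabelled cut distance is complete. -/
theorem exists_unlabelledCutDist_limit {U : ℕ → Kernel (I × I) ℝ} [∀ i, IsMarkovKernel (U i)]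
    (h : ∀ ε : ℝ≥0∞, 0 < ε → ∃ N, ∀ m ≥ N, ∀ n ≥ N, unlabelledCutDist (U m) (U n) < ε) :
    ∃ V : Kernel (I × I) ℝ, IsMarkovKernel V ∧
      Tendsto (fun n => unlabelledCutDist (U n) V) atTop (𝓝 0) := by
  let : PseudoEMetricSpace {V : Kernel (I × I) ℝ // IsMarkovKernel V} :=
    { edist := fun U V => unlabelledCutDist U.1 V.1
      edist_self := fun U => unlabelledCutDist_self U.1
      edist_comm := fun _ _ => unlabelledCutDist_comm
      edist_triangle := fun _ _ _ => unlabelledCutDist_triangle }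
  have hcomplete : CompleteSpace {V : Kernel (I × I) ℝ // IsMarkovKernel V} := by
    refine EMetric.complete_of_convergent_controlled_sequences (fun n => 1 / 2 ^ n)
      (fun n => ENNReal.div_pos one_ne_zero (by simp)) fun u hu => ?_
    have := fun n => (u n).2
    obtain ⟨V, hV, hlim⟩ := exists_limit_of_unlabelledCutDist_lt (U := fun n => (u n).1)
      fun n => hu n n (n + 1) le_rfl n.le_succ
    exact ⟨⟨V, hV⟩, tendsto_iff_edist_tendsto_0.2 hlim⟩
  let u : ℕ → {V : Kernel (I × I) ℝ // IsMarkovKernel V} := fun n => ⟨U n, inferInstance⟩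
  have hu : CauchySeq u := EMetric.cauchySeq_iff.2 h
  obtain ⟨V, hV⟩ := cauchySeq_tendsto_of_complete hu
  exact ⟨V.1, V.2, tendsto_iff_edist_tendsto_0.1 hV⟩

end ProbGraphon

/-! ### Weighted graphs and their step representations -/

/-- A family that is imitated by a single kernel is tight. -/
lemma Imitates.tightAlong {ι : Type*} {l : Filter ι} {X : ι → Type*} [∀ i, MeasurableSpace (X i)]
    {μ : ∀ i, Measure (X i)} {κ : ∀ i, Kernel (X i × X i) ℝ} {Y : Type*} [MeasurableSpace Y]
    {ν : Measure Y} [IsProbabilityMeasure ν] {κ' : Kernel (Y × Y) ℝ} [IsMarkovKernel κ']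
    (h : Imitates l μ κ (fun _ => ν) (fun _ => κ')) : TightAlong l μ κ := fun _ hε =>
  eventually_tail_le_of_LPClose (fun ε hε => ⟨blockLaw ν κ' Set.univ Set.univ, inferInstance,
    (h 1 ε hε).mono fun _ hi => hi.total⟩) hε

/-- A sequence whose members asymptotically imitate each other is tight. -/
lemma TightAlong.of_imitates_prod {X : ℕ → Type*} [∀ i, MeasurableSpace (X i)]
    {μ : ∀ i, Measure (X i)} [∀ i, IsProbabilityMeasure (μ i)] {κ : ∀ i, Kernel (X i × X i) ℝ}
    [∀ i, IsMarkovKernel (κ i)]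
    (h : Imitates (atTop : Filter (ℕ × ℕ)) (fun p => μ p.1) (fun p => κ p.1) (fun p => μ p.2)
      (fun p => κ p.2)) : TightAlong atTop μ κ := fun _ hε =>
  eventually_tail_le_of_LPClose (fun ε hε => by
    obtain ⟨⟨a, b⟩, hab⟩ := eventually_atTop.1 (h 1 ε hε)
    refine ⟨blockLaw (μ b) (κ b) Set.univ Set.univ, inferInstance, ?_⟩
    filter_upwards [eventually_ge_atTop a] with m hm
    exact (hab (m, b) ⟨hm, le_rfl⟩).total) hε

lemma TightAlong.comp {ι ι' : Type*} {l : Filter ι} {l' : Filter ι'} {X : ι → Type*}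
    [∀ i, MeasurableSpace (X i)] {μ : ∀ i, Measure (X i)} {κ : ∀ i, Kernel (X i × X i) ℝ}
    (h : TightAlong l μ κ) {f : ι' → ι} (hf : Tendsto f l' l) :
    TightAlong l' (fun i => μ (f i)) (fun i => κ (f i)) := fun ε hε => by
  obtain ⟨R, hR⟩ := h ε hε
  exact ⟨R, hf.eventually hR⟩

lemma imitates_of_tendsto_unlabelledCutDist {ι : Type*} {l : Filter ι}
    {U V : ι → Kernel (I × I) ℝ}
    (h : Tendsto (fun i => ProbGraphon.unlabelledCutDist (U i) (V i)) l (𝓝 0)) :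
    Imitates l (fun _ => volume) U (fun _ => volume) V := fun m ε hε => by
  filter_upwards [h.eventually (gt_mem_nhds (ENNReal.ofReal_pos.2 hε))] with i hi
  exact ProbGraphon.approximates_of_unlabelledCutDist_lt hε.le m hi

namespace WeightedGraph

instance (H : WeightedGraph) : NeZero H.order := ⟨H.order_pos.ne'⟩

instance (H : WeightedGraph) : IsMarkovKernel H.stepGraphon :=
  inferInstanceAs (IsMarkovKernel H.stepPVariable.graphon)

variable {Ω : Type*} [MeasurableSpace Ω] (P : Measure Ω) [IsProbabilityMeasure P]

lemma comap_graphon_toPVariable (H : WeightedGraph) :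
    ((H.toPVariable P).graphon).comap (Prod.map (cell H.order) (cell H.order))
      (measurable_cell.prodMap measurable_cell) = H.stepGraphon := by
  ext1 x
  have h1 : ∀ r : ℝ, P.map (fun _ => r) = (volume : Measure I).map (fun _ => r) := fun r => by
    rw [Measure.map_const, Measure.map_const, measure_univ, measure_univ]
  exact h1 (H.adjMatrix (H.stepIndex x.1) (H.stepIndex x.2))

lemma blockLaw_stepGraphon_univ (H : WeightedGraph) :
    blockLaw volume H.stepGraphon Set.univ Set.univ =
      blockLaw (uniformOn Set.univ) (H.toPVariable P).graphon Set.univ Set.univ := by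
  have h := blockLaw_comap (κ := (H.toPVariable P).graphon) (measurePreserving_cell (n := H.order))
    MeasurableSet.univ MeasurableSet.univ
  rwa [Set.preimage_univ, comap_graphon_toPVariable] at h

section Family

variable {ι : Type*} {l : Filter ι} {H : ι → WeightedGraph}

lemma imitates_toPVariable_stepGraphon :
    Imitates l (fun _ => uniformOn Set.univ) (fun i => ((H i).toPVariable P).graphon)
      (fun _ => volume) (fun i => (H i).stepGraphon) := fun m ε hε =>
  Eventually.of_forall fun i => by
    have h := Approximates.comap (κ := ((H i).toPVariable P).graphon) (m := m)
      (measurePreserving_cell (n := (H i).order)) hε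
    rwa [comap_graphon_toPVariable] at h

lemma imitates_stepGraphon_toPVariable (hH : Tendsto (fun i => (H i).order) l atTop)
    (ht : TightAlong l (fun _ => volume) (fun i => (H i).stepGraphon)) :
    Imitates l (fun _ => volume) (fun i => (H i).stepGraphon)
      (fun _ => uniformOn Set.univ) (fun i => ((H i).toPVariable P).graphon) := fun m ε hε => by
  obtain ⟨R, hR⟩ := ht (ε / 2) (by positivity)
  obtain ⟨n₀, hn₀⟩ := exists_approximates_of_step m hε R
  filter_upwards [hR, hH.eventually_ge_atTop n₀] with i hi hn
  rw [blockLaw_stepGraphon_univ P] at hi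
  have h := hn₀ (H i).order hn ((H i).toPVariable P).graphon hi
  rwa [comap_graphon_toPVariable] at h

lemma tightAlong_stepGraphon
    (ht : TightAlong l (fun _ => uniformOn Set.univ) fun i => ((H i).toPVariable P).graphon) :
    TightAlong l (fun _ => volume) (fun i => (H i).stepGraphon) := fun ε hε => by
  obtain ⟨R, hR⟩ := ht ε hε
  exact ⟨R, hR.mono fun i hi => by rwa [blockLaw_stepGraphon_univ P]⟩

/-- Imitation by a fixed kernel may be tested on the graphs or on their step representations. -/
lemma imitates_toPVariable_iff {Y : ι → Type*} [∀ i, MeasurableSpace (Y i)]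
    {ν : ∀ i, Measure (Y i)} {κ : ∀ i, Kernel (Y i × Y i) ℝ}
    (hH : Tendsto (fun i => (H i).order) l atTop)
    (ht : TightAlong l (fun _ => volume) (fun i => (H i).stepGraphon)) :
    Imitates l (fun _ => uniformOn Set.univ) (fun i => ((H i).toPVariable P).graphon) ν κ ↔
      Imitates l (fun _ => volume) (fun i => (H i).stepGraphon) ν κ :=
  ⟨fun h => (imitates_stepGraphon_toPVariable P hH ht).trans h,
    fun h => (imitates_toPVariable_stepGraphon P).trans h⟩

lemma imitates_toPVariable_iff' {Y : ι → Type*} [∀ i, MeasurableSpace (Y i)]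
    {ν : ∀ i, Measure (Y i)} {κ : ∀ i, Kernel (Y i × Y i) ℝ}
    (hH : Tendsto (fun i => (H i).order) l atTop)
    (ht : TightAlong l (fun _ => volume) (fun i => (H i).stepGraphon)) :
    Imitates l ν κ (fun _ => uniformOn Set.univ) (fun i => ((H i).toPVariable P).graphon) ↔
      Imitates l ν κ (fun _ => volume) (fun i => (H i).stepGraphon) :=
  ⟨fun h => h.trans (imitates_toPVariable_stepGraphon P),
    fun h => h.trans (imitates_stepGraphon_toPVariable P hH ht)⟩

lemma imitates_toPVariable_toPVariable_iff {H' : ι → WeightedGraph}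
    (hH : Tendsto (fun i => (H i).order) l atTop) (hH' : Tendsto (fun i => (H' i).order) l atTop)
    (ht : TightAlong l (fun _ => volume) (fun i => (H i).stepGraphon))
    (ht' : TightAlong l (fun _ => volume) (fun i => (H' i).stepGraphon)) :
    Imitates l (fun _ => uniformOn Set.univ) (fun i => ((H i).toPVariable P).graphon)
      (fun _ => uniformOn Set.univ) (fun i => ((H' i).toPVariable P).graphon) ↔
      Imitates l (fun _ => volume) (fun i => (H i).stepGraphon)
        (fun _ => volume) (fun i => (H' i).stepGraphon) :=
  (imitates_toPVariable_iff P hH ht).trans (imitates_toPVariable_iff' P hH' ht')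

end Family

end WeightedGraph

/-- Every probability graphon on `[0, 1]` comes from a `P`-variable, on copies of `[0, 1]` in
prescribed universes. -/
lemma exists_pVariable_approximates (V : Kernel (I × I) ℝ) [IsMarkovKernel V] :
    ∃ (μ₁ : Measure (ULift.{v} I)) (μ₂ : Measure (ULift.{w} I)) (_ : IsProbabilityMeasure μ₁)
      (_ : IsProbabilityMeasure μ₂) (W : PVariable μ₁ μ₂), ∀ m ε, 0 < ε →
      Approximates m ε volume V μ₁ W.graphon ∧ Approximates m ε μ₁ W.graphon volume V := by
  obtain ⟨f, hf, hfV⟩ := V.exists_measurable_map_eq_unitInterval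
  have hup : ∀ {A : Type} [MeasurableSpace A] (Q : Measure A),
      MeasurePreserving (ULift.up : A → ULift.{v} A) Q (Q.map ULift.up) := fun Q =>
    ⟨measurable_up, rfl⟩
  have hdown : MeasurePreserving (ULift.down : ULift.{v} I → I)
      ((volume : Measure I).map ULift.up) volume := by
    refine ⟨measurable_down, ?_⟩
    rw [Measure.map_map measurable_down measurable_up]
    exact Measure.map_id
  let W : PVariable ((volume : Measure I).map (ULift.up.{v}))
      ((volume : Measure I).map (ULift.up.{w})) :=
    { toFun := fun p => f (p.1.down, p.2.1.down) p.2.2.down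
      measurable_toFun := hf.comp
        (((measurable_down.comp measurable_fst).prodMk
          (measurable_down.comp measurable_snd.fst)).prodMk
          (measurable_down.comp measurable_snd.snd)) }
  have hP1 : IsProbabilityMeasure ((volume : Measure I).map (ULift.up.{v})) :=
    Measure.isProbabilityMeasure_map measurable_up.aemeasurable
  have hP2 : IsProbabilityMeasure ((volume : Measure I).map (ULift.up.{w})) :=
    Measure.isProbabilityMeasure_map measurable_up.aemeasurable
  have hW : ∀ x, W.graphon x = V (x.1.down, x.2.down) := by
    intro x
    rw [← hfV]
    refine (Measure.map_map (f := ULift.up.{w}) ?_ measurable_up).trans rfl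
    exact W.measurable_toFun.comp (by fun_prop : Measurable fun z : ULift.{w} I => (x.1, x.2, z))
  refine ⟨_, _, hP1, hP2, W, fun m ε hε => ⟨?_, ?_⟩⟩
  · have h := Approximates.comap (κ := V) (m := m) hdown hε
    have e : V.comap (Prod.map ULift.down ULift.down)
        (hdown.measurable.prodMap hdown.measurable) = W.graphon := by
      ext1 x
      exact (hW x).symm
    rwa [e] at h
  · have h := Approximates.comap (κ := W.graphon) (m := m) (hup volume) hε
    have e : W.graphon.comap (Prod.map ULift.up ULift.up)
        ((hup volume).measurable.prodMap (hup volume).measurable) = V := by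
      ext1 x
      exact hW _
    rwa [e] at h

lemma cauchy_iff_tendsto_atTop_prod (d : ℕ → ℕ → ℝ≥0∞) :
    (∀ ε : ℝ≥0∞, 0 < ε → ∃ N : ℕ, ∀ m ≥ N, ∀ n ≥ N, d m n < ε) ↔
      Tendsto (fun p : ℕ × ℕ => d p.1 p.2) atTop (𝓝 0) := by
  constructor
  · intro h
    refine ENNReal.tendsto_nhds_zero.2 fun ε hε => ?_
    obtain ⟨N, hN⟩ := h ε hε
    filter_upwards [eventually_ge_atTop (N, N)] with p hp
    exact (hN _ hp.1 _ hp.2).le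
  · intro h ε hε
    obtain ⟨⟨a, b⟩, hab⟩ := eventually_atTop.1 (h.eventually (gt_mem_nhds hε))
    exact ⟨max a b, fun m hm n hn =>
      hab (m, n) ⟨(le_max_left _ _).trans hm, (le_max_right _ _).trans hn⟩⟩

section Comparison

open WeightedGraph ProbGraphon

variable {Ω : Type*} [MeasurableSpace Ω] (P : Measure Ω) [IsProbabilityMeasure P]
  {H : ℕ → WeightedGraph}

lemma tendsto_atTop_prod_fst : Tendsto (Prod.fst : ℕ × ℕ → ℕ) atTop atTop := by
  rw [← prod_atTop_atTop_eq]; exact tendsto_fst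

lemma tendsto_atTop_prod_snd : Tendsto (Prod.snd : ℕ × ℕ → ℕ) atTop atTop := by
  rw [← prod_atTop_atTop_eq]; exact tendsto_snd

lemma Imitates.swap {X : ℕ → Type*} [∀ i, MeasurableSpace (X i)] {μ : ∀ i, Measure (X i)}
    {κ : ∀ i, Kernel (X i × X i) ℝ}
    (h : Imitates (atTop : Filter (ℕ × ℕ)) (fun p => μ p.1) (fun p => κ p.1) (fun p => μ p.2)
      (fun p => κ p.2)) : Imitates (atTop : Filter (ℕ × ℕ)) (fun p => μ p.2) (fun p => κ p.2)
      (fun p => μ p.1) (fun p => κ p.1) := by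
  have hswap : Tendsto (Prod.swap : ℕ × ℕ → ℕ × ℕ) atTop atTop := by
    rw [← prod_atTop_atTop_eq]; exact tendsto_snd.prodMk tendsto_fst
  exact h.comp hswap

/-- If the graphs asymptotically imitate each other then their step representations form a Cauchy
sequence for the unlabelled cut distance. -/
lemma tendsto_unlabelledCutDist_stepGraphon (hH : Tendsto (fun n => (H n).order) atTop atTop)
    (h : Imitates (atTop : Filter (ℕ × ℕ)) (fun _ => uniformOn Set.univ)
      (fun p => ((H p.1).toPVariable P).graphon) (fun _ => uniformOn Set.univ)
      (fun p => ((H p.2).toPVariable P).graphon)) :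
    Tendsto (fun p : ℕ × ℕ => unlabelledCutDist (H p.1).stepGraphon (H p.2).stepGraphon)
      atTop (𝓝 0) := by
  have ht : TightAlong atTop (fun _ => volume) (fun n => (H n).stepGraphon) :=
    tightAlong_stepGraphon P (TightAlong.of_imitates_prod (X := fun n => Fin (H n).order)
      (μ := fun _ => uniformOn Set.univ) (κ := fun n => ((H n).toPVariable P).graphon) h)
  have ht1 : TightAlong (atTop : Filter (ℕ × ℕ)) (fun _ => volume)
      (fun p => (H p.1).stepGraphon) := ht.comp tendsto_atTop_prod_fst
  have ht2 : TightAlong (atTop : Filter (ℕ × ℕ)) (fun _ => volume)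
      (fun p => (H p.2).stepGraphon) := ht.comp tendsto_atTop_prod_snd
  have key := (imitates_toPVariable_toPVariable_iff P (hH.comp tendsto_atTop_prod_fst)
    (hH.comp tendsto_atTop_prod_snd) ht1 ht2).1 h
  exact tendsto_unlabelledCutDist_of_imitates ht1 key
    (Imitates.swap (X := fun _ => I) (μ := fun _ => volume) (κ := fun n => (H n).stepGraphon) key)

lemma cauchy_dM_iff (hH : Tendsto (fun n => (H n).order) atTop atTop) :
    Tendsto (fun p : ℕ × ℕ => ((H p.1).toPVariable P).dM ((H p.2).toPVariable P)) atTop (𝓝 0) ↔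
      Tendsto (fun p : ℕ × ℕ => unlabelledCutDist (H p.1).stepGraphon (H p.2).stepGraphon)
        atTop (𝓝 0) := by
  constructor
  · intro h
    exact tendsto_unlabelledCutDist_stepGraphon P hH (PVariable.imitates_of_tendsto_dM h)
  · intro h
    have h1 := imitates_of_tendsto_unlabelledCutDist h
    have ht : TightAlong atTop (fun _ => volume) (fun n => (H n).stepGraphon) :=
      TightAlong.of_imitates_prod (X := fun _ => I) (μ := fun _ => volume)
        (κ := fun n => (H n).stepGraphon) h1
    have ht1 : TightAlong (atTop : Filter (ℕ × ℕ)) (fun _ => volume)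
        (fun p => (H p.1).stepGraphon) := ht.comp tendsto_atTop_prod_fst
    have ht2 : TightAlong (atTop : Filter (ℕ × ℕ)) (fun _ => volume)
        (fun p => (H p.2).stepGraphon) := ht.comp tendsto_atTop_prod_snd
    have key := (imitates_toPVariable_toPVariable_iff P (hH.comp tendsto_atTop_prod_fst)
      (hH.comp tendsto_atTop_prod_snd) ht1 ht2).2 h1
    exact PVariable.tendsto_dM_of_imitates key
      (Imitates.swap (X := fun n => Fin (H n).order) (μ := fun _ => uniformOn Set.univ)
        (κ := fun n => ((H n).toPVariable P).graphon) key)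

lemma tendsto_dM_iff (hH : Tendsto (fun n => (H n).order) atTop atTop) {Ω₂ : Type*}
    [MeasurableSpace Ω₂] {μ₂ : Measure Ω₂} [IsProbabilityMeasure μ₂]
    (W : PVariable (volume : Measure I) μ₂) :
    Tendsto (fun n => ((H n).toPVariable P).dM W) atTop (𝓝 0) ↔
      Tendsto (fun n => unlabelledCutDist (H n).stepGraphon W.graphon) atTop (𝓝 0) := by
  constructor
  · intro h
    have h1 := PVariable.imitates_of_tendsto_dM h
    have h2 := PVariable.imitates_of_tendsto_dM
      (h.congr fun n => PVariable.dM_comm ((H n).toPVariable P) W)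
    have ht := tightAlong_stepGraphon P h1.tightAlong
    exact tendsto_unlabelledCutDist_of_imitates ht
      ((imitates_toPVariable_iff P hH ht).1 h1) ((imitates_toPVariable_iff' P hH ht).1 h2)
  · intro h
    have h1 := imitates_of_tendsto_unlabelledCutDist h
    have h2 := imitates_of_tendsto_unlabelledCutDist (h.congr fun n => unlabelledCutDist_comm)
    have ht : TightAlong atTop (fun _ => volume) (fun n => (H n).stepGraphon) :=
      Imitates.tightAlong h1
    exact PVariable.tendsto_dM_of_imitates ((imitates_toPVariable_iff P hH ht).2 h1)
      ((imitates_toPVariable_iff' P hH ht).2 h2)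

end Comparison

end

/-- For finite weighted graphs `H_n` whose numbers of vertices tend to infinity, convergence of
`H_n` (as `P`-variables) in `d_M` is equivalent to convergence of the probability graphons of the
step representations in `δ_□`: for convergence to some limit, for the Cauchy property, and for
convergence to a prescribed limit. -/
theorem mainTheorem6 {Ω : Type u} [MeasurableSpace Ω] (P : Measure Ω) [IsProbabilityMeasure P]
    (H : ℕ → WeightedGraph) (hH : Tendsto (fun n => (H n).order) atTop atTop) :
    ((∃ (Ω₁ : Type v) (Ω₂ : Type w) (_ : MeasurableSpace Ω₁) (_ : MeasurableSpace Ω₂)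
          (μ₁ : Measure Ω₁) (μ₂ : Measure Ω₂) (_ : IsProbabilityMeasure μ₁)
          (_ : IsProbabilityMeasure μ₂) (W : PVariable μ₁ μ₂),
          Tendsto (fun n => ((H n).toPVariable P).dM W) atTop (𝓝 0)) ↔
        ∃ V : Kernel (I × I) ℝ, IsMarkovKernel V ∧
          Tendsto (fun n => ProbGraphon.unlabelledCutDist (H n).stepGraphon V) atTop (𝓝 0)) ∧
    ((∀ ε : ℝ≥0∞, 0 < ε → ∃ N : ℕ, ∀ m ≥ N, ∀ n ≥ N,
          ((H m).toPVariable P).dM ((H n).toPVariable P) < ε) ↔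
        ∀ ε : ℝ≥0∞, 0 < ε → ∃ N : ℕ, ∀ m ≥ N, ∀ n ≥ N,
          ProbGraphon.unlabelledCutDist (H m).stepGraphon (H n).stepGraphon < ε) ∧
    (∀ (Ω₂ : Type w) [MeasurableSpace Ω₂] (μ₂ : Measure Ω₂) [IsProbabilityMeasure μ₂]
        (W : PVariable (volume : Measure I) μ₂),
        Tendsto (fun n => ((H n).toPVariable P).dM W) atTop (𝓝 0) ↔
          Tendsto (fun n => ProbGraphon.unlabelledCutDist (H n).stepGraphon W.graphon)
            atTop (𝓝 0)) := by

  refine ⟨⟨?_, ?_⟩, ?_, fun Ω₂ _ μ₂ _ W => tendsto_dM_iff P hH W⟩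
  · rintro ⟨Ω₁, Ω₂, _, _, μ₁, μ₂, _, _, W, h⟩
    have h1 := PVariable.imitates_of_tendsto_dM h
    have h2 := PVariable.imitates_of_tendsto_dM
      (h.congr fun n => PVariable.dM_comm ((H n).toPVariable P) W)
    have h3 : Imitates (atTop : Filter (ℕ × ℕ)) (fun _ => uniformOn Set.univ)
        (fun p => ((H p.1).toPVariable P).graphon) (fun _ => μ₁) (fun _ => W.graphon) :=
      h1.comp tendsto_atTop_prod_fst
    have h4 : Imitates (atTop : Filter (ℕ × ℕ)) (fun _ => μ₁) (fun _ => W.graphon)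
        (fun _ => uniformOn Set.univ) (fun p => ((H p.2).toPVariable P).graphon) :=
      h2.comp tendsto_atTop_prod_snd
    refine ProbGraphon.exists_unlabelledCutDist_limit
      ((cauchy_iff_tendsto_atTop_prod fun m n =>
        ProbGraphon.unlabelledCutDist (H m).stepGraphon (H n).stepGraphon).2 ?_)
    exact tendsto_unlabelledCutDist_stepGraphon P hH (h3.trans h4)
  · rintro ⟨V, _, h⟩
    obtain ⟨μ₁, μ₂, _, _, W, hW⟩ := exists_pVariable_approximates.{v, w} V
    have h1 := imitates_of_tendsto_unlabelledCutDist h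
    have h2 := imitates_of_tendsto_unlabelledCutDist
      (h.congr fun n => ProbGraphon.unlabelledCutDist_comm)
    have ht : TightAlong atTop (fun _ => volume) (fun n => (H n).stepGraphon) :=
      Imitates.tightAlong h1
    have hVW : Imitates (atTop : Filter ℕ) (fun _ => volume) (fun _ => V) (fun _ => μ₁)
        (fun _ => W.graphon) := fun m ε hε => Eventually.of_forall fun _ => (hW m ε hε).1
    have hWV : Imitates (atTop : Filter ℕ) (fun _ => μ₁) (fun _ => W.graphon) (fun _ => volume)
        (fun _ => V) := fun m ε hε => Eventually.of_forall fun _ => (hW m ε hε).2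
    exact ⟨ULift.{v} I, ULift.{w} I, inferInstance, inferInstance, μ₁, μ₂, inferInstance,
      inferInstance, W, PVariable.tendsto_dM_of_imitates
        ((WeightedGraph.imitates_toPVariable_iff P hH ht).2 (h1.trans hVW))
        ((WeightedGraph.imitates_toPVariable_iff' P hH ht).2 (hWV.trans h2))⟩
  · rw [cauchy_iff_tendsto_atTop_prod fun m n => ((H m).toPVariable P).dM ((H n).toPVariable P),
      cauchy_iff_tendsto_atTop_prod fun m n =>
        ProbGraphon.unlabelledCutDist (H m).stepGraphon (H n).stepGraphon]
    exact cauchy_dM_iff P hH
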